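/- Let $\mathcal K_0$ be the set of convex bodies (compact convex sets) $K\subset\mathbb R^n$ with the origin in their interior. For $K\in\mathcal K_0$ let $\mu_K$ be the surface area measure on $\partial K$, $N_K(x)$ the outer unit normal and $\kappa_K(x)$ the generalized Gauss curvature at $x\in\partial K$ (both exist for $\mu_K$-almost every $x$), $K^\circ=\{y:\langle x,y\rangle\le 1\ \text{for all } x\in K\}$ the polar body, and $|\cdot|$ the volume. Put $$p_K(x)=\frac{\kappa_K(x)}{\langle x,N_K(x)\rangle^n\, n|K^\circ|},\quad q_K(x)=\frac{\langle x,N_K(x)\rangle}{n|K|},\quad \tilde p_K(x)=\frac{\kappa_K(x)}{\langle x,N_K(x)\rangle^n},\quad \tilde q_K(x)=\langle x,N_K(x)\rangle,$$ and $P_K=p_K\mu_K$, $Q_K=q_K\mu_K$, $\tilde P_K=\tilde p_K\mu_K$, $\tilde Q_K=\tilde q_K\mu_K$. For a convex function $f:(0,\infty)\to\mathbb R$ let $f^*(t)=tf(1/t)$, $f(0)=\lim_{t\downarrow0}f(t)$, $f^*(0)=\lim_{t\downarrow0}f^*(t)$, and for measures $P=p\mu$, $Q=q\mu$ let $$D_f(P,Q)=\int_{\{pq>0\}}f\Big(\frac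 pq\Big)q\,d\mu+f(0)\,Q(\{p=0\})+f^*(0)\,P(\{q=0\}),\qquad 0\cdot\infty=0.$$ Then for every convex function $f:(0,\infty)\to\mathbb R$ the quantities $D_f(P_K,Q_K)$, $D_f(Q_K,P_K)$, $D_f(\tilde P_K,\tilde Q_K)$, $D_f(\tilde Q_K,\tilde P_K)$ are well defined in $(-\infty,\infty]$ for all $K\in\mathcal K_0$, and: (i) $D_f(P_K,Q_K)$ and $D_f(Q_K,P_K)$ are $GL(n)$-invariant: for all $K\in\mathcal K_0$ and all invertible linear maps $T$ of $\mathbb R^n$, $D_f(P_{T(K)},Q_{T(K)})=D_f(P_K,Q_K)$ and $D_f(Q_{T(K)},P_{T(K)})=D_f(Q_K,P_K)$. (ii) $D_f(\tilde P_K,\tilde Q_K)$ and $D_f(\tilde Q_K,\tilde P_K)$ are $SL(n)$-invariant: they take the same value at $T(K)$ as at $K$ for all $K\in\mathcal K_0$ and all linear maps $T$ with $\det T=1$. (iii) $D_f(\tilde P_K,\tilde Q_K)$ and $D_f(\tilde Q_K,\tilde P_K)$ are valuations: for all $K,L\in\mathcal K_0$ with $K\cup L\in\mathcal K_0$, $$D_f(\tilde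 P_{K\cup L},\tilde Q_{K\cup L})+D_f(\tilde P_{K\cap L},\tilde Q_{K\cap L})=D_f(\tilde P_K,\tilde Q_K)+D_f(\tilde P_L,\tilde Q_L),$$ and likewise with the roles of $\tilde P$ and $\tilde Q$ exchanged. -/

import Mathlib

open MeasureTheory Filter Topology Set
open scoped ENNReal

noncomputable section

namespace BodyDivergence

/-! ### `f`-divergences of measures given by densities -/

section Divergence

variable {X : Type*} [MeasurableSpace X]

/-- The extended-real integral `∫ g⁺ dμ - ∫ g⁻ dμ`, which keeps the value `+∞`.
It is `⊥` (and only then) if `∫ g⁻ dμ = ∞`. -/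
def eintegral (μ : Measure X) (g : X → ℝ) : EReal :=
  ((∫⁻ x, ENNReal.ofReal (g x) ∂μ : ℝ≥0∞) : EReal)
    - ((∫⁻ x, ENNReal.ofReal (-g x) ∂μ : ℝ≥0∞) : EReal)

/-- The `*`-adjoint function `f*(t) = t f(1/t)`. -/
def adjointFun (f : ℝ → ℝ) (t : ℝ) : ℝ := t * f (1 / t)

/-- `f(0) = lim_{t ↓ 0} f(t)` in `[-∞, ∞]`; for convex `f` on `(0, ∞)` the limit exists
in `(-∞, ∞]`. -/
def valueAtZero (f : ℝ → ℝ) : EReal :=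
  limUnder (𝓝[>] (0 : ℝ)) (fun t => ((f t : ℝ) : EReal))

/-- The measure with density `p` with respect to `μ`. -/
def densityMeasure (μ : Measure X) (p : X → ℝ) : Measure X :=
  μ.withDensity (fun x => ENNReal.ofReal (p x))

/-- The `f`-divergence `D_f(P, Q)` of `P = p μ` and `Q = q μ`:
`∫_{pq > 0} f(p/q) q dμ + f(0) Q({p = 0}) + f*(0) P({q = 0})`,
in the extended reals, with `0 * ∞ = 0`. -/
def fDivergence (f : ℝ → ℝ) (μ : Measure X) (p q : X → ℝ) : EReal :=
  eintegral (μ.restrict {x | 0 < p x * q x}) (fun x => f (p x / q x) * q x)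
    + valueAtZero f * ((densityMeasure μ q {x | p x = 0} : ℝ≥0∞) : EReal)
    + valueAtZero (adjointFun f) * ((densityMeasure μ p {x | q x = 0} : ℝ≥0∞) : EReal)

end Divergence

/-! ### Convex bodies with the origin in their interior -/

section Bodies

variable {n : ℕ}

/-- The class `𝒦₀` of convex bodies in `ℝⁿ` that contain the origin in their interiors. -/
structure IsBody (K : Set (EuclideanSpace ℝ (Fin n))) : Prop where
  convex : Convex ℝ K
  isCompact : IsCompact K
  zero_mem_interior : (0 : EuclideanSpace ℝ (Fin n)) ∈ interior K

/-- The polar body `K° = {y : ⟨x, y⟩ ≤ 1 for all x ∈ K}`. -/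
def polarBody (K : Set (EuclideanSpace ℝ (Fin n))) : Set (EuclideanSpace ℝ (Fin n)) :=
  {y | ∀ x ∈ K, inner ℝ x y ≤ 1}

/-- The volume `|K|` as a real number. -/
def vol (K : Set (EuclideanSpace ℝ (Fin n))) : ℝ := (volume K).toReal

/-- The surface area measure `μ_K`: `(n-1)`-dimensional Hausdorff measure, normalized to agree
with Lebesgue measure on `ℝⁿ⁻¹`, restricted to `∂K`. (For `n = 0`, `∂K` is empty.) -/
def surfaceMeasure (K : Set (EuclideanSpace ℝ (Fin n))) :
    Measure (EuclideanSpace ℝ (Fin n)) :=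
  (μHE[n - 1] : Measure (EuclideanSpace ℝ (Fin n))).restrict (frontier K)

/-- `u` is an outer unit normal of `K` at `x`. -/
def IsOuterUnitNormal (K : Set (EuclideanSpace ℝ (Fin n)))
    (x u : EuclideanSpace ℝ (Fin n)) : Prop :=
  ‖u‖ = 1 ∧ ∀ y ∈ K, inner ℝ (y - x) u ≤ 0

open Classical in
/-- The outer unit normal `N_K(x)`. It is unique for `μ_K`-almost every `x ∈ ∂K`; on the null set
of the other boundary points it is given the value `0`. -/
def outerNormal (K : Set (EuclideanSpace ℝ (Fin n))) (x : EuclideanSpace ℝ (Fin n)) :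
    EuclideanSpace ℝ (Fin n) :=
  if h : ∃! u, IsOuterUnitNormal K x u then h.choose else 0

/-- `∂K` near `x` as a graph over the tangent hyperplane `x + u^⊥`, the height being measured in
the inner normal direction `-u`. For `v` near `0` this is a convex, nonnegative function of `v`
with value `0` at `0`, when `u` is the unique outer unit normal of the body `K` at `x ∈ ∂K`. -/
def boundaryGraph (K : Set (EuclideanSpace ℝ (Fin n))) (x u : EuclideanSpace ℝ (Fin n))
    (v : (ℝ ∙ u)ᗮ) : ℝ :=
  sInf {t : ℝ | x + (v : EuclideanSpace ℝ (Fin n)) - t • u ∈ K}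

/-- `A` is the generalized second derivative at `x` of the boundary of `K`:
the graph function `φ` satisfies `φ(v) = ⟨A v, v⟩ / 2 + o(‖v‖²)` as `v → 0` in `u^⊥`. -/
def IsCurvatureOperator (K : Set (EuclideanSpace ℝ (Fin n))) (x u : EuclideanSpace ℝ (Fin n))
    (A : (ℝ ∙ u)ᗮ →ₗ[ℝ] (ℝ ∙ u)ᗮ) : Prop :=
  A.IsSymmetric ∧
    (fun v : (ℝ ∙ u)ᗮ => boundaryGraph K x u v - (1 / 2 : ℝ) * inner ℝ (A v) v)
      =o[𝓝 0] (fun v : (ℝ ∙ u)ᗮ => ‖v‖ ^ 2)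

open Classical in
/-- The generalized Gauss curvature `κ_K(x)`: the determinant of the generalized second
derivative, which is unique if it exists. It exists for `μ_K`-almost every `x ∈ ∂K`; on the null
set of the other boundary points `κ_K` is given the value `0`. -/
def gaussCurvature (K : Set (EuclideanSpace ℝ (Fin n))) (x : EuclideanSpace ℝ (Fin n)) : ℝ :=
  if h : (∃! u, IsOuterUnitNormal K x u) ∧ ∃ A, IsCurvatureOperator K x (outerNormal K x) A then
    LinearMap.det h.2.choose
  else 0

/-- The density `κ_K / ⟨x, N_K(x)⟩ⁿ` of the non-normalized measure `P̃_K`. -/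
def densPtilde (K : Set (EuclideanSpace ℝ (Fin n))) (x : EuclideanSpace ℝ (Fin n)) : ℝ :=
  gaussCurvature K x / inner ℝ x (outerNormal K x) ^ n

/-- The density `⟨x, N_K(x)⟩` of the non-normalized measure `Q̃_K`. -/
def densQtilde (K : Set (EuclideanSpace ℝ (Fin n))) (x : EuclideanSpace ℝ (Fin n)) : ℝ :=
  inner ℝ x (outerNormal K x)

/-- The density `p_K = κ_K / (⟨x, N_K(x)⟩ⁿ n |K°|)` of `P_K`. -/
def densP (K : Set (EuclideanSpace ℝ (Fin n))) (x : EuclideanSpace ℝ (Fin n)) : ℝ :=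
  gaussCurvature K x / (inner ℝ x (outerNormal K x) ^ n * (n * vol (polarBody K)))

/-- The density `q_K = ⟨x, N_K(x)⟩ / (n |K|)` of `Q_K`. -/
def densQ (K : Set (EuclideanSpace ℝ (Fin n))) (x : EuclideanSpace ℝ (Fin n)) : ℝ :=
  inner ℝ x (outerNormal K x) / (n * vol K)

/-- `D_f(P_K, Q_K)`. -/
def divPQ (f : ℝ → ℝ) (K : Set (EuclideanSpace ℝ (Fin n))) : EReal :=
  fDivergence f (surfaceMeasure K) (densP K) (densQ K)

/-- `D_f(Q_K, P_K)`. -/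
def divQP (f : ℝ → ℝ) (K : Set (EuclideanSpace ℝ (Fin n))) : EReal :=
  fDivergence f (surfaceMeasure K) (densQ K) (densP K)

/-- `D_f(P̃_K, Q̃_K)`. -/
def divPQtilde (f : ℝ → ℝ) (K : Set (EuclideanSpace ℝ (Fin n))) : EReal :=
  fDivergence f (surfaceMeasure K) (densPtilde K) (densQtilde K)

/-- `D_f(Q̃_K, P̃_K)`. -/
def divQPtilde (f : ℝ → ℝ) (K : Set (EuclideanSpace ℝ (Fin n))) : EReal :=
  fDivergence f (surfaceMeasure K) (densQtilde K) (densPtilde K)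

/-- `Φ` is invariant under all invertible linear maps on `𝒦₀`. -/
def IsGLInvariant (Φ : Set (EuclideanSpace ℝ (Fin n)) → EReal) : Prop :=
  ∀ K, IsBody K → ∀ T : EuclideanSpace ℝ (Fin n) ≃ₗ[ℝ] EuclideanSpace ℝ (Fin n),
    Φ (T '' K) = Φ K

/-- `Φ` is invariant under all linear maps of determinant `1` on `𝒦₀`. -/
def IsSLInvariant (Φ : Set (EuclideanSpace ℝ (Fin n)) → EReal) : Prop :=
  ∀ K, IsBody K → ∀ T : EuclideanSpace ℝ (Fin n) ≃ₗ[ℝ] EuclideanSpace ℝ (Fin n),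
    LinearMap.det (T : EuclideanSpace ℝ (Fin n) →ₗ[ℝ] EuclideanSpace ℝ (Fin n)) = 1 →
      Φ (T '' K) = Φ K

/-- `Φ` is a valuation on `𝒦₀`. -/
def IsBodyValuation (Φ : Set (EuclideanSpace ℝ (Fin n)) → EReal) : Prop :=
  ∀ K L, IsBody K → IsBody L → IsBody (K ∪ L) →
    Φ (K ∪ L) + Φ (K ∩ L) = Φ K + Φ L

/-- On `𝒦₀`, `Φ` takes values in `(-∞, ∞]`; for the divergences above this says that the
defining integral exists and that no difference `∞ - ∞` occurs. -/
def IsProperOnBodies (Φ : Set (EuclideanSpace ℝ (Fin n)) → EReal) : Prop :=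
  ∀ K, IsBody K → Φ K ≠ ⊥

end Bodies

end BodyDivergence

end

open MeasureTheory Filter Topology Set
open scoped ENNReal

noncomputable section

namespace BodyDivergence

/-! ### Convex functions on the positive half-line -/

/-! Write g for the gauge of K and E = g² / 2 (`energy`). Everything can be read off from E. The
measure ⟨x, N⟩ μ_K is the cone measure, n times the volume of the cone over a piece of ∂K
(`IsBody.supportMeasure_eq_coneMeasure`), and the ratio κ / ⟨x, N⟩ⁿ⁺¹ of the two densities is the
Hessian determinant of E (`IsBody.gaussCurvature_div`). Hence each divergence is a
`ratioDivergence`, of f or of its adjoint f*, over a multiple of the cone measure.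

Invariance: a linear map T multiplies the cone measure by |det T| and the Hessian determinant by
(det T)⁻². Under normalization, |K| and |K| / |K°| scale by |det T| and (det T)², which cancels
these factors.

No value -∞: f lies above an affine function, so it suffices that the Hessian determinant has finite
integral. Where it is positive, the gradient map of the convex function E is injective with
derivative the Hessian, so the integral is the volume of a bounded set of gradients
(`lintegral_hessDet_lt_top`).

Valuation: the gauge of K ∪ L is the minimum and that of K ∩ L the maximum of the two gauges. On the
conic set where g_K < g_L, the union looks like K and the intersection like L; on the complement it
is the other way round. Cone measures are local on conic sets, and two convex functions that agree
on a set have the same second order expansions at its density points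
(`HasExpansion.of_isDensityPoint`).

Almost everywhere existence of second derivatives (Alexandrov's theorem) is not used: where there is
no expansion, curvature and Hessian determinant are both 0 by default, and all comparisons of
expansions are equivalences. -/

lemma exists_affine_minorant {f : ℝ → ℝ} (hf : ConvexOn ℝ (Ioi (0 : ℝ)) f) :
    ∃ b : ℝ, ∀ t, 0 < t → f 1 + b * (t - 1) ≤ f t := by
  have h1 : (1 : ℝ) ∈ interior (Ioi (0 : ℝ)) := by simp
  -- Any slope between the left and the right derivative at 1 would do.
  refine ⟨derivWithin f (Ioi 1) 1, fun t ht => ?_⟩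
  rcases lt_trichotomy t 1 with h | h | h
  · have h2 := hf.slope_le_leftDeriv_of_mem_interior (x := t) (y := 1) ht h1 h
    have h3 := hf.leftDeriv_le_rightDeriv_of_mem_interior h1
    have h4 := h2.trans h3
    rw [slope_def_field, div_le_iff₀ (by linarith)] at h4
    linarith
  · simp [h]
  · have h2 := hf.rightDeriv_le_slope_of_mem_interior (x := 1) (y := t) h1 ht h
    rw [slope_def_field, le_div_iff₀ (by linarith)] at h2
    linarith

/-- A `limUnder` says nothing until convergence is known. Subtracting the slope of a supporting line
at 1 gives a convex g with minimum at 1, hence antitone on (0, 1]; its limit at 0 is a supremum of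
real numbers, and the linear term tends to 0. -/
lemma valueAtZero_ne_bot {f : ℝ → ℝ} (hf : ConvexOn ℝ (Ioi (0 : ℝ)) f) :
    valueAtZero f ≠ ⊥ := by
  obtain ⟨b, hb⟩ := exists_affine_minorant hf
  let g : ℝ → ℝ := fun t => f t - b * t
  have hg1 : ∀ t, 0 < t → g 1 ≤ g t := fun t ht => by
    have := hb t ht
    simp only [g]; linarith
  have hg : ConvexOn ℝ (Ioi (0 : ℝ)) g := by
    refine hf.sub ⟨convex_Ioi 0, fun x _ y _ a c _ _ _ => ?_⟩
    simp only [smul_eq_mul]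
    exact le_of_eq (by ring)
  have hanti : ∀ s t, 0 < s → s ≤ t → t ≤ 1 → g t ≤ g s := by
    intro s t hs hst ht
    rcases eq_or_lt_of_le (hst.trans ht) with h | h
    · have : t = s := by linarith
      rw [this]
    · have h1s : 0 < 1 - s := by linarith
      have := hg.2 (show s ∈ Ioi (0 : ℝ) from hs) (show (1 : ℝ) ∈ Ioi (0 : ℝ) by simp)
        (show 0 ≤ (1 - t) / (1 - s) by apply div_nonneg <;> linarith)
        (show 0 ≤ (t - s) / (1 - s) by apply div_nonneg <;> linarith) (by field_simp; ring)
      simp only [smul_eq_mul] at this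
      have e : (1 - t) / (1 - s) * s + (t - s) / (1 - s) * 1 = t := by field_simp; ring
      rw [e] at this
      have h2 : (t - s) / (1 - s) * g 1 ≤ (t - s) / (1 - s) * g s :=
        mul_le_mul_of_nonneg_left (hg1 s hs) (by apply div_nonneg <;> linarith)
      have e2 : (1 - t) / (1 - s) * g s + (t - s) / (1 - s) * g s = g s := by
        field_simp; ring
      linarith
  -- Freezing g beyond 1 makes it antitone on all of (0, ∞).
  let G : ℝ → EReal := fun t => ((g (min t 1) : ℝ) : EReal)
  have hG : AntitoneOn G (Ioi 0) := by
    intro s hs t _ hst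
    simp only [G]
    exact_mod_cast hanti _ _ (lt_min hs one_pos) (min_le_min_right 1 hst) (min_le_right _ _)
  have hlim := hG.tendsto_nhdsGT (OrderTop.bddAbove _)
  set L := sSup (G '' Ioi 0) with hL
  have hLbot : L ≠ ⊥ := by
    have : G 1 ≤ L := le_sSup ⟨1, by simp, rfl⟩
    intro h
    rw [h] at this
    exact EReal.coe_ne_bot _ (le_bot_iff.mp this)
  have hlin : Tendsto (fun t : ℝ => ((b * t : ℝ) : EReal)) (𝓝[>] 0) (𝓝 ((0 : ℝ) : EReal)) := by
    have : Tendsto (fun t : ℝ => b * t) (𝓝 0) (𝓝 (b * 0)) := by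
      exact (continuous_const.mul continuous_id).tendsto 0
    rw [mul_zero] at this
    exact (continuous_coe_real_ereal.tendsto 0).comp (this.mono_left nhdsWithin_le_nhds)
  have hadd : Tendsto (fun t : ℝ => G t + ((b * t : ℝ) : EReal)) (𝓝[>] 0)
      (𝓝 (L + ((0 : ℝ) : EReal))) :=
    (EReal.continuousAt_add (p := (L, ((0 : ℝ) : EReal))) (Or.inr (EReal.coe_ne_bot _))
      (Or.inr (EReal.coe_ne_top _))).tendsto.comp (hlim.prodMk_nhds hlin)
  have hfin : Tendsto (fun t : ℝ => ((f t : ℝ) : EReal)) (𝓝[>] 0) (𝓝 (L + ((0 : ℝ) : EReal))) := by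
    refine hadd.congr' ?_
    filter_upwards [Ioo_mem_nhdsGT (zero_lt_one' ℝ)] with t ht
    simp only [G, min_eq_left ht.2.le, g]
    rw [← EReal.coe_add]
    congr 1; ring
  rw [valueAtZero, hfin.limUnder_eq]
  simpa using hLbot

/-- With z = ax + by, the point 1/z is the convex combination of 1/x and 1/y with weights ax/z and
by/z. Through this lemma every claim about D_f(Q, P) becomes a claim about f*. -/
lemma convexOn_adjointFun {f : ℝ → ℝ} (hf : ConvexOn ℝ (Ioi (0 : ℝ)) f) :
    ConvexOn ℝ (Ioi (0 : ℝ)) (adjointFun f) := by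
  refine ⟨convex_Ioi 0, ?_⟩
  intro x hx y hy a b ha hb hab
  simp only [mem_Ioi] at hx hy
  have hz : 0 < a * x + b * y := by
    rcases eq_or_lt_of_le ha with h | h
    · have : b = 1 := by linarith
      subst this; rw [← h]; simpa using hy
    · have := mul_pos h hx
      have := mul_nonneg hb hy.le
      linarith
  simp only [adjointFun, smul_eq_mul]
  set z := a * x + b * y with hzdef
  have := hf.2 (show 1 / x ∈ Ioi (0 : ℝ) by simpa using hx)
    (show 1 / y ∈ Ioi (0 : ℝ) by simpa using hy)
    (show 0 ≤ a * x / z by positivity) (show 0 ≤ b * y / z by positivity)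
    (by rw [← add_div, div_self hz.ne'])
  simp only [smul_eq_mul] at this
  have e : a * x / z * (1 / x) + b * y / z * (1 / y) = 1 / z := by
    field_simp; exact hab
  rw [e] at this
  calc z * f (1 / z) ≤ z * (a * x / z * f (1 / x) + b * y / z * f (1 / y)) :=
        mul_le_mul_of_nonneg_left this hz.le
    _ = a * (x * f (1 / x)) + b * (y * f (1 / y)) := by field_simp

/-! ### Divergences through a likelihood ratio -/

section Ratio

variable {X : Type*} [MeasurableSpace X]

/-- The divergence `∫_{ρ > 0} f(ρ) dQ + f(0) Q({ρ = 0})` of `ρ Q` with respect to `Q`. -/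
def ratioDivergence (f : ℝ → ℝ) (Q : Measure X) (ρ : X → ℝ) : EReal :=
  eintegral (Q.restrict {x | 0 < ρ x}) (fun x => f (ρ x))
    + valueAtZero f * ((Q {x | ρ x = 0} : ℝ≥0∞) : EReal)

lemma eintegral_congr_ae {μ : Measure X} {g g' : X → ℝ} (h : g =ᵐ[μ] g') :
    eintegral μ g = eintegral μ g' := by
  have h1 : ∫⁻ x, ENNReal.ofReal (g x) ∂μ = ∫⁻ x, ENNReal.ofReal (g' x) ∂μ :=
    lintegral_congr_ae (h.mono fun x hx => by simp only [hx])
  have h2 : ∫⁻ x, ENNReal.ofReal (-g x) ∂μ = ∫⁻ x, ENNReal.ofReal (-g' x) ∂μ :=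
    lintegral_congr_ae (h.mono fun x hx => by simp only [hx])
  rw [eintegral, eintegral, h1, h2]

lemma fDivergence_congr_ae (f : ℝ → ℝ) {μ : Measure X} {p p' q q' : X → ℝ}
    (hp : p =ᵐ[μ] p') (hq : q =ᵐ[μ] q') :
    fDivergence f μ p q = fDivergence f μ p' q' := by
  have hs : {x | 0 < p x * q x} =ᵐ[μ] {x | 0 < p' x * q' x} := by
    filter_upwards [hp, hq] with x h1 h2
    apply propext
    change 0 < p x * q x ↔ 0 < p' x * q' x
    rw [h1, h2]
  have hdp : densityMeasure μ p = densityMeasure μ p' :=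
    withDensity_congr_ae (hp.mono fun x hx => by simp only [hx])
  have hdq : densityMeasure μ q = densityMeasure μ q' :=
    withDensity_congr_ae (hq.mono fun x hx => by simp only [hx])
  have h0p : {x | p x = 0} =ᵐ[μ] {x | p' x = 0} := by
    filter_upwards [hp] with x h1
    apply propext
    change p x = 0 ↔ p' x = 0
    rw [h1]
  have h0q : {x | q x = 0} =ᵐ[μ] {x | q' x = 0} := by
    filter_upwards [hq] with x h1
    apply propext
    change q x = 0 ↔ q' x = 0
    rw [h1]
  have h1 : densityMeasure μ q' {x | p x = 0} = densityMeasure μ q' {x | p' x = 0} :=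
    measure_congr ((withDensity_absolutelyContinuous μ _).ae_le h0p)
  have h2 : densityMeasure μ p' {x | q x = 0} = densityMeasure μ p' {x | q' x = 0} :=
    measure_congr ((withDensity_absolutelyContinuous μ _).ae_le h0q)
  unfold fDivergence
  rw [Measure.restrict_congr_set hs, hdp, hdq, h1, h2]
  congr 2
  apply eintegral_congr_ae
  apply ae_restrict_of_ae
  filter_upwards [hp, hq] with x h1 h2
  rw [h1, h2]

lemma ratioDivergence_congr_ae (f : ℝ → ℝ) {Q : Measure X} {ρ ρ' : X → ℝ} (h : ρ =ᵐ[Q] ρ') :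
    ratioDivergence f Q ρ = ratioDivergence f Q ρ' := by
  have hs : {x | 0 < ρ x} =ᵐ[Q] {x | 0 < ρ' x} := by
    filter_upwards [h] with x h1
    apply propext
    change 0 < ρ x ↔ 0 < ρ' x
    rw [h1]
  have h0 : {x | ρ x = 0} =ᵐ[Q] {x | ρ' x = 0} := by
    filter_upwards [h] with x h1
    apply propext
    change ρ x = 0 ↔ ρ' x = 0
    rw [h1]
  unfold ratioDivergence
  rw [Measure.restrict_congr_set hs, measure_congr h0]
  congr 1
  apply eintegral_congr_ae
  apply ae_restrict_of_ae
  filter_upwards [h] with x h1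
  rw [h1]

/-- Only q is measurable here: the ratio ρ will be a Hessian determinant, whose measurability is
never established. So {ρ > 0} appears only as a restriction of an s-finite measure, and the
integrands stay arbitrary. -/
lemma lintegral_restrict_mul_density {μ : Measure X} [SFinite μ] {ρ q : X → ℝ}
    (hqm : Measurable q) (hq : ∀ x, 0 ≤ q x) (φ G : X → ℝ)
    (hG : ∀ x, 0 < q x → G x = φ x * q x) :
    ∫⁻ x, ENNReal.ofReal (G x) ∂(μ.restrict {x | 0 < ρ x ∧ 0 < q x})
      = ∫⁻ x, ENNReal.ofReal (φ x) ∂((densityMeasure μ q).restrict {x | 0 < ρ x}) := by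
  have hm : MeasurableSet {x | 0 < q x} := measurableSet_lt measurable_const hqm
  rw [densityMeasure, restrict_withDensity', lintegral_withDensity_eq_lintegral_mul_non_measurable _
    hqm.ennreal_ofReal (Eventually.of_forall fun x => ENNReal.ofReal_lt_top)]
  have hset : {x | 0 < ρ x ∧ 0 < q x} = {x | 0 < q x} ∩ {x | 0 < ρ x} := by
    ext x; simp [and_comm]
  rw [hset, ← Measure.restrict_restrict hm, ← lintegral_indicator hm]
  refine lintegral_congr fun x => ?_
  by_cases hx : 0 < q x
  · rw [indicator_of_mem (by exact hx), hG x hx]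
    simp only [Pi.mul_apply]
    rw [ENNReal.ofReal_mul' (hq x), mul_comm]
  · have : q x = 0 := le_antisymm (not_lt.mp hx) (hq x)
    rw [indicator_of_notMem (by exact hx)]
    simp [this]

lemma eintegral_restrict_mul_density {μ : Measure X} [SFinite μ] {ρ q : X → ℝ}
    (hqm : Measurable q) (hq : ∀ x, 0 ≤ q x) (φ G : X → ℝ)
    (hG : ∀ x, 0 < q x → G x = φ x * q x) {s : Set X}
    (hs : s = {x | 0 < ρ x ∧ 0 < q x}) :
    eintegral (μ.restrict s) G = eintegral ((densityMeasure μ q).restrict {x | 0 < ρ x}) φ := by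
  subst hs
  unfold eintegral
  rw [lintegral_restrict_mul_density hqm hq φ G hG,
    lintegral_restrict_mul_density hqm hq (fun x => -φ x) (fun x => -G x)
      (fun x hx => by rw [hG x hx]; ring)]

lemma densityMeasure_mul_eq_zero {μ : Measure X} {ρ q : X → ℝ} (hqm : Measurable q) :
    densityMeasure μ (fun x => ρ x * q x) {x | q x = 0} = 0 := by
  have hm : MeasurableSet {x | q x = 0} := measurableSet_eq_fun hqm measurable_const
  rw [densityMeasure, withDensity_apply _ hm, ← lintegral_indicator hm]
  refine (lintegral_congr fun x => ?_).trans lintegral_zero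
  by_cases hx : q x = 0
  · rw [indicator_of_mem (by exact hx)]; simp [hx]
  · rw [indicator_of_notMem (by exact hx)]

lemma densityMeasure_mul_eq_zero_set {μ : Measure X} {ρ q : X → ℝ} (hqm : Measurable q) :
    densityMeasure μ q {x | ρ x * q x = 0} = densityMeasure μ q {x | ρ x = 0} := by
  have h0 : densityMeasure μ q {x | q x = 0} = 0 := by
    simpa using densityMeasure_mul_eq_zero (μ := μ) (ρ := fun _ => 1) hqm
  apply le_antisymm
  · calc densityMeasure μ q {x | ρ x * q x = 0}
        ≤ densityMeasure μ q ({x | ρ x = 0} ∪ {x | q x = 0}) :=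
          measure_mono fun x hx => mul_eq_zero.mp hx
      _ ≤ _ := (measure_union_le _ _).trans (by rw [h0, add_zero])
  · exact measure_mono fun x (hx : ρ x = 0) => by simp [hx]

/-- If p = ρ q, then p vanishes wherever q does, so the f*(0) term drops out (0 * ∞ = 0) and only
the measure Q and the ratio ρ remain. -/
theorem fDivergence_mul_left (f : ℝ → ℝ) {μ : Measure X} [SFinite μ] {ρ q : X → ℝ}
    (hqm : Measurable q) (hq : ∀ x, 0 ≤ q x) :
    fDivergence f μ (fun x => ρ x * q x) q = ratioDivergence f (densityMeasure μ q) ρ := by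
  rw [fDivergence, ratioDivergence, densityMeasure_mul_eq_zero hqm,
    densityMeasure_mul_eq_zero_set hqm]
  rw [eintegral_restrict_mul_density (ρ := ρ) hqm hq (fun x => f (ρ x))]
  · simp
  · intro x hx
    rw [mul_div_cancel_right₀ _ hx.ne']
  · ext x
    simp only [mem_ofPred_eq]
    constructor
    · intro h
      have hx : 0 < q x := lt_of_le_of_ne (hq x) (by rintro h0; simp [← h0] at h)
      exact ⟨pos_of_mul_pos_left (pos_of_mul_pos_left h hx.le) hx.le, hx⟩
    · rintro ⟨h1, h2⟩; positivity

/-- The identity f(1/ρ) ρ = f*(ρ) turns the integral into one over Q. Now the f(0) term drops out,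
and f*(0) Q({ρ = 0}) is the singular term of the divergence of f*. -/
theorem fDivergence_mul_right (f : ℝ → ℝ) {μ : Measure X} [SFinite μ] {ρ q : X → ℝ}
    (hqm : Measurable q) (hq : ∀ x, 0 ≤ q x) :
    fDivergence f μ q (fun x => ρ x * q x)
      = ratioDivergence (adjointFun f) (densityMeasure μ q) ρ := by
  rw [fDivergence, ratioDivergence, densityMeasure_mul_eq_zero hqm,
    densityMeasure_mul_eq_zero_set hqm]
  rw [eintegral_restrict_mul_density (ρ := ρ) hqm hq (fun x => adjointFun f (ρ x))]
  · simp
  · intro x hx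
    rw [adjointFun, div_mul_cancel_right₀ hx.ne', one_div]
    ring
  · ext x
    simp only [mem_ofPred_eq]
    constructor
    · intro h
      have hx : 0 < q x := lt_of_le_of_ne (hq x) (by rintro h0; simp [← h0] at h)
      exact ⟨pos_of_mul_pos_left (pos_of_mul_pos_right h hx.le) hx.le, hx⟩
    · rintro ⟨h1, h2⟩; positivity

lemma lintegral_neg_part_ne_top {f : ℝ → ℝ} (hf : ConvexOn ℝ (Ioi (0 : ℝ)) f) {Q : Measure X}
    [IsFiniteMeasure Q] {ρ : X → ℝ} (hρ : ∀ x, 0 ≤ ρ x)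
    (hint : ∫⁻ x, ENNReal.ofReal (ρ x) ∂Q ≠ ∞) :
    ∫⁻ x, ENNReal.ofReal (-f (ρ x)) ∂Q ≠ ∞ := by
  obtain ⟨b, hb⟩ := exists_affine_minorant hf
  -- The summand |f 0| covers the points with ρ = 0, where f has an arbitrary value that convexity
  -- on (0, ∞) does not control.
  set c : ℝ := |f 0| + |f 1| + |b| with hc
  have hle : ∀ x, ENNReal.ofReal (-f (ρ x)) ≤ ENNReal.ofReal c
      + ENNReal.ofReal |b| * ENNReal.ofReal (ρ x) := by
    intro x
    rw [← ENNReal.ofReal_mul (abs_nonneg b), ← ENNReal.ofReal_add (by positivity)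
      (mul_nonneg (abs_nonneg b) (hρ x))]
    apply ENNReal.ofReal_le_ofReal
    rcases eq_or_lt_of_le (hρ x) with h | h
    · rw [← h, hc]
      have := neg_abs_le (f 0)
      have := abs_nonneg (f 1)
      have := abs_nonneg b
      linarith
    · have h1 := hb _ h
      have := neg_abs_le (f 1)
      have := abs_nonneg (f 0)
      have h2 : -b * ρ x ≤ |b| * ρ x := mul_le_mul_of_nonneg_right (neg_le_abs b) h.le
      have := le_abs_self b
      rw [hc]
      nlinarith
  refine ne_top_of_le_ne_top ?_ (lintegral_mono hle)
  rw [lintegral_add_left measurable_const, lintegral_const_mul' _ _ ENNReal.ofReal_ne_top,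
    lintegral_const]
  exact ENNReal.add_ne_top.mpr ⟨ENNReal.mul_ne_top ENNReal.ofReal_ne_top (measure_ne_top _ _),
    ENNReal.mul_ne_top ENNReal.ofReal_ne_top hint⟩

theorem ratioDivergence_ne_bot {f : ℝ → ℝ} (hf : ConvexOn ℝ (Ioi (0 : ℝ)) f) {Q : Measure X}
    [IsFiniteMeasure Q] {ρ : X → ℝ} (hρ : ∀ x, 0 ≤ ρ x)
    (hint : ∫⁻ x, ENNReal.ofReal (ρ x) ∂Q ≠ ∞) :
    ratioDivergence f Q ρ ≠ ⊥ := by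
  have h1 : ∫⁻ x, ENNReal.ofReal (-f (ρ x)) ∂(Q.restrict {x | 0 < ρ x}) ≠ ∞ :=
    ne_top_of_le_ne_top (lintegral_neg_part_ne_top hf hρ hint) (setLIntegral_le_lintegral _ _)
  have h2 : Q {x | ρ x = 0} ≠ ∞ := measure_ne_top _ _
  have h3 := valueAtZero_ne_bot hf
  rw [ratioDivergence, eintegral, sub_eq_add_neg, Ne, EReal.add_eq_bot_iff, EReal.add_eq_bot_iff,
    EReal.neg_eq_bot_iff]
  rintro ((h | h) | h)
  · exact EReal.coe_ennreal_ne_bot _ h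
  · exact h1 (EReal.coe_ennreal_eq_top_iff.mp h)
  · rw [EReal.mul_eq_bot] at h
    rcases h with h | h | h | h
    · exact h3 h.1
    · exact EReal.coe_ennreal_ne_bot _ h.2
    · exact absurd h.2 (not_lt.mpr (EReal.coe_ennreal_nonneg _))
    · exact h2 (EReal.coe_ennreal_eq_top_iff.mp h.2)

/-- Positive parts may be infinite, but the finite negative parts allow the difference to be split
in `EReal`. The f(0) term splits because both measures are nonnegative. -/
theorem ratioDivergence_restrict_add_compl {f : ℝ → ℝ} {Q : Measure X} {ρ : X → ℝ}
    (hneg : ∫⁻ x, ENNReal.ofReal (-f (ρ x)) ∂Q ≠ ∞)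
    {s : Set X} (hs : MeasurableSet s) :
    ratioDivergence f Q ρ = ratioDivergence f (Q.restrict s) ρ
      + ratioDivergence f (Q.restrict sᶜ) ρ := by
  set S := {x | 0 < ρ x}
  set Z := {x | ρ x = 0}
  have hcomm : ∀ t, MeasurableSet t → (Q.restrict t).restrict S = (Q.restrict S).restrict t := by
    intro t ht
    rw [Measure.restrict_restrict ht, Measure.restrict_restrict' ht, inter_comm]
  have hsplit : ∀ G : X → ℝ≥0∞, ∫⁻ x, G x ∂(Q.restrict S)
      = ∫⁻ x, G x ∂((Q.restrict s).restrict S) + ∫⁻ x, G x ∂((Q.restrict sᶜ).restrict S) := by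
    intro G
    rw [hcomm s hs, hcomm sᶜ hs.compl, lintegral_add_compl _ hs]
  have hZ : Q Z = Q.restrict s Z + Q.restrict sᶜ Z := by
    rw [Measure.restrict_apply' hs, Measure.restrict_apply' hs.compl, ← sdiff_eq,
      measure_inter_add_sdiff _ hs]
  have hfin : ∀ t, ∫⁻ x, ENNReal.ofReal (-f (ρ x)) ∂((Q.restrict t).restrict S) ≠ ∞ := fun t =>
    ne_top_of_le_ne_top hneg ((setLIntegral_le_lintegral _ _).trans (setLIntegral_le_lintegral _ _))
  have key : ∀ a b c d : ℝ≥0∞, c ≠ ∞ → d ≠ ∞ →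
      (((a + b : ℝ≥0∞) : EReal) - ((c + d : ℝ≥0∞) : EReal))
        = ((a : EReal) - (c : EReal)) + ((b : EReal) - (d : EReal)) := by
    intro a b c d hc hd
    rw [EReal.coe_ennreal_add, EReal.coe_ennreal_add, sub_eq_add_neg, sub_eq_add_neg,
      sub_eq_add_neg, EReal.neg_add (Or.inl (EReal.coe_ennreal_ne_bot _))
        (Or.inl (by simpa using hc)), sub_eq_add_neg]
    exact add_add_add_comm _ _ _ _
  rw [ratioDivergence, ratioDivergence, ratioDivergence, eintegral, eintegral, eintegral, hsplit,
    hsplit, hZ, key _ _ _ _ (hfin s) (hfin sᶜ), EReal.coe_ennreal_add,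
    EReal.left_distrib_of_nonneg (EReal.coe_ennreal_nonneg _) (EReal.coe_ennreal_nonneg _)]
  exact add_add_add_comm _ _ _ _

/-- A measurable equivalence, rather than a measurable map, so that ρ may be nonmeasurable. -/
theorem ratioDivergence_map_equiv {Y : Type*} [MeasurableSpace Y] (f : ℝ → ℝ) (Q : Measure X)
    (e : X ≃ᵐ Y) (ρ : Y → ℝ) :
    ratioDivergence f (Q.map e) ρ = ratioDivergence f Q (fun x => ρ (e x)) := by
  rw [ratioDivergence, ratioDivergence, eintegral, eintegral, e.restrict_map,
    lintegral_map_equiv, lintegral_map_equiv, e.map_apply]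
  rfl

end Ratio

end BodyDivergence

end

noncomputable section

namespace BodyDivergence

/-! ### Gauges of convex bodies -/

/-- Euclidean `n`-space. -/
abbrev Euc (n : ℕ) : Type := EuclideanSpace ℝ (Fin n)

section Gauge

variable {n : ℕ} {K L : Set (Euc n)}

lemma IsBody.mem_nhds (hK : IsBody K) : K ∈ 𝓝 (0 : Euc n) :=
  mem_interior_iff_mem_nhds.mp hK.zero_mem_interior

lemma IsBody.absorbent (hK : IsBody K) : Absorbent ℝ K := absorbent_nhds_zero hK.mem_nhds

lemma IsBody.gauge_le_one_iff (hK : IsBody K) {x : Euc n} : gauge K x ≤ 1 ↔ x ∈ K := by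
  rw [gauge_le_one_iff_mem_closure hK.convex hK.mem_nhds, hK.isCompact.isClosed.closure_eq]

lemma IsBody.gauge_eq_one_iff (hK : IsBody K) {x : Euc n} : gauge K x = 1 ↔ x ∈ frontier K :=
  gauge_eq_one_iff_mem_frontier hK.convex hK.mem_nhds

lemma IsBody.gauge_lt_one_iff (hK : IsBody K) {x : Euc n} : gauge K x < 1 ↔ x ∈ interior K :=
  gauge_lt_one_iff_mem_interior hK.convex hK.mem_nhds

lemma IsBody.gauge_pos_iff (hK : IsBody K) {x : Euc n} : 0 < gauge K x ↔ x ≠ 0 :=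
  gauge_pos hK.absorbent (NormedSpace.isVonNBounded_iff ℝ |>.mpr hK.isCompact.isBounded)

lemma IsBody.continuous_gauge (hK : IsBody K) : Continuous (gauge K) :=
  _root_.continuous_gauge hK.convex hK.mem_nhds

lemma gauge_smul_nonneg {t : ℝ} (ht : 0 ≤ t) (x : Euc n) :
    gauge K (t • x) = t * gauge K x := by
  rw [gauge_smul_of_nonneg ht, smul_eq_mul]

lemma IsBody.convexOn_gauge (hK : IsBody K) : ConvexOn ℝ univ (gauge K) := by
  refine ⟨convex_univ, fun x _ y _ a b ha hb _ => ?_⟩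
  refine (gauge_add_le hK.convex hK.absorbent _ _).trans ?_
  rw [gauge_smul_nonneg ha, gauge_smul_nonneg hb, smul_eq_mul, smul_eq_mul]

lemma IsBody.gauge_le_iff (hK : IsBody K) {x : Euc n} {a : ℝ} (ha : 0 < a) :
    gauge K x ≤ a ↔ a⁻¹ • x ∈ K := by
  rw [← hK.gauge_le_one_iff, gauge_smul_nonneg (inv_nonneg.mpr ha.le), inv_mul_le_iff₀ ha, mul_one]

/-- A gauge is determined by its sublevel sets aK, a > 0; this turns identities of bodies into
identities of gauges. -/
lemma eq_of_forall_pos_le_iff {s t : ℝ} (hs : 0 ≤ s) (ht : 0 ≤ t)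
    (h : ∀ a, 0 < a → (s ≤ a ↔ t ≤ a)) : s = t := by
  apply le_antisymm
  · refine le_of_forall_pos_le_add fun ε hε => (h _ (by linarith)).mpr (by linarith)
  · refine le_of_forall_pos_le_add fun ε hε => (h _ (by linarith)).mp (by linarith)

lemma IsBody.inter (hK : IsBody K) (hL : IsBody L) : IsBody (K ∩ L) where
  convex := hK.convex.inter hL.convex
  isCompact := hK.isCompact.inter hL.isCompact
  zero_mem_interior := by
    rw [interior_inter]; exact ⟨hK.zero_mem_interior, hL.zero_mem_interior⟩

lemma gauge_union (hK : IsBody K) (hL : IsBody L) (hKL : IsBody (K ∪ L)) (x : Euc n) :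
    gauge (K ∪ L) x = min (gauge K x) (gauge L x) := by
  refine eq_of_forall_pos_le_iff (gauge_nonneg _) (le_min (gauge_nonneg _) (gauge_nonneg _))
    fun a ha => ?_
  rw [min_le_iff, hK.gauge_le_iff ha, hL.gauge_le_iff ha, hKL.gauge_le_iff ha, mem_union]

lemma gauge_inter (hK : IsBody K) (hL : IsBody L) (x : Euc n) :
    gauge (K ∩ L) x = max (gauge K x) (gauge L x) := by
  refine eq_of_forall_pos_le_iff (gauge_nonneg _) (le_max_of_le_left (gauge_nonneg _))
    fun a ha => ?_
  rw [max_le_iff, hK.gauge_le_iff ha, hL.gauge_le_iff ha, (hK.inter hL).gauge_le_iff ha,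
    mem_inter_iff]

lemma IsBody.image (hK : IsBody K) (T : Euc n ≃ₗ[ℝ] Euc n) : IsBody (T '' K) where
  convex := hK.convex.linear_image (T : Euc n →ₗ[ℝ] Euc n)
  isCompact := hK.isCompact.image T.toContinuousLinearEquiv.continuous
  zero_mem_interior := by
    have h := T.toContinuousLinearEquiv.toHomeomorph.image_interior K
    have h' : T '' interior K = interior (T '' K) := h
    rw [← h']
    exact ⟨0, hK.zero_mem_interior, map_zero T⟩

lemma gauge_image (hK : IsBody K) (T : Euc n ≃ₗ[ℝ] Euc n) (x : Euc n) :
    gauge (T '' K) (T x) = gauge K x := by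
  refine eq_of_forall_pos_le_iff (gauge_nonneg _) (gauge_nonneg _) fun a ha => ?_
  rw [(hK.image T).gauge_le_iff ha, hK.gauge_le_iff ha, ← map_smul]
  exact T.injective.mem_set_image

lemma IsBody.exists_lipschitz (hK : IsBody K) : ∃ C, LipschitzWith C (gauge K) :=
  hK.convex.lipschitz_gauge hK.mem_nhds

end Gauge

/-! ### Outer normals -/

section Normals

variable {n : ℕ} {K L : Set (Euc n)} {x u : Euc n}

lemma IsBody.inner_pos (hK : IsBody K) (hu : IsOuterUnitNormal K x u) : 0 < inner ℝ x u := by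
  obtain ⟨r, hr, hball⟩ := Metric.mem_nhds_iff.mp hK.mem_nhds
  have hmem : (r / 2) • u ∈ K := hball (by
    rw [mem_ball_zero_iff, norm_smul, hu.1, Real.norm_of_nonneg (by linarith)]; linarith)
  have := hu.2 _ hmem
  rw [inner_sub_left, real_inner_smul_left, real_inner_self_eq_norm_sq, hu.1] at this
  linarith

/-- Scaled by ⟨x, u⟩⁻¹, an outer normal at a boundary point is a subgradient of the gauge there. -/
lemma IsBody.inner_le_gauge (hK : IsBody K) (hu : IsOuterUnitNormal K x u) (y : Euc n) :
    inner ℝ y u ≤ inner ℝ x u * gauge K y := by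
  rcases eq_or_ne y 0 with rfl | hy
  · simp
  have hg := hK.gauge_pos_iff.mpr hy
  have hmem := (hK.gauge_le_iff hg).mp le_rfl
  have := hu.2 _ hmem
  rw [inner_sub_left, real_inner_smul_left, sub_nonpos, inv_mul_le_iff₀ hg] at this
  linarith

lemma isOuterUnitNormal_of_forall_le {v : Euc n} (hv : v ≠ 0)
    (h : ∀ y ∈ K, inner ℝ y v ≤ inner ℝ x v) :
    IsOuterUnitNormal K x (‖v‖⁻¹ • v) := by
  have hv' : 0 < ‖v‖ := norm_pos_iff.mpr hv
  refine ⟨by rw [norm_smul, norm_inv, norm_norm, inv_mul_cancel₀ hv'.ne'], fun y hy => ?_⟩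
  rw [real_inner_smul_right, inner_sub_left]
  exact mul_nonpos_of_nonneg_of_nonpos (inv_nonneg.mpr hv'.le) (by linarith [h y hy])

/-- Since x lies both in S and in K, the closure of its interior, the separating hyperplane passes
through x. With S = {x} this yields a normal; with S the inner normal ray it shows that the ray
enters the interior. -/
lemma IsBody.exists_separating (hK : IsBody K) {S : Set (Euc n)} (hS : Convex ℝ S)
    (hxS : x ∈ S) (hxK : x ∈ K) (hdisj : Disjoint (interior K) S) :
    ∃ v : Euc n, v ≠ 0 ∧ (∀ y ∈ K, inner ℝ y v ≤ inner ℝ x v) ∧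
      ∀ y ∈ S, inner ℝ x v ≤ inner ℝ y v := by
  obtain ⟨f, c, hf1, hf2⟩ := geometric_hahn_banach_open hK.convex.interior isOpen_interior hS hdisj
  have hcl : closure (interior K) = K := by
    rw [hK.convex.closure_interior_eq_closure_of_nonempty_interior ⟨0, hK.zero_mem_interior⟩,
      hK.isCompact.isClosed.closure_eq]
  have hfK : ∀ y ∈ K, f y ≤ c := by
    intro y hy
    rw [← hcl] at hy
    exact closure_minimal (fun z hz => (hf1 z hz).le) (isClosed_le f.continuous continuous_const) hy
  have hfx : f x = c := le_antisymm (hfK x hxK) (hf2 x hxS)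
  set v := (InnerProductSpace.toDual ℝ (Euc n)).symm f with hv
  have hfv : ∀ y, inner ℝ y v = f y := fun y => by
    rw [real_inner_comm, hv, InnerProductSpace.toDual_symm_apply]
  refine ⟨v, ?_, fun y hy => ?_, fun y hy => ?_⟩
  · intro h0
    have h1 := hf1 0 hK.zero_mem_interior
    have h2 := hfv x
    rw [h0, inner_zero_right] at h2
    rw [map_zero] at h1
    linarith
  · rw [hfv, hfv, hfx]; exact hfK y hy
  · rw [hfv, hfv, hfx]; exact hf2 y hy

lemma IsBody.frontier_subset (hK : IsBody K) : frontier K ⊆ K :=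
  hK.isCompact.isClosed.frontier_subset

lemma IsBody.exists_normal (hK : IsBody K) (hx : x ∈ frontier K) :
    ∃ u, IsOuterUnitNormal K x u := by
  obtain ⟨v, hv, h, -⟩ := hK.exists_separating (convex_singleton x) rfl (hK.frontier_subset hx)
    (by rw [disjoint_singleton_right]; exact hx.2)
  exact ⟨_, isOuterUnitNormal_of_forall_le hv h⟩

lemma outerNormal_spec (h : ∃! u, IsOuterUnitNormal K x u) :
    IsOuterUnitNormal K x (outerNormal K x) := by
  rw [outerNormal, dif_pos h]
  exact h.choose_spec.1

lemma outerNormal_eq (h : ∃! u, IsOuterUnitNormal K x u) (hu : IsOuterUnitNormal K x u) :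
    outerNormal K x = u := h.unique (outerNormal_spec h) hu

lemma outerNormal_eq_zero (h : ¬ ∃! u, IsOuterUnitNormal K x u) : outerNormal K x = 0 := by
  rw [outerNormal, dif_neg h]

/-- At a boundary point with a unique normal the inner normal ray enters the interior. -/
lemma IsBody.exists_sub_smul_mem_interior (hK : IsBody K) (hx : x ∈ frontier K)
    (h : ∃! u, IsOuterUnitNormal K x u) (hu : IsOuterUnitNormal K x u) :
    ∃ s : ℝ, 0 < s ∧ x - s • u ∈ interior K := by
  by_contra! hcon
  let S : Set (Euc n) := (fun s : ℝ => x - s • u) '' Ici 0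
  have hS : Convex ℝ S := by
    rintro _ ⟨s, hs, rfl⟩ _ ⟨t, ht, rfl⟩ a b ha hb hab
    refine ⟨a * s + b * t, ?_, ?_⟩
    · exact add_nonneg (mul_nonneg ha hs) (mul_nonneg hb ht)
    · have : x = (a + b) • x := by rw [hab, one_smul]
      simp only
      nth_rewrite 1 [this]
      module
  have hdisj : Disjoint (interior K) S := by
    rw [disjoint_right]
    rintro _ ⟨s, hs, rfl⟩ hmem
    rcases eq_or_lt_of_le (show (0 : ℝ) ≤ s from hs) with h0 | h0
    · rw [← h0] at hmem
      simp only [zero_smul, sub_zero] at hmem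
      exact hx.2 hmem
    · exact hcon s h0 hmem
  -- By uniqueness of the normal, v is a positive multiple of u. But then ⟨·, v⟩ decreases strictly
  -- along the ray, against the separation.
  obtain ⟨v, hv, hvK, hvS⟩ := hK.exists_separating hS ⟨0, by simp, by simp⟩
    (hK.frontier_subset hx) hdisj
  have hnu := h.unique (isOuterUnitNormal_of_forall_le hv hvK) hu
  have hv' : 0 < ‖v‖ := norm_pos_iff.mpr hv
  have hvu : v = ‖v‖ • u := by rw [← hnu, smul_smul, mul_inv_cancel₀ hv'.ne', one_smul]
  have h1 := hvS (x - (1 : ℝ) • u) ⟨1, by simp, rfl⟩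
  rw [hvu, inner_sub_left, one_smul, real_inner_smul_right u u, real_inner_self_eq_norm_sq,
    hu.1] at h1
  linarith

/-- By `IsBody.inner_le_gauge` the function ⟨x, u⟩ g - ⟨·, u⟩ has a minimum at x, so its derivative
there vanishes. -/
lemma IsBody.normal_of_differentiableAt (hK : IsBody K) (hx : x ∈ frontier K)
    (hd : DifferentiableAt ℝ (gauge K) x) (hu : IsOuterUnitNormal K x u) (y : Euc n) :
    inner ℝ x u * fderiv ℝ (gauge K) x y = inner ℝ y u := by
  have hg1 := hK.gauge_eq_one_iff.mpr hx
  let φ : Euc n → ℝ := fun y => inner ℝ x u * gauge K y - inner ℝ y u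
  have hmin : IsLocalMin φ x := by
    apply Eventually.of_forall
    intro y
    have := hK.inner_le_gauge hu y
    simp only [φ, hg1]
    linarith
  have hder : HasFDerivAt φ (inner ℝ x u • fderiv ℝ (gauge K) x - innerSL ℝ u) x := by
    refine HasFDerivAt.sub (hd.hasFDerivAt.const_mul _) ?_
    refine ((innerSL ℝ u).hasFDerivAt (x := x)).congr_of_eventuallyEq ?_
    exact Eventually.of_forall fun y => by simp [real_inner_comm]
  have := hmin.hasFDerivAt_eq_zero hder
  have h2 := congrArg (fun l : Euc n →L[ℝ] ℝ => l y) this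
  simp only [_root_.sub_apply, _root_.smul_apply, smul_eq_mul,
    innerSL_apply_apply, _root_.zero_apply] at h2
  rw [real_inner_comm u y]
  linarith

/-- All normals at x are positive multiples of the one gradient of the gauge. -/
lemma IsBody.existsUnique_normal_of_differentiableAt (hK : IsBody K) (hx : x ∈ frontier K)
    (hd : DifferentiableAt ℝ (gauge K) x) : ∃! u, IsOuterUnitNormal K x u := by
  obtain ⟨u, hu⟩ := hK.exists_normal hx
  refine ⟨u, hu, fun w hw => ?_⟩
  have hpu := hK.inner_pos hu
  have hpw := hK.inner_pos hw
  have h : inner ℝ x u • w = inner ℝ x w • u := by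
    refine ext_inner_left ℝ fun y => ?_
    rw [real_inner_smul_right, real_inner_smul_right, ← hK.normal_of_differentiableAt hx hd hu y,
      ← hK.normal_of_differentiableAt hx hd hw y]
    ring
  have hn := congrArg norm h
  rw [norm_smul, norm_smul, hu.1, hw.1, Real.norm_of_nonneg hpu.le, Real.norm_of_nonneg hpw.le,
    mul_one, mul_one] at hn
  rw [← hn] at h
  exact (smul_right_injective _ hpu.ne') h

/-! ### Measurability of the outer normal -/

/-- It is the projection of a compact set of pairs (x, u). All measurability of normals rests on
this. -/
lemma IsBody.isClosed_normal_preimage (hK : IsBody K) {C : Set (Euc n)} (hC : IsClosed C) :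
    IsClosed {x | x ∈ frontier K ∧ ∃ u ∈ C, IsOuterUnitNormal K x u} := by
  have hcomp : IsCompact (frontier K ×ˢ Metric.sphere (0 : Euc n) 1) :=
    (hK.isCompact.of_isClosed_subset isClosed_frontier hK.frontier_subset).prod
      (isCompact_sphere 0 1)
  have hclosed : IsClosed {z : Euc n × Euc n | z.2 ∈ C ∧ ∀ y ∈ K, inner ℝ (y - z.1) z.2 ≤ 0} := by
    apply IsClosed.inter (hC.preimage continuous_snd)
    have : {z : Euc n × Euc n | ∀ y ∈ K, inner ℝ (y - z.1) z.2 ≤ 0}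
        = ⋂ y ∈ K, {z : Euc n × Euc n | inner ℝ (y - z.1) z.2 ≤ 0} := by
      ext z; simp
    change IsClosed {z : Euc n × Euc n | ∀ y ∈ K, inner ℝ (y - z.1) z.2 ≤ 0}
    rw [this]
    refine isClosed_biInter fun y _ => isClosed_le ?_ continuous_const
    fun_prop
  have himg := ((hcomp.inter_right hclosed).image continuous_fst).isClosed
  convert himg using 1
  ext x
  constructor
  · rintro ⟨hx, u, hu, hn⟩
    exact ⟨(x, u), ⟨⟨hx, by simp [hn.1]⟩, hu, hn.2⟩, rfl⟩
  · rintro ⟨⟨x', u⟩, ⟨⟨hx, hs⟩, hu, hn⟩, rfl⟩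
    exact ⟨hx, u, hu, by simpa using hs, hn⟩

/-- The regular boundary points, with a unique outer normal. -/
def regularPoints (K : Set (Euc n)) : Set (Euc n) :=
  {x | x ∈ frontier K ∧ ∃! u, IsOuterUnitNormal K x u}

lemma IsBody.measurableSet_regularPoints (hK : IsBody K) : MeasurableSet (regularPoints K) := by
  let N : Euc n → Euc n → Prop := IsOuterUnitNormal K
  let A : Set (Euc n) → Set (Euc n) := fun C => {x | x ∈ frontier K ∧ ∃ u ∈ C, N x u}
  -- Two distinct normals are separated by a ball of a countable family: one lies in the ball of
  -- radius 1/(k+1), the other outside the concentric ball of radius 2/(k+1).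
  let bad : Set (Euc n) := ⋃ (i : ℕ) (k : ℕ),
    A (Metric.closedBall (TopologicalSpace.denseSeq (Euc n) i) (1 / (k + 1 : ℝ))) ∩
    A ((Metric.ball (TopologicalSpace.denseSeq (Euc n) i) (2 / (k + 1 : ℝ)))ᶜ)
  have hbad : MeasurableSet bad := by
    refine MeasurableSet.iUnion fun i => MeasurableSet.iUnion fun k => MeasurableSet.inter ?_ ?_
    · exact (hK.isClosed_normal_preimage Metric.isClosed_closedBall).measurableSet
    · exact (hK.isClosed_normal_preimage Metric.isOpen_ball.isClosed_compl).measurableSet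
  have heq : regularPoints K = frontier K \ bad := by
    ext x
    constructor
    · rintro ⟨hx, hu⟩
      refine ⟨hx, fun hb => ?_⟩
      simp only [bad, mem_iUnion] at hb
      obtain ⟨i, k, ⟨-, u, huC, hun⟩, -, w, hwC, hwn⟩ := hb
      have := hu.unique hun hwn
      subst this
      apply hwC
      have h1 : dist u (TopologicalSpace.denseSeq (Euc n) i) ≤ 1 / (k + 1 : ℝ) := huC
      have h2 : 1 / (k + 1 : ℝ) < 2 / (k + 1 : ℝ) := by
        apply div_lt_div_of_pos_right (by norm_num); positivity
      exact lt_of_le_of_lt h1 h2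
    · rintro ⟨hx, hb⟩
      obtain ⟨u, hu⟩ := hK.exists_normal hx
      refine ⟨hx, u, hu, fun w hw => ?_⟩
      by_contra hne
      apply hb
      have hd : 0 < dist w u := dist_pos.mpr hne
      obtain ⟨k, hk⟩ := exists_nat_one_div_lt (show 0 < dist w u / 3 by positivity)
      obtain ⟨i, hi⟩ := (TopologicalSpace.denseRange_denseSeq (Euc n)).exists_dist_lt u
        (show 0 < 1 / (k + 1 : ℝ) by positivity)
      simp only [bad, mem_iUnion]
      refine ⟨i, k, ⟨hx, u, hi.le, hu⟩, hx, w, ?_, hw⟩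
      intro hmem
      have h1 : dist w (TopologicalSpace.denseSeq (Euc n) i) < 2 / (k + 1 : ℝ) := hmem
      have h2 := dist_triangle_right w u (TopologicalSpace.denseSeq (Euc n) i)
      have h3 : 2 / (k + 1 : ℝ) = 2 * (1 / (k + 1 : ℝ)) := by ring
      linarith
  rw [heq]
  exact isClosed_frontier.measurableSet.diff hbad

/-- The outer normal on the regular boundary points, and `0` elsewhere. -/
def regularNormal (K : Set (Euc n)) : Euc n → Euc n := (regularPoints K).indicator (outerNormal K)

lemma IsBody.measurable_regularNormal (hK : IsBody K) : Measurable (regularNormal K) := by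
  refine measurable_of_isClosed fun C hC => ?_
  have h0 : regularNormal K ⁻¹' C = (regularPoints K ∩
      {x | x ∈ frontier K ∧ ∃ u ∈ C, IsOuterUnitNormal K x u}) ∪
      ((regularPoints K)ᶜ ∩ {_x | (0 : Euc n) ∈ C}) := by
    ext x
    by_cases hx : x ∈ regularPoints K
    · simp only [regularNormal, mem_preimage, indicator_of_mem hx, mem_union, mem_inter_iff, hx,
        true_and, mem_compl_iff, not_true_eq_false, false_and, or_false, mem_ofPred_eq]
      constructor
      · intro h
        exact ⟨hx.1, _, h, outerNormal_spec hx.2⟩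
      · rintro ⟨-, u, hu, hn⟩
        rw [outerNormal_eq hx.2 hn]; exact hu
    · simp [regularNormal, hx]
  rw [h0]
  exact (hK.measurableSet_regularPoints.inter (hK.isClosed_normal_preimage hC).measurableSet).union
    (hK.measurableSet_regularPoints.compl.inter (MeasurableSet.const _))

end Normals

end BodyDivergence

end

noncomputable section

namespace BodyDivergence

/-! ### Second order expansions -/

section Expansion

variable {E : Type*} [NormedAddCommGroup E] [InnerProductSpace ℝ E]

/-- `F(x + w) = F(x) + ⟨p, w⟩ + ⟨H w, w⟩ / 2 + o(‖w‖²)` with `H` symmetric. -/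
structure HasExpansion (F : E → ℝ) (x p : E) (H : E →L[ℝ] E) : Prop where
  symm : (H : E →ₗ[ℝ] E).IsSymmetric
  isLittleO : (fun w => F (x + w) - F x - inner ℝ p w - 1 / 2 * inner ℝ (H w) w)
    =o[𝓝 0] (fun w => ‖w‖ ^ 2)

variable {F G : E → ℝ} {x p p' : E} {H H' : E →L[ℝ] E}

lemma isLittleO_norm_sq_iff {E : Type*} [SeminormedAddCommGroup E] {R : E → ℝ} :
    R =o[𝓝 0] (fun w => ‖w‖ ^ 2) ↔
      ∀ ε > 0, ∃ δ > 0, ∀ w, ‖w‖ < δ → |R w| ≤ ε * ‖w‖ ^ 2 := by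
  rw [Asymptotics.isLittleO_iff]
  refine forall₂_congr fun ε _ => ?_
  rw [Metric.eventually_nhds_iff]
  simp

lemma HasExpansion.bound (h : HasExpansion F x p H) {ε : ℝ} (hε : 0 < ε) :
    ∃ δ > 0, ∀ w, ‖w‖ < δ →
      |F (x + w) - F x - inner ℝ p w - 1 / 2 * inner ℝ (H w) w| ≤ ε * ‖w‖ ^ 2 :=
  isLittleO_norm_sq_iff.mp h.isLittleO ε hε

lemma abs_inner_apply_self_le (H : E →L[ℝ] E) (w : E) :
    |inner ℝ (H w) w| ≤ ‖H‖ * ‖w‖ ^ 2 := by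
  refine (abs_real_inner_le_norm _ _).trans ?_
  rw [sq, ← mul_assoc]
  exact mul_le_mul_of_nonneg_right (H.le_opNorm w) (norm_nonneg _)

lemma HasExpansion.hasFDerivAt (h : HasExpansion F x p H) : HasFDerivAt F (innerSL ℝ p) x := by
  rw [hasFDerivAt_iff_isLittleO_nhds_zero]
  have h1 : (fun w => 1 / 2 * inner ℝ (H w) w) =O[𝓝 (0 : E)] (fun w => ‖w‖ ^ 2) := by
    refine Asymptotics.IsBigO.of_bound (1 / 2 * ‖H‖) (Eventually.of_forall fun w => ?_)
    rw [Real.norm_eq_abs, abs_mul, abs_of_pos (by norm_num : (0 : ℝ) < 1 / 2), norm_pow,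
      norm_norm, mul_assoc]
    exact mul_le_mul_of_nonneg_left (abs_inner_apply_self_le H w) (by norm_num)
  have h2 := h.isLittleO.isBigO.add h1
  have h3 : (fun w : E => ‖w‖ ^ 2) =o[𝓝 0] (fun w : E => w) :=
    Asymptotics.isLittleO_norm_pow_id one_lt_two
  refine (h2.trans_isLittleO h3).congr_left fun w => ?_
  simp

/-- Along tw with t → 0 both quadratic terms scale like t², so the two forms agree. A form
determines its operator only among symmetric operators, which is why symmetry belongs to
`HasExpansion`. -/
lemma HasExpansion.unique (h : HasExpansion F x p H) (h' : HasExpansion F x p' H') :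
    p = p' ∧ H = H' := by
  have hp : p = p' := by
    have := h.hasFDerivAt.unique h'.hasFDerivAt
    refine ext_inner_right ℝ fun v => ?_
    simpa using congrArg (fun l : E →L[ℝ] ℝ => l v) this
  subst hp
  refine ⟨rfl, ?_⟩
  have hs : ((H - H' : E →L[ℝ] E) : E →ₗ[ℝ] E).IsSymmetric := by
    intro v w
    have h1 := h.symm v w
    have h2 := h'.symm v w
    simp only [ContinuousLinearMap.coe_coe] at h1 h2
    simp [inner_sub_left, inner_sub_right, h1, h2]
  have h0 : ∀ w, inner ℝ ((H - H') w) w = 0 := by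
    intro w
    have key : ∀ ε > 0, |inner ℝ ((H - H') w) w| ≤ ε * (4 * ‖w‖ ^ 2) := by
      intro ε hε
      obtain ⟨δ, hδ, hb⟩ := h.bound hε
      obtain ⟨δ', hδ', hb'⟩ := h'.bound hε
      obtain ⟨t, ht, htw⟩ : ∃ t : ℝ, 0 < t ∧ t * ‖w‖ < min δ δ' := by
        refine ⟨min δ δ' / (‖w‖ + 1), by positivity, ?_⟩
        rw [div_mul_eq_mul_div, div_lt_iff₀ (by positivity)]
        have : 0 < min δ δ' := lt_min hδ hδ'
        nlinarith
      have hn : ‖t • w‖ = t * ‖w‖ := by rw [norm_smul, Real.norm_of_nonneg ht.le]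
      have e1 := hb (t • w) (by rw [hn]; exact htw.trans_le (min_le_left _ _))
      have e2 := hb' (t • w) (by rw [hn]; exact htw.trans_le (min_le_right _ _))
      rw [hn] at e1 e2
      simp only [map_smul, real_inner_smul_left, real_inner_smul_right] at e1 e2
      have e3 : inner ℝ ((H - H') w) w = inner ℝ (H w) w - inner ℝ (H' w) w := by
        rw [_root_.sub_apply, inner_sub_left]
      rw [abs_le] at e1 e2 ⊢
      have ht2 : 0 < t ^ 2 := by positivity
      constructor
      · refine le_of_mul_le_mul_left ?_ ht2
        rw [e3]; nlinarith [e1.1, e1.2, e2.1, e2.2]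
      · refine le_of_mul_le_mul_left ?_ ht2
        rw [e3]; nlinarith [e1.1, e1.2, e2.1, e2.2]
    by_contra hne
    have hpos : 0 < |inner ℝ ((H - H') w) w| := abs_pos.mpr hne
    have := key (|inner ℝ ((H - H') w) w| / (8 * ‖w‖ ^ 2 + 1)) (by positivity)
    rw [div_mul_eq_mul_div, le_div_iff₀ (by positivity)] at this
    nlinarith [sq_nonneg ‖w‖, mul_nonneg hpos.le (sq_nonneg ‖w‖)]
  have := (hs.inner_map_self_eq_zero).mp h0
  rw [← sub_eq_zero]
  ext v
  exact congrArg (fun l : E →ₗ[ℝ] E => l v) this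

lemma HasExpansion.congr_of_eventuallyEq (h : HasExpansion F x p H) (hFG : G =ᶠ[𝓝 x] F) :
    HasExpansion G x p H := by
  refine ⟨h.symm, h.isLittleO.congr' ?_ EventuallyEq.rfl⟩
  have ht : Tendsto (fun w => x + w) (𝓝 0) (𝓝 x) := by
    have : Tendsto (fun w => x + w) (𝓝 0) (𝓝 (x + 0)) := (continuous_const.add continuous_id).tendsto 0
    simpa using this
  filter_upwards [ht.eventually hFG] with w hw
  rw [hw, hFG.eq_of_nhds]

lemma HasExpansion.comp_linear [CompleteSpace E] (S : E →L[ℝ] E) (c : ℝ) {y : E}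
    (h : HasExpansion F (S y) p H) :
    HasExpansion (fun z => c * F (S z)) y (c • S.adjoint p) (c • (S.adjoint ∘L H ∘L S)) := by
  refine ⟨fun v w => ?_, ?_⟩
  · have := h.symm (S v) (S w)
    simp only [ContinuousLinearMap.coe_coe] at this
    simp [real_inner_smul_left, real_inner_smul_right, ContinuousLinearMap.adjoint_inner_left,
      ContinuousLinearMap.adjoint_inner_right, this]
  · have ht : Tendsto S (𝓝 0) (𝓝 0) := by simpa using S.continuous.tendsto 0
    have h1 := h.isLittleO.comp_tendsto ht
    have h2 : (fun w => ‖S w‖ ^ 2) =O[𝓝 0] (fun w : E => ‖w‖ ^ 2) :=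
      ((S.isBigO_id (𝓝 0)).norm_norm).pow 2
    refine ((h1.trans_isBigO h2).const_mul_left c).congr_left fun w => ?_
    simp only [Function.comp_apply, map_add, _root_.smul_apply,
      real_inner_smul_left, ContinuousLinearMap.adjoint_inner_left,
      ContinuousLinearMap.comp_apply]
    ring

lemma _root_.ConvexOn.add_inner_le_of_hasFDerivAt (hF : ConvexOn ℝ univ F)
    (h : HasFDerivAt F (innerSL ℝ p) x) (w : E) : F x + inner ℝ p w ≤ F (x + w) := by
  let l : ℝ →ᵃ[ℝ] E := AffineMap.lineMap x (x + w)
  have hl : ∀ t, l t = x + t • w := fun t => by simp [l, AffineMap.lineMap_apply, add_comm]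
  have hc : ConvexOn ℝ univ (F ∘ l) := by simpa using hF.comp_affineMap l
  have hd : HasDerivAt (F ∘ l) (inner ℝ p w) 0 := by
    have h1 : HasDerivAt l w 0 := by
      have : HasDerivAt (fun t : ℝ => x + t • w) ((1 : ℝ) • w) 0 :=
        ((hasDerivAt_id (0 : ℝ)).smul_const w).const_add x
      rw [one_smul] at this
      exact this.congr_of_eventuallyEq (Eventually.of_forall hl)
    have h2 : HasFDerivAt F (innerSL ℝ p) (l 0) := by simpa [hl] using h
    simpa using h2.comp_hasDerivAt (0 : ℝ) h1
  have := hc.le_slope_of_hasDerivAt (mem_univ 0) (mem_univ 1) zero_lt_one hd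
  rw [slope_def_field] at this
  simp [hl] at this
  linarith

/-- A direction of negative curvature would push F below its tangent plane. -/
lemma HasExpansion.inner_nonneg (h : HasExpansion F x p H) (hF : ConvexOn ℝ univ F) (w : E) :
    0 ≤ inner ℝ (H w) w := by
  by_contra! hneg
  have hw : w ≠ 0 := by rintro rfl; simp at hneg
  have hw' : 0 < ‖w‖ := norm_pos_iff.mpr hw
  obtain ⟨δ, hδ, hb⟩ := h.bound (show 0 < -inner ℝ (H w) w / (4 * ‖w‖ ^ 2) by
    apply div_pos (by linarith); positivity)
  set t := δ / (2 * ‖w‖) with ht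
  have ht0 : 0 < t := by positivity
  have hn : ‖t • w‖ = t * ‖w‖ := by rw [norm_smul, Real.norm_of_nonneg ht0.le]
  have h1 := hb (t • w) (by rw [hn, ht]; field_simp; linarith)
  have h2 := hF.add_inner_le_of_hasFDerivAt h.hasFDerivAt (t • w)
  rw [abs_le] at h1
  rw [hn] at h1
  simp only [map_smul, real_inner_smul_left, real_inner_smul_right] at h1 h2
  have h3 : -inner ℝ (H w) w / (4 * ‖w‖ ^ 2) * (t * ‖w‖) ^ 2 = -inner ℝ (H w) w * t ^ 2 / 4 := by
    field_simp
  rw [h3] at h1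
  have h4 : 0 < t ^ 2 := by positivity
  nlinarith [h1.2, mul_pos_of_neg_of_neg hneg (neg_neg_of_pos h4)]

open Classical in
/-- The determinant of the second derivative in a second order expansion, or `0`. -/
def hessDet (F : E → ℝ) (x : E) : ℝ :=
  if h : ∃ z : E × (E →L[ℝ] E), HasExpansion F x z.1 z.2 then h.choose.2.det else 0

lemma HasExpansion.hessDet_eq (h : HasExpansion F x p H) : hessDet F x = H.det := by
  have hex : ∃ z : E × (E →L[ℝ] E), HasExpansion F x z.1 z.2 := ⟨(p, H), h⟩
  rw [hessDet, dif_pos hex, (hex.choose_spec.unique h).2]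

lemma hessDet_eq_zero (h : ∀ p H, ¬ HasExpansion F x p H) : hessDet F x = 0 := by
  rw [hessDet, dif_neg]
  rintro ⟨z, hz⟩
  exact h _ _ hz

lemma exists_hasExpansion_of_hessDet_ne_zero (h : hessDet F x ≠ 0) :
    ∃ p H, HasExpansion F x p H := by
  by_contra! hcon
  exact h (hessDet_eq_zero hcon)

/-- The default value 0 is covered as well, so no expansion has to be shown to exist. -/
lemma hessDet_congr {y : E} (h : ∀ p H, HasExpansion F x p H ↔ HasExpansion G y p H) :
    hessDet F x = hessDet G y := by
  by_cases hex : ∃ p H, HasExpansion F x p H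
  · obtain ⟨p, H, hH⟩ := hex
    rw [hH.hessDet_eq, ((h p H).mp hH).hessDet_eq]
  · push Not at hex
    rw [hessDet_eq_zero hex, hessDet_eq_zero fun p H hH => hex p H ((h p H).mpr hH)]

lemma hessDet_nonneg [FiniteDimensional ℝ E] (hF : ConvexOn ℝ univ F) (x : E) :
    0 ≤ hessDet F x := by
  by_cases hex : ∃ p H, HasExpansion F x p H
  · obtain ⟨p, H, hH⟩ := hex
    rw [hH.hessDet_eq]
    have hpos : (H : E →ₗ[ℝ] E).IsPositive := ⟨hH.symm, fun w => by
      simpa using hH.inner_nonneg hF w⟩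
    have := ((LinearMap.posSemidef_toMatrix_iff (stdOrthonormalBasis ℝ E)).mpr hpos).det_nonneg
    rwa [LinearMap.det_toMatrix] at this
  · push Not at hex
    rw [hessDet_eq_zero hex]

lemma det_adjoint [FiniteDimensional ℝ E] [CompleteSpace E] (S : E →L[ℝ] E) :
    (ContinuousLinearMap.adjoint S).det = S.det := by
  have h1 := LinearMap.toMatrix_adjoint (stdOrthonormalBasis ℝ E) (stdOrthonormalBasis ℝ E)
    (S : E →ₗ[ℝ] E)
  have h2 := congrArg Matrix.det h1
  rw [Matrix.det_conjTranspose, LinearMap.det_toMatrix, LinearMap.det_toMatrix] at h2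
  exact h2

lemma det_adjoint_comp_comp [FiniteDimensional ℝ E] [CompleteSpace E] (S H : E →L[ℝ] E) (c : ℝ) :
    c * (S.adjoint ∘L H ∘L S).det = c * S.det ^ 2 * H.det := by
  have h : (S.adjoint ∘L H ∘L S).det = S.adjoint.det * (H.det * S.det) := by
    simp only [ContinuousLinearMap.det, ContinuousLinearMap.toLinearMap_comp, LinearMap.det_comp]
  rw [h, det_adjoint]
  ring

/-- As S is invertible and c ≠ 0, an expansion on either side yields one on the other; so the
formula also holds when both determinants are the default 0. -/
lemma hessDet_comp_linearEquiv [FiniteDimensional ℝ E] (S : E ≃L[ℝ] E) {c : ℝ} (hc : c ≠ 0)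
    (y : E) :
    hessDet (fun z => c * F (S z)) y
      = c ^ Module.finrank ℝ E * (S : E →L[ℝ] E).det ^ 2 * hessDet F (S y) := by
  have := FiniteDimensional.complete ℝ E
  by_cases hex : ∃ p H, HasExpansion F (S y) p H
  · obtain ⟨p, H, hH⟩ := hex
    have h1 := (HasExpansion.comp_linear (S : E →L[ℝ] E) c (y := y) hH).hessDet_eq
    simp only [ContinuousLinearEquiv.coe_coe] at h1
    rw [hH.hessDet_eq, h1, ← det_adjoint_comp_comp]
    simp only [ContinuousLinearMap.det, ContinuousLinearMap.toLinearMap_smul, LinearMap.det_smul]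
  · push Not at hex
    rw [hessDet_eq_zero hex, mul_zero]
    refine hessDet_eq_zero fun p H hH => ?_
    have h1 : HasExpansion (fun z => c * F (S z)) ((S.symm : E →L[ℝ] E) (S y)) p H := by
      simpa using hH
    have h2 := HasExpansion.comp_linear (S.symm : E →L[ℝ] E) c⁻¹ h1
    refine hex _ _ (h2.congr_of_eventuallyEq (Eventually.of_forall fun z => ?_))
    simp [hc]

end Expansion

end BodyDivergence

end

noncomputable section

namespace BodyDivergence

/-! ### The gradient map -/

section Gradient

variable {E : Type*} [NormedAddCommGroup E] [InnerProductSpace ℝ E]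
variable {F : E → ℝ} {x p : E} {H : E →L[ℝ] E}

/-- For a convex function, a second order expansion at x forces a first order expansion of its
gradient. The gradient inequality at x + w is tested on a vector z parallel to the error v = q - p -
H w and of length η‖w‖. -/
lemma HasExpansion.norm_gradient_sub_le (hF : HasExpansion F x p H) (hconv : ConvexOn ℝ univ F)
    {ε : ℝ} (hε : 0 < ε) :
    ∃ δ > 0, ∀ (w q : E), ‖w‖ < δ → HasFDerivAt F (innerSL ℝ q) (x + w) →
      ‖q - p - H w‖ ≤ ε * ‖w‖ := by
  set M := ‖H‖ + 1 with hM
  have hMpos : 0 < M := by positivity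
  -- With η ≤ ε / M the term ⟨H z, z⟩ / 2 is at most ε η ‖w‖² / 2. The two remainders, at w and at w
  -- + z with ‖w + z‖ ≤ 2‖w‖, cost ε η / 10 * (1 + 4) ‖w‖², the other half.
  set η := min 1 (ε / M) with hη
  have hη0 : 0 < η := lt_min one_pos (by positivity)
  have hη1 : η ≤ 1 := min_le_left _ _
  have hηM : M * η ≤ ε := by
    calc M * η ≤ M * (ε / M) := by gcongr; exact min_le_right _ _
      _ = ε := by field_simp
  obtain ⟨δ, hδ, hb⟩ := hF.bound (show 0 < ε * η / 10 by positivity)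
  refine ⟨δ / 2, by positivity, fun w q hw hq => ?_⟩
  set v := q - p - H w with hv
  rcases eq_or_ne v 0 with hv0 | hv0
  · rw [hv0, norm_zero]; positivity
  rcases eq_or_ne w 0 with hw0 | hw0
  · subst hw0
    rw [add_zero] at hq
    have := hF.hasFDerivAt.unique hq
    have hpq : p = q := by
      refine ext_inner_right ℝ fun v => ?_
      simpa using congrArg (fun l : E →L[ℝ] ℝ => l v) this
    exact absurd (by rw [hv, hpq]; simp) hv0
  have hr : 0 < ‖w‖ := norm_pos_iff.mpr hw0
  have hvpos : 0 < ‖v‖ := norm_pos_iff.mpr hv0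
  set z := (η * ‖w‖ / ‖v‖) • v with hz
  have hzn : ‖z‖ = η * ‖w‖ := by
    rw [hz, norm_smul, Real.norm_of_nonneg (by positivity)]; field_simp
  have hvz : inner ℝ v z = η * ‖w‖ * ‖v‖ := by
    rw [hz, real_inner_smul_right, real_inner_self_eq_norm_sq]; field_simp
  have hwz : ‖w + z‖ ≤ 2 * ‖w‖ := (norm_add_le _ _).trans (by rw [hzn]; nlinarith)
  have h1 := (abs_le.mp (hb w (by linarith))).1
  have h2 := (abs_le.mp (hb (w + z) (by linarith))).2
  have h3 := hconv.add_inner_le_of_hasFDerivAt hq z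
  have h4 := (abs_le.mp (abs_inner_apply_self_le H z)).2
  have hsym : inner ℝ (H z) w = inner ℝ (H w) z := by
    rw [real_inner_comm]; exact (hF.symm w z).symm
  have h5 : inner ℝ v z = inner ℝ q z - inner ℝ p z - inner ℝ (H w) z := by
    rw [hv, inner_sub_left, inner_sub_left]
  have h6 : ‖w + z‖ ^ 2 ≤ (2 * ‖w‖) ^ 2 := by gcongr
  simp only [map_add, inner_add_left, inner_add_right, hsym] at h2
  rw [add_assoc] at h3
  have h7 : ε * η / 10 * ‖w + z‖ ^ 2 ≤ ε * η / 10 * (2 * ‖w‖) ^ 2 := by gcongr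
  have h8 : ‖H‖ * ‖z‖ ^ 2 ≤ ε * η * ‖w‖ ^ 2 := by
    rw [hzn]
    calc ‖H‖ * (η * ‖w‖) ^ 2 ≤ M * (η * ‖w‖) ^ 2 := by gcongr; rw [hM]; linarith
      _ = (M * η) * (η * ‖w‖ ^ 2) := by ring
      _ ≤ ε * (η * ‖w‖ ^ 2) := by gcongr
      _ = _ := by ring
  have h9 : η * ‖w‖ * ‖v‖ ≤ η * ‖w‖ * (ε * ‖w‖) := by
    rw [← hvz, h5]
    nlinarith
  exact le_of_mul_le_mul_left h9 (by positivity)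

/-- This is the differentiability needed to change variables along the gradient map; nothing is
required of F outside S beyond convexity. -/
lemma hasFDerivWithinAt_gradient (hconv : ConvexOn ℝ univ F) {S : Set E}
    {P : E → E} {A : E → E →L[ℝ] E} (hS : ∀ y ∈ S, HasExpansion F y (P y) (A y)) (hx : x ∈ S) :
    HasFDerivWithinAt P (A x) S x := by
  rw [hasFDerivWithinAt_iff_isLittleO, Asymptotics.isLittleO_iff]
  intro ε hε
  obtain ⟨δ, hδ, hb⟩ := (hS x hx).norm_gradient_sub_le hconv hε
  have : ∀ᶠ y in 𝓝[S] x, dist y x < δ ∧ y ∈ S :=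
    (eventually_nhdsWithin_of_eventually_nhds (Metric.ball_mem_nhds x hδ)).and
      eventually_mem_nhdsWithin
  filter_upwards [this] with y ⟨hy, hyS⟩
  have := hb (y - x) (P y) (by rwa [← dist_eq_norm]) (by
    rw [add_sub_cancel]; exact (hS y hyS).hasFDerivAt)
  exact this

/-- Equal gradients at x and y make F affine on the segment between them, so ⟨H z, z⟩ = 0 for z = y
- x, and then H z = 0 as H is positive semidefinite. If H is invertible, y = x: the gradient map is
injective where the determinant is not 0. -/
lemma HasExpansion.apply_eq_zero_of_eq_gradient (hF : HasExpansion F x p H)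
    (hconv : ConvexOn ℝ univ F) {y : E} (hy : HasFDerivAt F (innerSL ℝ p) y) :
    H (y - x) = 0 := by
  set z := y - x with hz
  have hyz : y = x + z := by rw [hz]; abel
  have h1 := hconv.add_inner_le_of_hasFDerivAt hF.hasFDerivAt z
  have h2 := hconv.add_inner_le_of_hasFDerivAt hy (-z)
  have hx : y + -z = x := by rw [hyz]; abel
  rw [hx, inner_neg_right] at h2
  rw [← hyz] at h1
  have hline : ∀ t : ℝ, 0 ≤ t → t ≤ 1 → F (x + t • z) ≤ F x + t * inner ℝ p z := by
    intro t ht0 ht1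
    have := hconv.2 (mem_univ x) (mem_univ y) (sub_nonneg.mpr ht1) ht0 (by ring)
    have e : (1 - t) • x + t • y = x + t • z := by rw [hyz]; module
    rw [e, smul_eq_mul, smul_eq_mul] at this
    nlinarith
  have hq0 : inner ℝ (H z) z ≤ 0 := by
    by_contra! hpos
    have hz0 : z ≠ 0 := by rintro h0; rw [h0] at hpos; simp at hpos
    have hzn : 0 < ‖z‖ := norm_pos_iff.mpr hz0
    obtain ⟨δ, hδ, hb⟩ := hF.bound (show 0 < inner ℝ (H z) z / (4 * ‖z‖ ^ 2) by positivity)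
    set t := min 1 (δ / (2 * ‖z‖)) with ht
    have ht0 : 0 < t := lt_min one_pos (by positivity)
    have hn : ‖t • z‖ = t * ‖z‖ := by rw [norm_smul, Real.norm_of_nonneg ht0.le]
    have hlt : t * ‖z‖ < δ := by
      calc t * ‖z‖ ≤ δ / (2 * ‖z‖) * ‖z‖ := by gcongr; exact min_le_right _ _
        _ = δ / 2 := by field_simp
        _ < δ := by linarith
    have h3 := (abs_le.mp (hb (t • z) (by rwa [hn]))).1
    have h4 := hline t ht0.le (min_le_left _ _)
    rw [hn] at h3
    simp only [map_smul, real_inner_smul_left, real_inner_smul_right] at h3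
    have h5 : inner ℝ (H z) z / (4 * ‖z‖ ^ 2) * (t * ‖z‖) ^ 2 = inner ℝ (H z) z * t ^ 2 / 4 := by
      field_simp
    rw [h5] at h3
    have h6 : 0 < inner ℝ (H z) z * t ^ 2 := by positivity
    nlinarith
  have hq : inner ℝ (H z) z = 0 := le_antisymm hq0 (hF.inner_nonneg hconv z)
  refine ext_inner_right ℝ fun w => ?_
  rw [inner_zero_left]
  have hpoly : ∀ s : ℝ, 0 ≤ 2 * s * inner ℝ (H z) w + s ^ 2 * inner ℝ (H w) w := by
    intro s
    have h3 := hF.inner_nonneg hconv (z + s • w)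
    have hsym : inner ℝ (H w) z = inner ℝ (H z) w := by
      rw [real_inner_comm]; exact (hF.symm z w).symm
    simp only [map_add, map_smul, inner_add_left, inner_add_right, real_inner_smul_left,
      real_inner_smul_right, hq, hsym] at h3
    nlinarith
  have hww := hF.inner_nonneg hconv w
  set b := inner ℝ (H z) w
  set d := inner ℝ (H w) w
  -- The minimizer of the polynomial is -b / d; the denominator d + 1 avoids the case d = 0.
  have h7 := hpoly (-b / (d + 1))
  have hd1 : 0 < d + 1 := by linarith
  have h8 : 2 * (-b / (d + 1)) * b + (-b / (d + 1)) ^ 2 * d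
      = -(b ^ 2 * (d + 2)) / (d + 1) ^ 2 := by field_simp; ring
  rw [h8] at h7
  have h9 : 0 ≤ -(b ^ 2 * (d + 2)) := by
    have := mul_nonneg h7 (sq_nonneg (d + 1))
    rwa [div_mul_cancel₀ _ (by positivity)] at this
  have h10 : b ^ 2 ≤ 0 := by nlinarith [sq_nonneg b, mul_nonneg (sq_nonneg b) hww]
  exact pow_eq_zero_iff two_ne_zero |>.mp (le_antisymm h10 (sq_nonneg b))

end Gradient

/-! ### Expansions of convex functions that agree near a density point -/

section Density

variable {E : Type*} [NormedAddCommGroup E] [InnerProductSpace ℝ E] [FiniteDimensional ℝ E]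
  [MeasurableSpace E] [BorelSpace E]
variable {F G : E → ℝ} {x p : E} {H : E →L[ℝ] E}

/-- `x` is a point of density one of `C`. -/
def IsDensityPoint (C : Set E) (x : E) : Prop :=
  x ∈ C ∧ Tendsto (fun r => volume (Cᶜ ∩ Metric.closedBall x r) / volume (Metric.closedBall x r))
    (𝓝[>] 0) (𝓝 0)

lemma ae_isDensityPoint {C : Set E} (hC : MeasurableSet C) :
    ∀ᵐ x, x ∈ C → IsDensityPoint C x := by
  filter_upwards [Besicovitch.ae_tendsto_measure_inter_div_of_measurableSet volume hC.compl]
    with x hx hxC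
  refine ⟨hxC, ?_⟩
  rwa [indicator_of_notMem (by simpa using hxC)] at hx

/-- A volume count: the a in the ball of radius η‖w‖ for which one of the two points misses C are
too few to fill it. As |c|, |d| ≥ 1, preimages under a ↦ c a and a ↦ d a do not gain volume; as |c|,
|d| ≤ 2 and η ≤ 1/2, the points stay within 2‖w‖ of x. -/
lemma IsDensityPoint.exists_pair {C : Set E} (h : IsDensityPoint C x) {η : ℝ} (hη : 0 < η)
    (hη1 : η ≤ 1 / 2) {c d : ℝ} (hc : 1 ≤ |c|) (hc2 : |c| ≤ 2) (hd : 1 ≤ |d|) (hd2 : |d| ≤ 2) :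
    ∃ δ > 0, ∀ w : E, w ≠ 0 → ‖w‖ < δ →
      ∃ a : E, ‖a‖ < η * ‖w‖ ∧ x + (w + c • a) ∈ C ∧ x + (w + d • a) ∈ C := by
  set m := Module.finrank ℝ E
  -- (η / 2)^m is the volume ratio of the balls of radii η‖w‖ and 2‖w‖; with the factor 1/4 the two
  -- bad sets fill at most half of the small ball.
  have hε : (0 : ℝ) < (η / 2) ^ m / 4 := by positivity
  have hev := h.2.eventually (gt_mem_nhds (ENNReal.ofReal_pos.mpr hε))
  rw [eventually_nhdsWithin_iff, Metric.eventually_nhds_iff] at hev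
  obtain ⟨δ, hδ, hev⟩ := hev
  refine ⟨δ / 2, by positivity, fun w hw0 hw => ?_⟩
  have : Nontrivial E := ⟨w, 0, hw0⟩
  have hr : 0 < ‖w‖ := norm_pos_iff.mpr hw0
  have h1 := hev (y := 2 * ‖w‖) (by
    rw [Real.dist_eq, sub_zero, abs_of_pos (by positivity)]; linarith) (by
    simp only [mem_Ioi]; positivity)
  set D := Cᶜ ∩ Metric.closedBall x (2 * ‖w‖) with hD
  by_contra! hcon
  have hpre : ∀ e : ℝ, 1 ≤ |e| → volume ((fun a : E => x + (w + e • a)) ⁻¹' D) ≤ volume D := by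
    intro e he
    have he0 : e ≠ 0 := by rintro rfl; norm_num at he
    have hcomp : (fun a : E => x + (w + e • a)) ⁻¹' D
        = (fun a : E => e • a) ⁻¹' ((fun b => (x + w) + b) ⁻¹' D) := by
      ext a; simp [add_assoc]
    rw [hcomp, Measure.addHaar_preimage_smul _ he0, measure_preimage_add]
    refine mul_le_of_le_one_left' ?_
    rw [ENNReal.ofReal_le_one, abs_inv, abs_pow]
    exact inv_le_one_of_one_le₀ (one_le_pow₀ he)
  have hmem : ∀ (a : E) (e : ℝ), |e| ≤ 2 → ‖a‖ < η * ‖w‖ →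
      x + (w + e • a) ∈ Metric.closedBall x (2 * ‖w‖) := by
    intro a e he ha
    rw [mem_closedBall_iff_norm, add_sub_cancel_left]
    calc ‖w + e • a‖ ≤ ‖w‖ + |e| * ‖a‖ := (norm_add_le _ _).trans (by rw [norm_smul, Real.norm_eq_abs])
      _ ≤ ‖w‖ + 2 * (1 / 2 * ‖w‖) := by
        gcongr
        exact ha.le.trans (by gcongr)
      _ = 2 * ‖w‖ := by ring
  have hsub : Metric.ball (0 : E) (η * ‖w‖) ⊆ ((fun a : E => x + (w + c • a)) ⁻¹' D) ∪
      ((fun a : E => x + (w + d • a)) ⁻¹' D) := by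
    intro a ha
    rw [mem_ball_zero_iff] at ha
    by_cases haC : x + (w + c • a) ∈ C
    · exact Or.inr ⟨hcon a ha haC, hmem a d hd2 ha⟩
    · exact Or.inl ⟨haC, hmem a c hc2 ha⟩
  have hball0 : volume (Metric.ball (0 : E) 1) ≠ 0 := (Metric.measure_ball_pos _ _ one_pos).ne'
  have hballt : volume (Metric.ball (0 : E) 1) ≠ ∞ := measure_ball_lt_top.ne
  have h2 : volume (Metric.ball (0 : E) (η * ‖w‖)) ≤ 2 * volume D :=
    (measure_mono hsub).trans ((measure_union_le _ _).trans
      ((add_le_add (hpre c hc) (hpre d hd)).trans_eq (two_mul _).symm))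
  have hcb0 : volume (Metric.closedBall x (2 * ‖w‖)) ≠ 0 :=
    (Metric.measure_closedBall_pos _ _ (by positivity)).ne'
  have hcbt : volume (Metric.closedBall x (2 * ‖w‖)) ≠ ∞ := measure_closedBall_lt_top.ne
  have h3 : volume D < ENNReal.ofReal ((η / 2) ^ m / 4) * volume (Metric.closedBall x (2 * ‖w‖)) :=
    (ENNReal.div_lt_iff (Or.inl hcb0) (Or.inl hcbt)).mp h1
  rw [Measure.addHaar_closedBall _ _ (by positivity), ← mul_assoc,
    ← ENNReal.ofReal_mul hε.le] at h3
  rw [Measure.addHaar_ball _ _ (by positivity)] at h2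
  have h4 : ENNReal.ofReal ((η * ‖w‖) ^ m) * volume (Metric.ball (0 : E) 1)
      ≤ ENNReal.ofReal (2 * ((η / 2) ^ m / 4 * (2 * ‖w‖) ^ m)) * volume (Metric.ball (0 : E) 1) := by
    refine h2.trans ?_
    rw [ENNReal.ofReal_mul zero_le_two, mul_assoc]
    have : (2 : ℝ≥0∞) = ENNReal.ofReal 2 := by simp
    rw [this]
    exact mul_le_mul_right h3.le _
  rw [ENNReal.mul_le_mul_iff_left hball0 hballt, ENNReal.ofReal_le_ofReal_iff (by positivity)] at h4
  have h5 : (η / 2) ^ m * (2 * ‖w‖) ^ m = (η * ‖w‖) ^ m := by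
    rw [← mul_pow]; congr 1; ring
  have h6 : 0 < (η * ‖w‖) ^ m := by positivity
  nlinarith

/-- A convex function that agrees, on a set with density one at `x`, with a function that has a
second order expansion at `x`, has the same expansion. -/
theorem HasExpansion.of_isDensityPoint (hF : HasExpansion F x p H) (hG : ConvexOn ℝ univ G)
    {C : Set E} (hC : ∀ y ∈ C, F y = G y) (hx : IsDensityPoint C x) : HasExpansion G x p H := by
  refine ⟨hF.symm, isLittleO_norm_sq_iff.mpr fun ε hε => ?_⟩
  set M := ‖H‖ + 1 with hM
  have hMpos : 0 < M := by positivity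
  obtain ⟨η, hη, hη1, hηε⟩ : ∃ η : ℝ, 0 < η ∧ η ≤ 1 / 2 ∧ M * η ^ 2 ≤ ε / 2 := by
    have : Tendsto (fun η : ℝ => M * η ^ 2) (𝓝[>] 0) (𝓝 0) := by
      have h0 : Tendsto (fun η : ℝ => M * η ^ 2) (𝓝 0) (𝓝 (M * 0 ^ 2)) :=
        (continuous_const.mul (continuous_pow 2)).tendsto 0
      simp only [ne_eq, OfNat.ofNat_ne_zero, not_false_eq_true, zero_pow, mul_zero] at h0
      exact h0.mono_left nhdsWithin_le_nhds
    have e1 := this.eventually (gt_mem_nhds (half_pos hε))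
    obtain ⟨η, h1, h2⟩ := (e1.and (Ioo_mem_nhdsGT (show (0 : ℝ) < 1 / 2 by norm_num))).exists
    exact ⟨η, h2.1, h2.2.le, h1.le⟩
  obtain ⟨δ₁, hδ₁, hb⟩ := hF.bound (show 0 < ε / 24 by positivity)
  -- The pair (1, -1) makes x + w the midpoint of two points of C, so convexity bounds G(x + w) from
  -- above. The pair (1, 2) makes x + w + a in C the midpoint of x + w and x + w + 2a, which bounds
  -- it from below. In both cases the terms linear in a cancel and only ⟨H a, a⟩ and the remainders
  -- are left.
  obtain ⟨δ₂, hδ₂, hpair₂⟩ := hx.exists_pair hη hη1 (c := 1) (d := -1) (by norm_num) (by norm_num)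
    (by norm_num) (by norm_num)
  obtain ⟨δ₃, hδ₃, hpair₃⟩ := hx.exists_pair hη hη1 (c := 1) (d := 2) (by norm_num) (by norm_num)
    (by norm_num) (by norm_num)
  refine ⟨min (δ₁ / 2) (min δ₂ δ₃), by positivity, fun w hw => ?_⟩
  rcases eq_or_ne w 0 with rfl | hw0
  · simp
  have hr : 0 < ‖w‖ := norm_pos_iff.mpr hw0
  have hw1 : ‖w‖ < δ₁ / 2 := hw.trans_le (min_le_left _ _)
  have hw2 : ‖w‖ < δ₂ := hw.trans_le ((min_le_right _ _).trans (min_le_left _ _))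
  have hw3 : ‖w‖ < δ₃ := hw.trans_le ((min_le_right _ _).trans (min_le_right _ _))
  have hsym : ∀ v, inner ℝ (H v) w = inner ℝ (H w) v := fun v => by
    rw [real_inner_comm]; exact (hF.symm w v).symm
  have hR : ∀ (a : E) (e : ℝ), |e| ≤ 2 → ‖a‖ < η * ‖w‖ →
      |F (x + (w + e • a)) - (F x + inner ℝ p w + e * inner ℝ p a + 1 / 2 * inner ℝ (H w) w
        + e * inner ℝ (H w) a + e ^ 2 / 2 * inner ℝ (H a) a)| ≤ ε / 6 * ‖w‖ ^ 2 := by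
    intro a e he ha
    have hn : ‖w + e • a‖ ≤ 2 * ‖w‖ := by
      calc ‖w + e • a‖ ≤ ‖w‖ + |e| * ‖a‖ :=
            (norm_add_le _ _).trans (by rw [norm_smul, Real.norm_eq_abs])
        _ ≤ ‖w‖ + 2 * (1 / 2 * ‖w‖) := by
          gcongr
          exact ha.le.trans (by gcongr)
        _ = 2 * ‖w‖ := by ring
    have h1 := hb (w + e • a) (by linarith)
    have h2 : ε / 24 * ‖w + e • a‖ ^ 2 ≤ ε / 6 * ‖w‖ ^ 2 := by
      have : ‖w + e • a‖ ^ 2 ≤ (2 * ‖w‖) ^ 2 := by gcongr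
      nlinarith
    refine le_trans (le_of_eq ?_) (h1.trans h2)
    congr 1
    simp only [map_add, map_smul, inner_add_left, inner_add_right, real_inner_smul_left,
      real_inner_smul_right, hsym a]
    ring
  have hquad : ∀ a : E, ‖a‖ < η * ‖w‖ → |inner ℝ (H a) a| ≤ ε / 2 * ‖w‖ ^ 2 := by
    intro a ha
    calc |inner ℝ (H a) a| ≤ ‖H‖ * ‖a‖ ^ 2 := abs_inner_apply_self_le H a
      _ ≤ M * (η * ‖w‖) ^ 2 := by gcongr; rw [hM]; linarith
      _ = M * η ^ 2 * ‖w‖ ^ 2 := by ring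
      _ ≤ _ := by gcongr
  rw [← hC x hx.1, abs_le]
  constructor
  · obtain ⟨a, ha, haC, haC'⟩ := hpair₃ w hw0 hw3
    have h1 := (abs_le.mp (hR a 1 (by norm_num) ha)).1
    have h2 := (abs_le.mp (hR a 2 (by norm_num) ha)).2
    have h3 := (abs_le.mp (hquad a ha)).2
    have hconv := hG.2 (mem_univ (x + w)) (mem_univ (x + (w + (2 : ℝ) • a)))
      (show (0 : ℝ) ≤ 1 / 2 by norm_num) (show (0 : ℝ) ≤ 1 / 2 by norm_num) (by norm_num)
    have hmid : (1 / 2 : ℝ) • (x + w) + (1 / 2 : ℝ) • (x + (w + (2 : ℝ) • a))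
        = x + (w + (1 : ℝ) • a) := by module
    rw [hmid, ← hC _ haC, ← hC _ haC', smul_eq_mul, smul_eq_mul] at hconv
    nlinarith
  · obtain ⟨a, ha, haC, haC'⟩ := hpair₂ w hw0 hw2
    have h1 := (abs_le.mp (hR a 1 (by norm_num) ha)).2
    have h2 := (abs_le.mp (hR a (-1) (by norm_num) ha)).2
    have h3 := (abs_le.mp (hquad a ha)).2
    have hconv := hG.2 (mem_univ (x + (w + (1 : ℝ) • a))) (mem_univ (x + (w + (-1 : ℝ) • a)))
      (show (0 : ℝ) ≤ 1 / 2 by norm_num) (show (0 : ℝ) ≤ 1 / 2 by norm_num) (by norm_num)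
    have hmid : (1 / 2 : ℝ) • (x + (w + (1 : ℝ) • a)) + (1 / 2 : ℝ) • (x + (w + (-1 : ℝ) • a))
        = x + w := by module
    rw [hmid, ← hC _ haC, ← hC _ haC', smul_eq_mul, smul_eq_mul] at hconv
    nlinarith

lemma hessDet_eq_of_isDensityPoint (hF : ConvexOn ℝ univ F) (hG : ConvexOn ℝ univ G)
    {C : Set E} (hC : ∀ y ∈ C, F y = G y) (hx : IsDensityPoint C x) :
    hessDet F x = hessDet G x :=
  hessDet_congr fun _ _ => ⟨fun h => h.of_isDensityPoint hG hC hx,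
    fun h => h.of_isDensityPoint hF (fun y hy => (hC y hy).symm) hx⟩

/-- The determinant of the second derivative of a convex function has finite integral over every
set where the function is Lipschitz. -/
theorem lintegral_hessDet_lt_top (hconv : ConvexOn ℝ univ F) {U : Set E} (hU : IsOpen U)
    {c : NNReal} (hlip : LipschitzOnWith c F U) :
    ∫⁻ x in U, ENNReal.ofReal (hessDet F x) < ∞ := by
  -- `hessDet F` need not be measurable; a measurable minorant with the same integral supplies the
  -- measurable set S on which the determinant is positive.
  obtain ⟨g, hgm, hgle, hgeq⟩ := exists_measurable_le_lintegral_eq (volume.restrict U)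
    (fun x => ENNReal.ofReal (hessDet F x))
  rw [hgeq]
  set S := {x | g x ≠ 0} ∩ U with hS
  have hSm : MeasurableSet S :=
    (measurableSet_eq_fun hgm measurable_const).compl.inter hU.measurableSet
  have hdet : ∀ y ∈ S, 0 < hessDet F y := by
    intro y hy
    by_contra! hle
    have := hgle y
    simp only [ENNReal.ofReal_eq_zero.mpr hle, nonpos_iff_eq_zero] at this
    exact hy.1 this
  have hex : ∀ y, ∃ z : E × (E →L[ℝ] E), y ∈ S → HasExpansion F y z.1 z.2 := by
    intro y
    by_cases hy : y ∈ S
    · obtain ⟨p, H, h⟩ := exists_hasExpansion_of_hessDet_ne_zero (hdet y hy).ne'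
      exact ⟨(p, H), fun _ => h⟩
    · exact ⟨0, fun h => absurd h hy⟩
  choose Z hZ using hex
  have hinj : InjOn (fun y => (Z y).1) S := by
    intro y hy y' hy' heq
    simp only at heq
    have h0 := (hZ y hy).apply_eq_zero_of_eq_gradient hconv (y := y')
      (by rw [heq]; exact (hZ y' hy').hasFDerivAt)
    have hd := hdet y hy
    rw [(hZ y hy).hessDet_eq] at hd
    have hunit : IsUnit (LinearMap.det ((Z y).2 : E →ₗ[ℝ] E)) := isUnit_iff_ne_zero.mpr hd.ne'
    have hinj := (LinearMap.equivOfIsUnitDet hunit).injective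
    have h1 : y' - y = 0 := by
      apply hinj
      simpa using h0
    exact (sub_eq_zero.mp h1).symm
  -- By the area formula the integral becomes the volume of a set of gradients, which the Lipschitz
  -- bound confines to a ball of radius c.
  have hcv := lintegral_abs_det_fderiv_eq_addHaar_image volume hSm
    (f := fun y => (Z y).1) (f' := fun y => (Z y).2)
    (fun y hy => hasFDerivWithinAt_gradient hconv hZ hy) hinj
  have hle : ∫⁻ x in U, g x ≤ ∫⁻ x in S, ENNReal.ofReal |((Z x).2).det| := by
    have h1 : ∫⁻ x in U, g x = ∫⁻ x in S, g x := by
      have hm : MeasurableSet {x | g x ≠ 0} := (measurableSet_eq_fun hgm measurable_const).compl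
      rw [hS, ← Measure.restrict_restrict hm, ← lintegral_indicator hm]
      refine lintegral_congr fun x => ?_
      by_cases hx : g x = 0
      · rw [indicator_of_notMem (by simpa using hx), hx]
      · rw [indicator_of_mem (by simpa using hx)]
    rw [h1]
    refine setLIntegral_mono' hSm fun y hy => (hgle y).trans ?_
    simp only [(hZ y hy).hessDet_eq]
    exact ENNReal.ofReal_le_ofReal (le_abs_self _)
  refine hle.trans_lt ?_
  rw [hcv]
  refine (measure_mono (?_ : _ ⊆ Metric.closedBall (0 : E) c)).trans_lt measure_closedBall_lt_top
  rintro _ ⟨y, hy, rfl⟩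
  rw [mem_closedBall_zero_iff]
  have := (hZ y hy).hasFDerivAt.le_of_lipschitzOn (hU.mem_nhds hy.2) hlip
  simpa using this

end Density

end BodyDivergence

end

noncomputable section

namespace BodyDivergence

/-! ### The Hessian of the squared gauge in terms of the curvature operator -/

section HessianOperator

variable {E : Type*} [NormedAddCommGroup E] [InnerProductSpace ℝ E]
variable (x u : E) (A : (ℝ ∙ u)ᗮ →ₗ[ℝ] (ℝ ∙ u)ᗮ)

/-- The linear map that fixes `u^⊥` and maps `x` to `u`. -/
def shear : E →ₗ[ℝ] E :=
  LinearMap.transvection (((inner ℝ x u)⁻¹ • innerSL ℝ u : E →L[ℝ] ℝ) : E →ₗ[ℝ] ℝ) (u - x)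

variable {x u A}

lemma shear_apply (w : E) : shear x u w = w + ((inner ℝ x u)⁻¹ * inner ℝ w u) • (u - x) := by
  rw [shear, LinearMap.transvection.apply]
  simp [real_inner_comm]

lemma projectionOnto_orthogonal_self (u : E) : (ℝ ∙ u)ᗮ.orthogonalProjectionOnto u = 0 := by
  rw [Submodule.orthogonalProjectionOnto_eq_zero_iff]
  rw [Submodule.mem_orthogonal]
  intro v hv
  rw [Submodule.mem_orthogonal] at hv
  have := hv u (Submodule.mem_span_singleton_self u)
  rwa [real_inner_comm]

lemma inner_coe_orthogonal (v : (ℝ ∙ u)ᗮ) : inner ℝ (v : E) u = 0 := by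
  rw [real_inner_comm]
  exact Submodule.mem_orthogonal_singleton_iff_inner_right.mp v.2

variable [FiniteDimensional ℝ E]

variable (x u A) in
/-- The orthogonal sum of the identity on `ℝ u` and `A / ⟨x, u⟩` on `u^⊥`. -/
def blockOperator : E →ₗ[ℝ] E :=
  (innerSL ℝ u : E →ₗ[ℝ] ℝ).smulRight u + (inner ℝ x u)⁻¹ •
    ((ℝ ∙ u)ᗮ.subtype ∘ₗ A ∘ₗ ((ℝ ∙ u)ᗮ.orthogonalProjectionOnto : E →ₗ[ℝ] (ℝ ∙ u)ᗮ))

variable (x u A) in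
/-- The second derivative of half the squared gauge at `x`, if `A` is the curvature operator. -/
def hessianOperator : E →L[ℝ] E :=
  (LinearMap.toContinuousLinearMap (shear x u)).adjoint ∘L
    LinearMap.toContinuousLinearMap (blockOperator x u A) ∘L
    LinearMap.toContinuousLinearMap (shear x u)

lemma det_shear (hu : ‖u‖ = 1) (hx : inner ℝ x u ≠ 0) :
    LinearMap.det (shear x u) = (inner ℝ x u)⁻¹ := by
  rw [shear, LinearMap.transvection.det]
  simp [inner_sub_right, hu, real_inner_comm]
  field_simp
  ring

lemma det_blockOperator (hu : ‖u‖ = 1) :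
    LinearMap.det (blockOperator x u A)
      = (inner ℝ x u)⁻¹ ^ Module.finrank ℝ (ℝ ∙ u)ᗮ * LinearMap.det A := by
  have hc : IsCompl (ℝ ∙ u) (ℝ ∙ u)ᗮ := Submodule.isCompl_orthogonal _
  let e := (ℝ ∙ u).prodEquivOfIsCompl (ℝ ∙ u)ᗮ hc
  have hconj : blockOperator x u A = (e : _ →ₗ[ℝ] E) ∘ₗ
      (LinearMap.prodMap (LinearMap.id : (ℝ ∙ u) →ₗ[ℝ] (ℝ ∙ u)) ((inner ℝ x u)⁻¹ • A)) ∘ₗ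
      (e.symm : E →ₗ[ℝ] _) := by
    have : blockOperator x u A ∘ₗ (e : _ →ₗ[ℝ] E) = (e : _ →ₗ[ℝ] E) ∘ₗ
        (LinearMap.prodMap (LinearMap.id : (ℝ ∙ u) →ₗ[ℝ] (ℝ ∙ u)) ((inner ℝ x u)⁻¹ • A)) := by
      refine LinearMap.ext fun z => ?_
      obtain ⟨⟨a, ha⟩, v⟩ := z
      obtain ⟨t, rfl⟩ := Submodule.mem_span_singleton.mp ha
      simp only [LinearMap.comp_apply, LinearEquiv.coe_coe, e, Submodule.coe_prodEquivOfIsCompl',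
        LinearMap.prodMap_apply, LinearMap.id_apply, LinearMap.smul_apply, blockOperator,
        LinearMap.add_apply, LinearMap.smulRight_apply, ContinuousLinearMap.coe_coe, map_add,
        map_smul, projectionOnto_orthogonal_self,
        Submodule.orthogonalProjectionOnto_mem_subspace_eq_self, Submodule.subtype_apply,
        innerSL_apply_apply, real_inner_self_eq_norm_sq, hu, real_inner_comm (v : E) u,
        inner_coe_orthogonal]
      simp
    rw [← LinearMap.comp_assoc, ← this, LinearMap.comp_assoc]
    simp
  rw [hconj, LinearMap.det_conj, LinearMap.det_prodMap, LinearMap.det_id, one_mul,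
    LinearMap.det_smul]

/-- The shear enters twice and gives ⟨x, u⟩⁻²; the block on the hyperplane u^⊥ gives the remaining n
- 1 factors, n being the dimension. -/
lemma det_hessianOperator (hu : ‖u‖ = 1) (hx : inner ℝ x u ≠ 0) :
    (hessianOperator x u A).det
      = LinearMap.det A / inner ℝ x u ^ (Module.finrank ℝ E + 1) := by
  have h1 := det_adjoint_comp_comp (LinearMap.toContinuousLinearMap (shear x u))
    (LinearMap.toContinuousLinearMap (blockOperator x u A)) 1
  rw [one_mul, one_mul] at h1
  have hu0 : u ≠ 0 := by rintro rfl; simp at hu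
  have hfr : Module.finrank ℝ (ℝ ∙ u)ᗮ + 1 = Module.finrank ℝ E := by
    have := (ℝ ∙ u).finrank_add_finrank_orthogonal
    rw [finrank_span_singleton hu0] at this
    omega
  rw [hessianOperator, h1, LinearMap.det_toContinuousLinearMap,
    LinearMap.det_toContinuousLinearMap, det_shear hu hx, det_blockOperator hu, ← hfr, inv_pow, inv_pow]
  field_simp
  ring

/-- Splitting w = s x + v with v in u^⊥, the shear sends w to s u + v. The form is s² in the radial
direction, as the energy is 2-homogeneous, plus the curvature form of v divided by ⟨x, u⟩. -/
lemma inner_hessianOperator (w : E) :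
    inner ℝ (hessianOperator x u A w) w = (inner ℝ (shear x u w) u) ^ 2 + (inner ℝ x u)⁻¹ *
      inner ℝ (A ((ℝ ∙ u)ᗮ.orthogonalProjectionOnto (shear x u w)))
        ((ℝ ∙ u)ᗮ.orthogonalProjectionOnto (shear x u w)) := by
  rw [hessianOperator]
  simp only [ContinuousLinearMap.comp_apply, ContinuousLinearMap.adjoint_inner_left,
    LinearMap.coe_toContinuousLinearMap']
  set y := shear x u w
  simp only [blockOperator, LinearMap.add_apply, LinearMap.smulRight_apply,
    ContinuousLinearMap.coe_coe, innerSL_apply_apply, LinearMap.smul_apply, LinearMap.comp_apply,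
    Submodule.subtype_apply, inner_add_left, real_inner_smul_left]
  rw [real_inner_comm u y]
  congr 1
  · ring
  · congr 1
    rw [← Submodule.inner_orthogonalProjectionOnto_eq_of_mem_left]

lemma isSymmetric_hessianOperator (hA : A.IsSymmetric) :
    (hessianOperator x u A : E →ₗ[ℝ] E).IsSymmetric := by
  intro v w
  simp only [ContinuousLinearMap.coe_coe, hessianOperator, ContinuousLinearMap.comp_apply,
    ContinuousLinearMap.adjoint_inner_left, ContinuousLinearMap.adjoint_inner_right,
    LinearMap.coe_toContinuousLinearMap']
  generalize shear x u v = a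
  generalize shear x u w = b
  simp only [blockOperator, LinearMap.add_apply, LinearMap.smulRight_apply,
    ContinuousLinearMap.coe_coe, innerSL_apply_apply, LinearMap.smul_apply, LinearMap.comp_apply,
    Submodule.subtype_apply, inner_add_left, inner_add_right, real_inner_smul_left,
    real_inner_smul_right]
  congr 1
  · rw [real_inner_comm a u]; ring
  · congr 1
    rw [← Submodule.inner_orthogonalProjectionOnto_eq_of_mem_left,
      ← Submodule.inner_orthogonalProjectionOnto_eq_of_mem_right]
    exact hA _ _

end HessianOperator

end BodyDivergence

end

noncomputable section

namespace BodyDivergence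

/-! ### The boundary as a graph over a tangent hyperplane -/

section Graph

variable {n : ℕ} {K : Set (Euc n)} {x u : Euc n}

/-- Half the squared gauge. -/
def energy (K : Set (Euc n)) (y : Euc n) : ℝ := 1 / 2 * gauge K y ^ 2

lemma IsBody.convexOn_energy (hK : IsBody K) : ConvexOn ℝ univ (energy K) := by
  have h1 := hK.convexOn_gauge.pow (fun y _ => gauge_nonneg y) 2
  have h2 := h1.smul (show (0 : ℝ) ≤ 1 / 2 by norm_num)
  exact h2

/-- The line x + v - ℝ u contains an interior point at some depth s > t. The gauge is convex along
the line, equal to 1 at t and below 1 at s, so it exceeds 1 before t, and t is the least parameter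
in K. -/
lemma IsBody.boundaryGraph_eq (hK : IsBody K) (hx : x ∈ frontier K)
    (h : ∃! u, IsOuterUnitNormal K x u) (hu : IsOuterUnitNormal K x u) :
    ∃ δ > 0, ∀ (v : (ℝ ∙ u)ᗮ) (t : ℝ), ‖v‖ < δ → t < δ → gauge K (x + v - t • u) = 1 →
      boundaryGraph K x u v = t := by
  obtain ⟨s, hs, hsK⟩ := hK.exists_sub_smul_mem_interior hx h hu
  have hcont : Tendsto (fun v : Euc n => x + v - s • u) (𝓝 0) (𝓝 (x - s • u)) := by
    have : Tendsto (fun v : Euc n => x + v - s • u) (𝓝 0) (𝓝 (x + 0 - s • u)) :=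
      Continuous.tendsto (by fun_prop) 0
    simpa using this
  obtain ⟨δ, hδ, hball⟩ := Metric.eventually_nhds_iff.mp
    (hcont.eventually (isOpen_interior.mem_nhds hsK))
  refine ⟨min δ s, lt_min hδ hs, fun v t hv ht hg => ?_⟩
  have hint : x + v - s • u ∈ interior K := hball (by
    rw [dist_zero_right]; exact hv.trans_le (min_le_left _ _))
  have hts : t < s := ht.trans_le (min_le_right _ _)
  refine IsLeast.csInf_eq ⟨hK.gauge_le_one_iff.mp hg.le, fun t' ht' => ?_⟩
  by_contra! hlt
  have hg1 := hK.gauge_le_one_iff.mpr ht'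
  have hg2 := hK.gauge_lt_one_iff.mpr hint
  have hst : 0 < s - t' := by linarith
  have hconv := hK.convexOn_gauge.2 (mem_univ (x + v - t' • u)) (mem_univ (x + v - s • u))
    (show 0 ≤ (s - t) / (s - t') by apply div_nonneg <;> linarith)
    (show 0 ≤ (t - t') / (s - t') by apply div_nonneg <;> linarith)
    (by field_simp; ring)
  have hpt : ((s - t) / (s - t')) • (x + (v : Euc n) - t' • u)
      + ((t - t') / (s - t')) • (x + (v : Euc n) - s • u) = x + v - t • u := by
    have h1 : (t - t') / (s - t') = 1 - (s - t) / (s - t') := by field_simp; ring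
    have h2 : t = (s - t) / (s - t') * t' + (1 - (s - t) / (s - t')) * s := by field_simp; ring
    have h3 : t • u = ((s - t) / (s - t') * t' + (1 - (s - t) / (s - t')) * s) • u :=
      congrArg (· • u) h2
    rw [h1, h3]
    module
  rw [hpt, hg, smul_eq_mul, smul_eq_mul] at hconv
  have hpos : 0 < (t - t') / (s - t') := by apply div_pos <;> linarith
  have h3 : (s - t) / (s - t') * gauge K (x + v - t' • u) ≤ (s - t) / (s - t') * 1 :=
    mul_le_mul_of_nonneg_left hg1 (by apply div_nonneg <;> linarith)
  have h4 : (t - t') / (s - t') * gauge K (x + v - s • u) < (t - t') / (s - t') * 1 :=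
    mul_lt_mul_of_pos_left hg2 hpos
  have h5 : (s - t) / (s - t') * 1 + (t - t') / (s - t') * 1 = 1 := by field_simp; ring
  linarith

/-- Intermediate value theorem: on the tangent plane the gauge is at least 1, and a little below it,
at an interior point, less than 1. -/
lemma IsBody.exists_gauge_eq_one (hK : IsBody K) (hx : x ∈ frontier K)
    (h : ∃! u, IsOuterUnitNormal K x u) (hu : IsOuterUnitNormal K x u) {η : ℝ} (hη : 0 < η) :
    ∃ δ > 0, ∀ v : (ℝ ∙ u)ᗮ, ‖v‖ < δ → ∃ t, 0 ≤ t ∧ t < η ∧ gauge K (x + v - t • u) = 1 := by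
  obtain ⟨s₀, hs₀, hs₀K⟩ := hK.exists_sub_smul_mem_interior hx h hu
  obtain ⟨s, hs, hsη, hsK⟩ : ∃ s : ℝ, 0 < s ∧ s < η ∧ x - s • u ∈ interior K := by
    set θ := min (1 / 2) (η / (2 * s₀)) with hθ
    have hθ0 : 0 < θ := lt_min (by norm_num) (by positivity)
    have hθ1 : θ < 1 := (min_le_left _ _).trans_lt (by norm_num)
    refine ⟨θ * s₀, by positivity, ?_, ?_⟩
    · calc θ * s₀ ≤ η / (2 * s₀) * s₀ := by gcongr; exact min_le_right _ _
        _ = η / 2 := by field_simp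
        _ < η := by linarith
    · have := hK.convex.combo_self_interior_mem_interior (hK.frontier_subset hx) hs₀K
        (show 0 ≤ 1 - θ by linarith) hθ0 (by ring)
      convert this using 1
      module
  have hcont : Tendsto (fun v : Euc n => x + v - s • u) (𝓝 0) (𝓝 (x - s • u)) := by
    have : Tendsto (fun v : Euc n => x + v - s • u) (𝓝 0) (𝓝 (x + 0 - s • u)) :=
      Continuous.tendsto (by fun_prop) 0
    simpa using this
  obtain ⟨δ, hδ, hball⟩ := Metric.eventually_nhds_iff.mp
    (hcont.eventually (isOpen_interior.mem_nhds hsK))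
  refine ⟨δ, hδ, fun v hv => ?_⟩
  have hint : x + v - s • u ∈ interior K := hball (by rw [dist_zero_right]; exact hv)
  have hpos := hK.inner_pos hu
  have h0 : 1 ≤ gauge K (x + v - (0 : ℝ) • u) := by
    have := hK.inner_le_gauge hu (x + v - (0 : ℝ) • u)
    rw [zero_smul, sub_zero, inner_add_left, inner_coe_orthogonal, add_zero] at this
    rw [zero_smul, sub_zero]
    by_contra! hlt
    nlinarith
  have h1 := hK.gauge_lt_one_iff.mpr hint
  have hc : ContinuousOn (fun t : ℝ => gauge K (x + v - t • u)) (Icc 0 s) := by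
    have := hK.continuous_gauge
    fun_prop
  obtain ⟨t, ht, hteq⟩ := intermediate_value_Icc' hs.le hc ⟨h1.le, h0⟩
  exact ⟨t, ht.1, ht.2.trans_lt hsη, hteq⟩

/-- A curvature operator gives a second order expansion of half the squared gauge. -/
theorem IsBody.hasExpansion_of_isCurvatureOperator (hK : IsBody K) (hx : x ∈ frontier K)
    (h : ∃! u, IsOuterUnitNormal K x u) (hu : IsOuterUnitNormal K x u)
    {A : (ℝ ∙ u)ᗮ →ₗ[ℝ] (ℝ ∙ u)ᗮ} (hA : IsCurvatureOperator K x u A) :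
    HasExpansion (energy K) x ((inner ℝ x u)⁻¹ • u) (hessianOperator x u A) := by
  refine ⟨isSymmetric_hessianOperator hA.1, ?_⟩
  have hpos := hK.inner_pos hu
  set c := inner ℝ x u with hc
  have hgx : gauge K x = 1 := hK.gauge_eq_one_iff.mpr hx
  let N : Euc n → ℝ := fun w => ‖w‖
  let g : Euc n → ℝ := fun w => gauge K (x + w)
  let s : Euc n → ℝ := fun w => c⁻¹ * inner ℝ w u
  -- x + z is the radial projection of x + w to ∂K, with depth τ below the tangent plane and
  -- tangential part v, so `boundaryGraph` at v is exactly τ. To first order g - 1 is s, and v is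
  -- v₀.
  let z : Euc n → Euc n := fun w => (g w)⁻¹ • (x + w) - x
  let τ : Euc n → ℝ := fun w => -inner ℝ (z w) u
  let π := (ℝ ∙ u)ᗮ.orthogonalProjectionOnto
  let Ac := LinearMap.toContinuousLinearMap A
  let v : Euc n → (ℝ ∙ u)ᗮ := fun w => π (z w)
  let v₀ : Euc n → (ℝ ∙ u)ᗮ := fun w => π (w - s w • x)
  have hN0 : Tendsto N (𝓝 0) (𝓝 0) := by simpa [N] using continuous_norm.tendsto (0 : Euc n)
  have hNN : (fun w => N w ^ 2) =O[𝓝 0] N := by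
    have := (Asymptotics.isLittleO_norm_pow_id (E' := Euc n) one_lt_two).isBigO
    exact this.norm_right
  have hN1 : N =o[𝓝 0] (fun _ => (1 : ℝ)) := (Asymptotics.isLittleO_one_iff ℝ).mpr hN0
  have hid : (fun w : Euc n => w) =O[𝓝 0] N := (Asymptotics.isBigO_refl _ _).norm_right
  -- first order bounds
  have hg1 : (fun w => g w - 1) =O[𝓝 0] N := by
    obtain ⟨C, hC⟩ := hK.exists_lipschitz
    refine Asymptotics.IsBigO.of_bound C (Eventually.of_forall fun w => ?_)
    have := hC.dist_le_mul (x + w) x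
    rw [hgx, dist_eq_norm, dist_eq_norm, add_sub_cancel_left] at this
    simpa [N, g] using this
  have hgt : Tendsto g (𝓝 0) (𝓝 1) := by
    have : Tendsto g (𝓝 0) (𝓝 (gauge K (x + 0))) :=
      (hK.continuous_gauge.comp (continuous_const.add continuous_id)).tendsto 0
    simpa [hgx] using this
  have hgO : g =O[𝓝 0] (fun _ => (1 : ℝ)) := hgt.isBigO_one ℝ
  have hgpos : ∀ᶠ w in 𝓝 0, 0 < g w := hgt.eventually (lt_mem_nhds one_pos)
  have hginvt : Tendsto (fun w => (g w)⁻¹) (𝓝 0) (𝓝 1) := by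
    simpa using hgt.inv₀ one_ne_zero
  have hginvO : (fun w => (g w)⁻¹) =O[𝓝 0] (fun _ => (1 : ℝ)) := hginvt.isBigO_one ℝ
  have hginv : (fun w => (g w)⁻¹ - 1) =O[𝓝 0] N := by
    have h1 : (fun w => (g w)⁻¹ * -(g w - 1)) =O[𝓝 0] (fun w => 1 * N w) :=
      hginvO.mul hg1.neg_left
    simp only [one_mul] at h1
    refine h1.congr' ?_ EventuallyEq.rfl
    filter_upwards [hgpos] with w hw
    field_simp
    ring
  have hs : s =O[𝓝 0] N := by
    refine Asymptotics.IsBigO.of_bound (|c⁻¹|) (Eventually.of_forall fun w => ?_)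
    simp only [s, N, norm_mul, Real.norm_eq_abs, abs_norm]
    have := abs_real_inner_le_norm w u
    rw [hu.1, mul_one] at this
    gcongr
  have hxconst : (fun _ : Euc n => x) =O[𝓝 0] (fun _ => (1 : ℝ)) :=
    Asymptotics.isBigO_const_const _ one_ne_zero _
  have hzrep : ∀ᶠ w in 𝓝 0, z w = (g w)⁻¹ • (w - (g w - 1) • x) := by
    filter_upwards [hgpos] with w hw
    simp only [z]
    have : (g w)⁻¹ * (g w - 1) = 1 - (g w)⁻¹ := by field_simp
    rw [smul_sub, smul_smul, this]
    module
  have hz1 : (fun w => w - (g w - 1) • x) =O[𝓝 0] N := by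
    refine hid.sub ?_
    simpa using hg1.smul hxconst
  have hz : z =O[𝓝 0] N := by
    have : (fun w => (g w)⁻¹ • (w - (g w - 1) • x)) =O[𝓝 0] (fun w => (1 : ℝ) • N w) :=
      hginvO.smul hz1
    simp only [one_smul] at this
    exact this.congr' (hzrep.mono fun w hw => hw.symm) EventuallyEq.rfl
  have hv : v =O[𝓝 0] N := (π.isBigO_comp z _).trans hz
  have hv₀ : v₀ =O[𝓝 0] N := by
    refine (π.isBigO_comp _ _).trans (hid.sub ?_)
    simpa using hs.smul hxconst
  have hzt : Tendsto z (𝓝 0) (𝓝 0) := hz.trans_tendsto hN0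
  have hvt : Tendsto v (𝓝 0) (𝓝 0) := hv.trans_tendsto hN0
  have hτt : Tendsto τ (𝓝 0) (𝓝 0) := by
    have h1 : Tendsto (fun w => -inner ℝ (z w) u) (𝓝 0) (𝓝 (-inner ℝ (0 : Euc n) u)) :=
      (hzt.inner tendsto_const_nhds).neg
    simpa using h1
  -- the exact relation with the graph function
  have hcoe : ∀ y : Euc n, (π y : Euc n) = y - (inner ℝ y u) • u := by
    intro y
    change (ℝ ∙ u)ᗮ.starProjection y = _
    rw [Submodule.starProjection_orthogonal_val, Submodule.starProjection_unit_singleton ℝ hu.1,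
      real_inner_comm]
  have hgraph : ∀ᶠ w in 𝓝 0, boundaryGraph K x u (v w) = τ w := by
    obtain ⟨δ, hδ, hb⟩ := hK.boundaryGraph_eq hx h hu
    have e1 : ∀ᶠ w in 𝓝 (0 : Euc n), ‖v w‖ < δ := by
      have := hvt.norm
      rw [norm_zero] at this
      exact this.eventually (gt_mem_nhds hδ)
    have e2 : ∀ᶠ w in 𝓝 (0 : Euc n), τ w < δ := hτt.eventually (gt_mem_nhds hδ)
    filter_upwards [e1, e2, hgpos] with w h1 h2 h3
    apply hb _ _ h1 h2
    have : x + (v w : Euc n) - τ w • u = (g w)⁻¹ • (x + w) := by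
      simp only [v, hcoe, τ, z]
      module
    rw [this, gauge_smul_nonneg (inv_nonneg.mpr h3.le)]
    exact inv_mul_cancel₀ h3.ne'
  have hφ : (fun w => boundaryGraph K x u (v w) - 1 / 2 * inner ℝ (A (v w)) (v w))
      =o[𝓝 0] (fun w => N w ^ 2) := by
    have := hA.2.comp_tendsto hvt
    exact this.trans_isBigO (hv.norm_left.pow 2)
  have hτφ : (fun w => τ w - 1 / 2 * inner ℝ (A (v w)) (v w)) =o[𝓝 0] (fun w => N w ^ 2) :=
    hφ.congr' (hgraph.mono fun w hw => by simp only [hw]) EventuallyEq.rfl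
  have hinnerO : ∀ {a b : Euc n → (ℝ ∙ u)ᗮ} {M M' : Euc n → ℝ}, a =O[𝓝 0] M → b =O[𝓝 0] M' →
      (fun w => inner ℝ (A (a w)) (b w)) =O[𝓝 0] (fun w => M w * M' w) := by
    intro a b M M' ha hb
    have h1 : (fun w => Ac (a w)) =O[𝓝 0] M := (Ac.isBigO_comp a _).trans ha
    refine Asymptotics.IsBigO.trans ?_ (h1.norm_left.mul hb.norm_left)
    refine Asymptotics.IsBigO.of_bound 1 (Eventually.of_forall fun w => ?_)
    rw [one_mul, Real.norm_eq_abs, norm_mul, norm_norm, norm_norm]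
    exact abs_real_inner_le_norm _ _
  have hτ : τ =O[𝓝 0] (fun w => N w ^ 2) := by
    have h1 := hinnerO hv hv
    have h2 : (fun w => 1 / 2 * inner ℝ (A (v w)) (v w)) =O[𝓝 0] (fun w => N w ^ 2) := by
      refine (h1.const_mul_left (1 / 2)).congr_right fun w => by ring
    refine (hτφ.isBigO.add h2).congr_left fun w => by ring
  -- An exact identity: the gauge differs from its linear part by c⁻¹ g τ, which is of second order
  -- because τ is.
  have hgs : ∀ᶠ w in 𝓝 0, g w - 1 - s w = c⁻¹ * (g w * τ w) := by
    filter_upwards [hgpos] with w hw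
    simp only [τ, z, inner_sub_left, real_inner_smul_left, inner_add_left, ← hc, s]
    field_simp
    ring
  have hgs2 : (fun w => g w - 1 - s w) =O[𝓝 0] (fun w => N w ^ 2) := by
    have h1 : (fun w => c⁻¹ * (g w * τ w)) =O[𝓝 0] (fun w => 1 * N w ^ 2) :=
      (hgO.mul hτ).const_mul_left _
    simp only [one_mul] at h1
    exact h1.congr' (hgs.mono fun w hw => hw.symm) EventuallyEq.rfl
  have hdiff : (fun w => v w - v₀ w) =O[𝓝 0] (fun w => N w ^ 2) := by
    have h0 : (fun w => z w - (w - s w • x)) =O[𝓝 0] (fun w => N w ^ 2) := by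
      have h1 : (fun w => ((g w)⁻¹ - 1) • (w - (g w - 1) • x)) =O[𝓝 0]
          (fun w => N w • N w) := hginv.smul hz1
      have h2 : (fun w => (g w - 1 - s w) • x) =O[𝓝 0] (fun w => N w ^ 2 • (1 : ℝ)) :=
        hgs2.smul hxconst
      have h3 := (h1.congr_right (g₂ := fun w => N w ^ 2) fun w => by
        rw [smul_eq_mul, sq]).sub (h2.congr_right (g₂ := fun w => N w ^ 2) fun w => by
        rw [smul_eq_mul, mul_one])
      refine h3.congr' ?_ EventuallyEq.rfl
      filter_upwards [hzrep] with w hw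
      rw [hw]
      module
    refine ((π.isBigO_comp _ _).trans h0).congr_left fun w => ?_
    simp only [v, v₀, map_sub]
  have hquad : (fun w => inner ℝ (A (v w)) (v w) - inner ℝ (A (v₀ w)) (v₀ w))
      =o[𝓝 0] (fun w => N w ^ 2) := by
    have h1 := (hinnerO hdiff hv)
    have h2 := (hinnerO hv₀ hdiff)
    have h3 : (fun w => N w ^ 2 * N w) =o[𝓝 0] (fun w => N w ^ 2) := by
      simpa using (Asymptotics.isBigO_refl (fun w => N w ^ 2) (𝓝 0)).mul_isLittleO hN1
    have h4 : (fun w => N w * N w ^ 2) =o[𝓝 0] (fun w => N w ^ 2) :=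
      h3.congr_left fun w => mul_comm _ _
    refine ((h1.trans_isLittleO h3).add (h2.trans_isLittleO h4)).congr_left fun w => ?_
    simp only [map_sub, inner_sub_left, inner_sub_right]
    ring
  have hτ₀ : (fun w => τ w - 1 / 2 * inner ℝ (A (v₀ w)) (v₀ w)) =o[𝓝 0] (fun w => N w ^ 2) := by
    refine (hτφ.add (hquad.const_mul_left (1 / 2))).congr_left fun w => by ring
  -- Squaring g = 1 + s + c⁻¹ g τ gives half the square as (1 + s)² / 2 plus c⁻¹ τ times a factor
  -- tending to 1; this is the error of replacing that factor by 1.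
  have hrem : (fun w => τ w * (1 / 2 * g w * (2 * (1 + s w) + c⁻¹ * (g w * τ w)) - 1))
      =o[𝓝 0] (fun w => N w ^ 2) := by
    have hst : Tendsto s (𝓝 0) (𝓝 0) := hs.trans_tendsto hN0
    have ht : Tendsto (fun w => 1 / 2 * g w * (2 * (1 + s w) + c⁻¹ * (g w * τ w)) - 1) (𝓝 0)
        (𝓝 (1 / 2 * 1 * (2 * (1 + 0) + c⁻¹ * (1 * 0)) - 1)) :=
      ((tendsto_const_nhds.mul hgt).mul ((tendsto_const_nhds.mul (tendsto_const_nhds.add hst)).add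
        (tendsto_const_nhds.mul (hgt.mul hτt)))).sub tendsto_const_nhds
    have e0 : (1 / 2 * 1 * (2 * (1 + 0) + c⁻¹ * (1 * 0)) - 1 : ℝ) = 0 := by ring
    rw [e0] at ht
    have h1 := hτ.mul_isLittleO ((Asymptotics.isLittleO_one_iff ℝ).mpr ht)
    simpa using h1
  refine ((hτ₀.const_mul_left c⁻¹).add (hrem.const_mul_left c⁻¹)).congr' ?_ EventuallyEq.rfl
  filter_upwards [hgs] with w hw
  have hgw : g w = 1 + s w + c⁻¹ * (g w * τ w) := by linarith
  have hsh : inner ℝ (shear x u w) u = s w := by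
    rw [shear_apply, inner_add_left, real_inner_smul_left, inner_sub_left,
      real_inner_self_eq_norm_sq, hu.1, ← hc]
    simp only [s]
    field_simp
    ring
  have hpr : π (shear x u w) = v₀ w := by
    rw [shear_apply]
    simp only [v₀, s, map_add, map_sub, map_smul, π, projectionOnto_orthogonal_self, ← hc]
    module
  rw [inner_hessianOperator, hsh]
  change _ = energy K (x + w) - energy K x - _ - 1 / 2 * (s w ^ 2 + c⁻¹ *
    inner ℝ (A (π (shear x u w))) (π (shear x u w)))
  rw [hpr, energy, energy, hgx, real_inner_smul_left, real_inner_comm w u]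
  change _ = 1 / 2 * g w ^ 2 - 1 / 2 * 1 ^ 2 - s w - _
  have hsq : g w ^ 2 = (1 + s w) ^ 2 + c⁻¹ * (g w * τ w) * (2 * (1 + s w) + c⁻¹ * (g w * τ w)) := by
    calc g w ^ 2 = (1 + s w + c⁻¹ * (g w * τ w)) ^ 2 := by rw [← hgw]
      _ = _ := by ring
  rw [hsq]
  ring

/-- The gauge is the square root of twice the energy; at gauge 1 the chain rule factor is 1, so both
gradients are p. -/
lemma IsBody.differentiableAt_gauge_of_hasExpansion (hK : IsBody K) (hx : x ∈ frontier K)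
    {p : Euc n} {H : Euc n →L[ℝ] Euc n} (hH : HasExpansion (energy K) x p H) :
    HasFDerivAt (gauge K) (innerSL ℝ p) x := by
  have hgx : gauge K x = 1 := hK.gauge_eq_one_iff.mpr hx
  have h1 := (hH.hasFDerivAt.const_mul 2).sqrt (by rw [energy, hgx]; norm_num)
  have h2 : (fun y => √(2 * energy K y)) = gauge K := by
    funext y
    rw [energy, ← mul_assoc]
    norm_num
    exact Real.sqrt_sq (gauge_nonneg y)
  rw [h2] at h1
  have h3 : (1 / (2 * √(2 * energy K x))) • (2 : ℝ) • innerSL ℝ p = innerSL ℝ p := by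
    rw [smul_smul, energy, hgx]
    norm_num
  rwa [h3] at h1

/-- A second order expansion of half the squared gauge gives a curvature operator. -/
theorem IsBody.exists_isCurvatureOperator_of_hasExpansion (hK : IsBody K) (hx : x ∈ frontier K)
    {p : Euc n} {H : Euc n →L[ℝ] Euc n} (hH : HasExpansion (energy K) x p H)
    (hu : IsOuterUnitNormal K x u) : ∃ A, IsCurvatureOperator K x u A := by
  have hgd := hK.differentiableAt_gauge_of_hasExpansion hx hH
  have hun := hK.existsUnique_normal_of_differentiableAt hx hgd.differentiableAt
  have hpos := hK.inner_pos hu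
  set c := inner ℝ x u with hc
  have hgx : gauge K x = 1 := hK.gauge_eq_one_iff.mpr hx
  have hp : ∀ w, c * inner ℝ p w = inner ℝ w u := by
    intro w
    have := hK.normal_of_differentiableAt hx hgd.differentiableAt hu w
    rwa [hgd.fderiv] at this
  let ι := (ℝ ∙ u)ᗮ.subtypeL
  let π := (ℝ ∙ u)ᗮ.orthogonalProjectionOnto
  -- The curvature operator is the compression of H to the tangent hyperplane, scaled by ⟨x, u⟩.
  let A : (ℝ ∙ u)ᗮ →L[ℝ] (ℝ ∙ u)ᗮ := c • (π ∘L H ∘L ι)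
  have hA : ∀ v v' : (ℝ ∙ u)ᗮ, inner ℝ (A v) v' = c * inner ℝ (H v) (v' : Euc n) := by
    intro v v'
    simp only [A, _root_.smul_apply, ContinuousLinearMap.comp_apply, real_inner_smul_left, π, ι,
      Submodule.subtypeL_apply]
    rw [Submodule.inner_orthogonalProjectionOnto_eq_of_mem_right]
  refine ⟨A, fun v v' => ?_, ?_⟩
  · change inner ℝ (A v) v' = inner ℝ v (A v')
    rw [real_inner_comm (A v') v, hA, hA, real_inner_comm (v : Euc n) (H v')]
    congr 1
    exact hH.symm v v'
  let φ : (ℝ ∙ u)ᗮ → ℝ := boundaryGraph K x u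
  obtain ⟨δ₀, hδ₀, hb⟩ := hK.boundaryGraph_eq hx hun hu
  have hev : ∀ η > 0, ∀ᶠ v in 𝓝 (0 : (ℝ ∙ u)ᗮ),
      0 ≤ φ v ∧ φ v < η ∧ gauge K (x + v - φ v • u) = 1 := by
    intro η hη
    obtain ⟨δ, hδ, hex⟩ := hK.exists_gauge_eq_one hx hun hu (lt_min hη hδ₀)
    filter_upwards [Metric.ball_mem_nhds (0 : (ℝ ∙ u)ᗮ) (lt_min hδ hδ₀)] with v hv
    rw [mem_ball_zero_iff] at hv
    obtain ⟨t, ht0, htη, htg⟩ := hex v (hv.trans_le (min_le_left _ _))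
    have : φ v = t := hb v t (hv.trans_le (min_le_right _ _)) (htη.trans_le (min_le_right _ _)) htg
    rw [this]
    exact ⟨ht0, htη.trans_le (min_le_left _ _), htg⟩
  have hφt : Tendsto φ (𝓝 0) (𝓝 0) := by
    rw [Metric.tendsto_nhds]
    intro η hη
    filter_upwards [hev η hη] with v hv
    rw [Real.dist_eq, sub_zero, abs_of_nonneg hv.1]
    exact hv.2.1
  let w : (ℝ ∙ u)ᗮ → Euc n := fun v => v - φ v • u
  have hwt : Tendsto w (𝓝 0) (𝓝 0) := by
    have h1 : Tendsto (fun v : (ℝ ∙ u)ᗮ => (v : Euc n)) (𝓝 0) (𝓝 ((0 : (ℝ ∙ u)ᗮ) : Euc n)) :=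
      continuous_subtype_val.tendsto 0
    have h2 := h1.sub (hφt.smul_const u)
    simpa using h2
  have hR := hH.isLittleO.comp_tendsto hwt
  -- The energy is constant along ∂K, so the expansion reads 0 = ⟨p, w⟩ + ⟨H w, w⟩ / 2 + remainder,
  -- with ⟨p, w⟩ = -φ / c.
  have hφeq : ∀ᶠ v in 𝓝 (0 : (ℝ ∙ u)ᗮ), φ v = c * ((energy K (x + w v) - energy K x -
      inner ℝ p (w v) - 1 / 2 * inner ℝ (H (w v)) (w v)) + 1 / 2 * inner ℝ (H (w v)) (w v)) := by
    filter_upwards [hev 1 one_pos] with v hv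
    have h1 : energy K (x + w v) = energy K x := by
      have : x + w v = x + v - φ v • u := by simp only [w]; abel
      rw [energy, energy, this, hv.2.2, hgx]
    have h2 := hp (w v)
    have h3 : inner ℝ (w v) u = -φ v := by
      simp only [w, inner_sub_left, inner_coe_orthogonal, real_inner_smul_left,
        real_inner_self_eq_norm_sq, hu.1]
      ring
    rw [h1]
    linarith
  have hinnerO : ∀ {a b : (ℝ ∙ u)ᗮ → Euc n} {M M' : (ℝ ∙ u)ᗮ → ℝ}, a =O[𝓝 0] M → b =O[𝓝 0] M' →
      (fun v => inner ℝ (H (a v)) (b v)) =O[𝓝 0] (fun v => M v * M' v) := by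
    intro a b M M' ha hb
    have h1 : (fun v => H (a v)) =O[𝓝 0] M := (H.isBigO_comp a _).trans ha
    refine Asymptotics.IsBigO.trans ?_ (h1.norm_left.mul hb.norm_left)
    refine Asymptotics.IsBigO.of_bound 1 (Eventually.of_forall fun v => ?_)
    rw [one_mul, Real.norm_eq_abs, norm_mul, norm_norm, norm_norm]
    exact abs_real_inner_le_norm _ _
  have hww : w =O[𝓝 0] (fun v => ‖w v‖) := (Asymptotics.isBigO_refl _ _).norm_right
  have hφw : φ =O[𝓝 0] (fun v => ‖w v‖ ^ 2) := by
    have h1 : (fun v => 1 / 2 * inner ℝ (H (w v)) (w v)) =O[𝓝 0] (fun v => ‖w v‖ ^ 2) :=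
      ((hinnerO hww hww).const_mul_left (1 / 2)).congr_right fun v => (sq _).symm
    exact ((hR.isBigO.add h1).const_mul_left c).congr' (hφeq.mono fun v hv => hv.symm)
      EventuallyEq.rfl
  -- The height φ is quadratic in w, hence w = v - φ u is O(‖v‖), and estimates in w become
  -- estimates in v.
  have hφo : (fun v => φ v • u) =o[𝓝 0] w := by
    have h1 : (fun v => ‖w v‖ ^ 2) =o[𝓝 0] w :=
      (Asymptotics.isLittleO_norm_pow_id (E' := Euc n) one_lt_two).comp_tendsto hwt
    have h2 : (fun v => φ v • u) =O[𝓝 0] φ := by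
      refine Asymptotics.IsBigO.of_bound 1 (Eventually.of_forall fun v => ?_)
      rw [norm_smul, hu.1, mul_one, one_mul]
    exact (h2.trans hφw).trans_isLittleO h1
  have hwv : w =O[𝓝 0] (fun v => ‖v‖) := by
    have h1 := hφo.right_isBigO_add
    have h2 : ∀ v, φ v • u + w v = (v : Euc n) := fun v => by simp only [w]; abel
    simp only [h2] at h1
    exact h1.norm_right
  have hwv2 : (fun v => ‖w v‖ ^ 2) =O[𝓝 0] (fun v => ‖v‖ ^ 2) := hwv.norm_left.pow 2
  have hφv : φ =O[𝓝 0] (fun v => ‖v‖ ^ 2) := hφw.trans hwv2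
  have hvv : (fun v : (ℝ ∙ u)ᗮ => (v : Euc n)) =O[𝓝 0] (fun v => ‖v‖) :=
    Asymptotics.IsBigO.of_bound 1 (Eventually.of_forall fun v => by simp)
  have hdiff : (fun v => w v - (v : Euc n)) =O[𝓝 0] (fun v => ‖v‖ ^ 2) := by
    refine Asymptotics.IsBigO.trans (Asymptotics.IsBigO.of_bound 1
      (Eventually.of_forall fun v => ?_)) hφv
    simp [w, norm_smul, hu.1]
  have hN1 : (fun v : (ℝ ∙ u)ᗮ => ‖v‖) =o[𝓝 0] (fun _ => (1 : ℝ)) := by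
    rw [Asymptotics.isLittleO_one_iff]
    simpa using continuous_norm.tendsto (0 : (ℝ ∙ u)ᗮ)
  have hquad : (fun v => inner ℝ (H (w v)) (w v) - inner ℝ (H (v : Euc n)) (v : Euc n))
      =o[𝓝 0] (fun v => ‖v‖ ^ 2) := by
    have h1 := hinnerO hdiff hwv
    have h2 := hinnerO hvv hdiff
    have h3 : (fun v : (ℝ ∙ u)ᗮ => ‖v‖ ^ 2 * ‖v‖) =o[𝓝 0] (fun v => ‖v‖ ^ 2) := by
      simpa using (Asymptotics.isBigO_refl (fun v : (ℝ ∙ u)ᗮ => ‖v‖ ^ 2) (𝓝 0)).mul_isLittleO hN1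
    have h4 : (fun v : (ℝ ∙ u)ᗮ => ‖v‖ * ‖v‖ ^ 2) =o[𝓝 0] (fun v => ‖v‖ ^ 2) :=
      h3.congr_left fun v => mul_comm _ _
    refine ((h1.trans_isLittleO h3).add (h2.trans_isLittleO h4)).congr_left fun v => ?_
    simp only [map_sub, inner_sub_left, inner_sub_right]
    ring
  refine (((hR.trans_isBigO hwv2).const_mul_left c).add
    (hquad.const_mul_left (c / 2))).congr' ?_ EventuallyEq.rfl
  filter_upwards [hφeq] with v hv
  change _ = φ v - 1 / 2 * inner ℝ (A v) v
  rw [hA, hv]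
  simp only [Function.comp_apply]
  ring

/-- The curvature ratio `κ / ⟨x, N⟩ⁿ⁺¹` is the Hessian determinant of half the squared gauge. -/
theorem IsBody.gaussCurvature_div (hK : IsBody K) (hx : x ∈ frontier K) :
    gaussCurvature K x / inner ℝ x (outerNormal K x) ^ (n + 1) = hessDet (energy K) x := by
  by_cases h : (∃! u, IsOuterUnitNormal K x u) ∧ ∃ A, IsCurvatureOperator K x (outerNormal K x) A
  · have hu := outerNormal_spec h.1
    have hexp := hK.hasExpansion_of_isCurvatureOperator hx h.1 hu h.2.choose_spec
    rw [gaussCurvature, dif_pos h, hexp.hessDet_eq, det_hessianOperator hu.1 (hK.inner_pos hu).ne',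
      finrank_euclideanSpace_fin]
  -- Without normal or curvature operator the left side is 0 by default. An expansion of the energy
  -- would provide both, so the right side is 0 too.
  · rw [gaussCurvature, dif_neg h, zero_div, eq_comm]
    refine hessDet_eq_zero fun p H hH => h ?_
    have hun := hK.existsUnique_normal_of_differentiableAt hx
      (hK.differentiableAt_gauge_of_hasExpansion hx hH).differentiableAt
    exact ⟨hun, hK.exists_isCurvatureOperator_of_hasExpansion hx hH (outerNormal_spec hun)⟩

end Graph

end BodyDivergence

end

noncomputable section

namespace BodyDivergence

/-! ### Hausdorff measures of images -/

section Hausdorff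

variable {X Y : Type*} [MetricSpace X] [MeasurableSpace X] [BorelSpace X]
  [MetricSpace Y] [MeasurableSpace Y] [BorelSpace Y]

lemma euclideanHausdorffMeasure_image_le {f : X → Y} {s : Set X} {C : NNReal}
    (h : LipschitzOnWith C f s) (d : ℕ) :
    (μHE[d] : Measure Y) (f '' s) ≤ (C : ℝ≥0∞) ^ d * (μHE[d] : Measure X) s := by
  rw [Measure.euclideanHausdorffMeasure_def, Measure.euclideanHausdorffMeasure_def,
    Measure.smul_apply, Measure.smul_apply, ENNReal.smul_def, ENNReal.smul_def, smul_eq_mul,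
    smul_eq_mul, mul_left_comm]
  have := h.hausdorffMeasure_image_le (d := d) (Nat.cast_nonneg d)
  rw [ENNReal.rpow_natCast] at this
  exact mul_le_mul_right this _

lemma euclideanHausdorffMeasure_le_image [Nonempty X] {f : X → Y} {s : Set X} {C : NNReal}
    (h : ∀ x ∈ s, ∀ y ∈ s, dist x y ≤ C * dist (f x) (f y)) (d : ℕ) :
    (μHE[d] : Measure X) s ≤ (C : ℝ≥0∞) ^ d * (μHE[d] : Measure Y) (f '' s) := by
  have hinj : InjOn f s := by
    intro x hx y hy hxy
    have := h x hx y hy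
    rw [hxy, dist_self, mul_zero] at this
    exact dist_le_zero.mp this
  have hinv : ∀ x ∈ s, Function.invFunOn f s (f x) = x := fun x hx =>
    hinj.leftInvOn_invFunOn hx
  have hlip : LipschitzOnWith C (Function.invFunOn f s) (f '' s) := by
    refine LipschitzOnWith.of_dist_le_mul ?_
    rintro _ ⟨x, hx, rfl⟩ _ ⟨y, hy, rfl⟩
    rw [hinv x hx, hinv y hy]
    exact h x hx y hy
  have himg : Function.invFunOn f s '' (f '' s) = s := by
    rw [image_image]
    exact (image_congr hinv).trans (image_id' s)
  have := euclideanHausdorffMeasure_image_le hlip d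
  rwa [himg] at this

end Hausdorff

/-! ### Finiteness of the surface area measure -/

section Surface

variable {n : ℕ} {K : Set (Euc n)}

lemma euclideanHausdorffMeasure_top_dim : (μHE[n] : Measure (Euc n)) = volume :=
  EuclideanSpace.euclideanHausdorffMeasure_eq_volume n

lemma finrank_orthogonal_singleton {u : Euc n} (hu : u ≠ 0) :
    Module.finrank ℝ (ℝ ∙ u)ᗮ = n - 1 := by
  have := (ℝ ∙ u).finrank_add_finrank_orthogonal
  rw [finrank_span_singleton hu, finrank_euclideanSpace_fin] at this
  omega

/-- Between two points with a normal within 1/2 of u, the displacement has a component along u of at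
most half its length. So the projection to u^⊥ has a 2-Lipschitz inverse on B, and its image is
bounded. -/
lemma IsBody.measure_normal_near_lt_top (hK : IsBody K) {u : Euc n} (hu : ‖u‖ = 1) :
    (μHE[n - 1] : Measure (Euc n)) {x | x ∈ frontier K ∧
      ∃ w ∈ Metric.closedBall u (1 / 2), IsOuterUnitNormal K x w} < ∞ := by
  set B := {x | x ∈ frontier K ∧ ∃ w ∈ Metric.closedBall u (1 / 2), IsOuterUnitNormal K x w}
  have hu0 : u ≠ 0 := by rintro rfl; simp at hu
  let P := (ℝ ∙ u)ᗮ.orthogonalProjectionOnto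
  have hone : ∀ x ∈ B, ∀ y ∈ B, inner ℝ (y - x) u ≤ 1 / 2 * ‖y - x‖ := by
    rintro x ⟨-, w, hw, hxw⟩ y ⟨hy, -⟩
    have h1 := hxw.2 y (hK.frontier_subset hy)
    have h2 : inner ℝ (y - x) u = inner ℝ (y - x) w + inner ℝ (y - x) (u - w) := by
      rw [← inner_add_right]; congr 1; abel
    have h3 := real_inner_le_norm (y - x) (u - w)
    have h4 : ‖u - w‖ ≤ 1 / 2 := by rw [← dist_eq_norm, dist_comm]; exact hw
    nlinarith [norm_nonneg (y - x)]
  have hdist : ∀ x ∈ B, ∀ y ∈ B, dist x y ≤ ((2 : NNReal) : ℝ) * dist (P x) (P y) := by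
    intro x hx y hy
    rw [dist_eq_norm, dist_eq_norm, ← map_sub]
    have h1 := hone x hx y hy
    have h2 := hone y hy x hx
    have h3 : inner ℝ (y - x) u = -inner ℝ (x - y) u := by rw [← inner_neg_left]; congr 1; abel
    rw [h3, norm_sub_rev y x] at h1
    have h4 := Submodule.norm_sq_eq_add_norm_sq_projection (x - y) (ℝ ∙ u)
    have h5 : ‖(ℝ ∙ u).orthogonalProjectionOnto (x - y)‖ ≤ 1 / 2 * ‖x - y‖ := by
      have e : ((ℝ ∙ u).orthogonalProjectionOnto (x - y) : Euc n) = inner ℝ u (x - y) • u :=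
        Submodule.starProjection_unit_singleton ℝ hu (x - y)
      rw [Submodule.coe_norm, e, norm_smul, hu, mul_one, Real.norm_eq_abs, abs_le,
        real_inner_comm]
      constructor <;> linarith
    have h6 : ‖(ℝ ∙ u).orthogonalProjectionOnto (x - y)‖ ^ 2 ≤ (1 / 2 * ‖x - y‖) ^ 2 := by gcongr
    have h7 : ‖x - y‖ ^ 2 ≤ (2 * ‖P (x - y)‖) ^ 2 := by
      change ‖x - y‖ ^ 2 = _ + ‖P (x - y)‖ ^ 2 at h4
      nlinarith
    exact abs_le_of_sq_le_sq' h7 (by positivity) |>.2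
  refine (euclideanHausdorffMeasure_le_image hdist (n - 1)).trans_lt ?_
  refine ENNReal.mul_lt_top (by simp) ?_
  rw [← finrank_orthogonal_singleton hu0, InnerProductSpace.euclideanHausdorffMeasure_eq_volume]
  have hbdd : Bornology.IsBounded (P '' B) :=
    P.lipschitz.isBounded_image (hK.isCompact.isBounded.subset fun x hx =>
      hK.frontier_subset hx.1)
  exact hbdd.measure_lt_top

lemma IsBody.isFiniteMeasure_surfaceMeasure (hK : IsBody K) :
    IsFiniteMeasure (surfaceMeasure K) := by
  refine ⟨?_⟩
  rw [surfaceMeasure, Measure.restrict_apply_univ]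
  obtain ⟨t, hts, htfin, hcover⟩ := (isCompact_sphere (0 : Euc n) 1).finite_cover_balls
    (show (0 : ℝ) < 1 / 2 by norm_num)
  have hsub : frontier K ⊆ ⋃ u ∈ t, {x | x ∈ frontier K ∧
      ∃ w ∈ Metric.closedBall u (1 / 2), IsOuterUnitNormal K x w} := by
    intro x hx
    obtain ⟨w, hw⟩ := hK.exists_normal hx
    obtain ⟨u, hut, hu⟩ := mem_iUnion₂.mp (hcover (by simpa using hw.1 : w ∈ Metric.sphere 0 1))
    exact mem_iUnion₂.mpr ⟨u, hut, hx, w, Metric.ball_subset_closedBall hu, hw⟩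
  refine (measure_mono hsub).trans_lt ?_
  refine measure_biUnion_lt_top htfin fun u hu => ?_
  exact hK.measure_normal_near_lt_top (by simpa using hts hu)

/-! ### Volumes of flat cones -/

lemma lintegral_pow_Ioc (k : ℕ) :
    ((k + 1 : ℕ) : ℝ≥0∞) * ∫⁻ s in Ioc (0 : ℝ) 1, ENNReal.ofReal s ^ k = 1 := by
  have h1 : ∫⁻ s in Ioc (0 : ℝ) 1, ENNReal.ofReal s ^ k
      = ENNReal.ofReal (∫ s in (0 : ℝ)..1, s ^ k) := by
    rw [intervalIntegral.integral_of_le zero_le_one, ofReal_integral_eq_lintegral_ofReal]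
    · refine setLIntegral_congr_fun measurableSet_Ioc fun s hs => ?_
      exact (ENNReal.ofReal_pow hs.1.le k).symm
    · exact (continuous_pow k).integrableOn_Ioc
    · filter_upwards [ae_restrict_mem measurableSet_Ioc] with s hs
      exact pow_nonneg hs.1.le k
  rw [h1, integral_pow]
  rw [← ENNReal.ofReal_natCast, ← ENNReal.ofReal_mul (Nat.cast_nonneg _)]
  simp
  field_simp

open scoped Pointwise in
-- The volume formula for a cone of height ‖ξ‖⁻¹ over D: the slice at level s is s D, its measure
-- scales by s^(n-1), and n ∫ s^(n-1) ds over (0, 1] is 1.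
lemma volume_flat_cone (hn : 0 < n) {ξ : Euc n} (hξ : ξ ≠ 0) {D C : Set (Euc n)}
    (hD : ∀ d ∈ D, inner ℝ d ξ = 1) (hC : MeasurableSet C)
    (hCD : ∀ y, y ∈ C ↔ ∃ t ∈ Ioc (0 : ℝ) 1, y ∈ t • D) :
    (n : ℝ≥0∞) * volume C = ENNReal.ofReal ‖ξ‖⁻¹ * (μHE[n - 1] : Measure (Euc n)) D := by
  have hξn : 0 < ‖ξ‖ := norm_pos_iff.mpr hξ
  -- v is the foot of the perpendicular from 0 to the hyperplane ⟨·, ξ⟩ = 1, so s v lies on level s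
  -- and slicing along v brings in the factor ‖v‖ = ‖ξ‖⁻¹.
  set v : Euc n := (‖ξ‖ ^ 2)⁻¹ • ξ with hv
  have hv0 : v ≠ 0 := smul_ne_zero (by positivity) hξ
  have hvn : ‖v‖ = ‖ξ‖⁻¹ := by
    rw [hv, norm_smul, Real.norm_of_nonneg (by positivity)]; field_simp
  have key := EuclideanGeometry.euclideanHausdorffMeasure_eq_lintegral (0 : Euc n) hv0 hC
  rw [finrank_euclideanSpace_fin, euclideanHausdorffMeasure_top_dim] at key
  have hmem : ∀ (s : ℝ) (y : Euc n),
      y ∈ AffineSubspace.mk' (s • v +ᵥ (0 : Euc n)) (ℝ ∙ v)ᗮ ↔ inner ℝ y ξ = s := by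
    intro s y
    rw [AffineSubspace.mem_mk', Submodule.mem_orthogonal_singleton_iff_inner_left]
    simp only [vsub_eq_sub, vadd_eq_add, add_zero, inner_sub_left, real_inner_smul_left]
    rw [real_inner_self_eq_norm_sq, hvn, hv, real_inner_smul_right, sub_eq_zero]
    field_simp
  have hslice : ∀ s : ℝ, (μHE[n - 1] : Measure (Euc n))
      (C ∩ AffineSubspace.mk' (s • v +ᵥ (0 : Euc n)) (ℝ ∙ v)ᗮ)
      = (Ioc (0 : ℝ) 1).indicator
        (fun s => ENNReal.ofReal s ^ (n - 1) * (μHE[n - 1] : Measure (Euc n)) D) s := by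
    intro s
    by_cases hs : s ∈ Ioc (0 : ℝ) 1
    · rw [indicator_of_mem hs]
      have : C ∩ AffineSubspace.mk' (s • v +ᵥ (0 : Euc n)) (ℝ ∙ v)ᗮ = s • D := by
        ext y
        constructor
        · rintro ⟨hyC, hyP⟩
          obtain ⟨t, -, d, hd, rfl⟩ := (hCD y).mp hyC
          have := (hmem s _).mp hyP
          simp only [real_inner_smul_left, hD d hd, mul_one] at this
          rw [← this]
          exact ⟨d, hd, rfl⟩
        · rintro ⟨d, hd, rfl⟩
          refine ⟨(hCD _).mpr ⟨s, hs, d, hd, rfl⟩, (hmem s _).mpr ?_⟩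
          simp only [real_inner_smul_left, hD d hd, mul_one]
      rw [this, Measure.euclideanHausdorffMeasure_smul₀ _ hs.1.ne', ENNReal.smul_def, smul_eq_mul]
      congr 1
      rw [ENNReal.coe_pow, ← enorm_eq_nnnorm, Real.enorm_of_nonneg hs.1.le]
    · rw [indicator_of_notMem hs]
      have : C ∩ AffineSubspace.mk' (s • v +ᵥ (0 : Euc n)) (ℝ ∙ v)ᗮ = ∅ := by
        rw [eq_empty_iff_forall_notMem]
        rintro y ⟨hyC, hyP⟩
        obtain ⟨t, ht, d, hd, rfl⟩ := (hCD y).mp hyC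
        have := (hmem s _).mp hyP
        simp only [real_inner_smul_left, hD d hd, mul_one] at this
        exact hs (this ▸ ht)
      rw [this, measure_empty]
  rw [key]
  simp_rw [hslice]
  rw [lintegral_indicator measurableSet_Ioc, lintegral_mul_const _ (by fun_prop)]
  have hI := lintegral_pow_Ioc (n - 1)
  rw [Nat.sub_add_cancel hn] at hI
  have he : ‖v‖ₑ = ENNReal.ofReal ‖ξ‖⁻¹ := by rw [← ofReal_norm, hvn]
  rw [he]
  calc (n : ℝ≥0∞) * (ENNReal.ofReal ‖ξ‖⁻¹ * ((∫⁻ s in Ioc (0 : ℝ) 1, ENNReal.ofReal s ^ (n - 1))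
        * (μHE[n - 1] : Measure (Euc n)) D))
      = (n * ∫⁻ s in Ioc (0 : ℝ) 1, ENNReal.ofReal s ^ (n - 1)) *
        (ENNReal.ofReal ‖ξ‖⁻¹ * (μHE[n - 1] : Measure (Euc n)) D) := by ring
    _ = _ := by rw [hI, one_mul]

end Surface

end BodyDivergence

end

noncomputable section

namespace BodyDivergence

/-! ### The cone measure -/

section Cone

variable {n : ℕ} {K : Set (Euc n)} {x : Euc n}

/-- The radial projection to the boundary. -/
def radial (K : Set (Euc n)) (y : Euc n) : Euc n := (gauge K y)⁻¹ • y

/-- The cone measure, `n` times the volume of the cone over a part of the boundary. -/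
def coneMeasure (K : Set (Euc n)) : Measure (Euc n) :=
  (n : ℝ≥0∞) • (volume.restrict K).map (radial K)

lemma IsBody.measurable_radial (hK : IsBody K) : Measurable (radial K) :=
  hK.continuous_gauge.measurable.inv.smul measurable_id

lemma IsBody.measurableSet (hK : IsBody K) : MeasurableSet K := hK.isCompact.isClosed.measurableSet

lemma IsBody.radial_mem_frontier (hK : IsBody K) {y : Euc n} (hy : y ≠ 0) :
    radial K y ∈ frontier K := by
  have hg := hK.gauge_pos_iff.mpr hy
  rw [← hK.gauge_eq_one_iff, radial, gauge_smul_nonneg (inv_nonneg.mpr hg.le),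
    inv_mul_cancel₀ hg.ne']

lemma IsBody.gauge_smul_radial (hK : IsBody K) (y : Euc n) : gauge K y • radial K y = y := by
  rcases eq_or_ne y 0 with rfl | hy
  · simp [radial]
  · rw [radial, smul_smul, mul_inv_cancel₀ (hK.gauge_pos_iff.mpr hy).ne', one_smul]

lemma IsBody.coneMeasure_apply (hK : IsBody K) {B : Set (Euc n)} (hB : MeasurableSet B) :
    coneMeasure K B = n * volume (radial K ⁻¹' B ∩ K) := by
  rw [coneMeasure, Measure.smul_apply, smul_eq_mul, Measure.map_apply hK.measurable_radial hB,
    Measure.restrict_apply (hK.measurable_radial hB)]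

lemma IsBody.isFiniteMeasure_coneMeasure (hK : IsBody K) : IsFiniteMeasure (coneMeasure K) := by
  refine ⟨?_⟩
  rw [hK.coneMeasure_apply MeasurableSet.univ]
  refine ENNReal.mul_lt_top (by simp) ?_
  exact (measure_mono inter_subset_right).trans_lt hK.isCompact.measure_lt_top

/-- The gradient `N / ⟨x, N⟩` of the gauge at a regular boundary point. -/
def polarNormal (K : Set (Euc n)) (x : Euc n) : Euc n :=
  (inner ℝ x (regularNormal K x))⁻¹ • regularNormal K x

/-- The support density `⟨x, N⟩` on the regular boundary points, and `0` elsewhere. -/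
def supportDensity (K : Set (Euc n)) (x : Euc n) : ℝ := inner ℝ x (regularNormal K x)

lemma IsBody.measurable_supportDensity (hK : IsBody K) : Measurable (supportDensity K) :=
  Measurable.inner measurable_id hK.measurable_regularNormal

lemma IsBody.measurable_polarNormal (hK : IsBody K) : Measurable (polarNormal K) :=
  hK.measurable_supportDensity.inv.smul hK.measurable_regularNormal

lemma regularNormal_eq (hx : x ∈ regularPoints K) : regularNormal K x = outerNormal K x :=
  indicator_of_mem hx _

lemma supportDensity_eq_zero (hx : x ∉ regularPoints K) : supportDensity K x = 0 := by
  rw [supportDensity, regularNormal, indicator_of_notMem hx, inner_zero_right]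

lemma isOuterUnitNormal_regularNormal (hx : x ∈ regularPoints K) :
    IsOuterUnitNormal K x (regularNormal K x) := by
  rw [regularNormal_eq hx]; exact outerNormal_spec hx.2

lemma IsBody.supportDensity_nonneg (hK : IsBody K) (x : Euc n) : 0 ≤ supportDensity K x := by
  by_cases hx : x ∈ regularPoints K
  · exact (hK.inner_pos (isOuterUnitNormal_regularNormal hx)).le
  · rw [supportDensity_eq_zero hx]

lemma IsBody.norm_polarNormal (hK : IsBody K) (hx : x ∈ regularPoints K) :
    ‖polarNormal K x‖ = (supportDensity K x)⁻¹ := by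
  have hu := isOuterUnitNormal_regularNormal hx
  have hpos := hK.inner_pos hu
  rw [polarNormal, norm_smul, hu.1, mul_one, norm_inv, Real.norm_of_nonneg hpos.le, supportDensity]

lemma IsBody.inner_polarNormal_self (hK : IsBody K) (hx : x ∈ regularPoints K) :
    inner ℝ x (polarNormal K x) = 1 := by
  have hpos := hK.inner_pos (isOuterUnitNormal_regularNormal hx)
  rw [polarNormal, real_inner_smul_right, inv_mul_cancel₀ hpos.ne']

lemma IsBody.inner_polarNormal_le (hK : IsBody K) (hx : x ∈ regularPoints K) (z : Euc n) :
    inner ℝ z (polarNormal K x) ≤ gauge K z := by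
  have hu := isOuterUnitNormal_regularNormal hx
  have hpos := hK.inner_pos hu
  rw [polarNormal, real_inner_smul_right, inv_mul_le_iff₀ hpos]
  exact hK.inner_le_gauge hu z

/-- Subgradients of the gauge are constant along rays. -/
lemma IsBody.gauge_sub_ge (hK : IsBody K) {y : Euc n} (hy : radial K y ∈ regularPoints K)
    (z : Euc n) :
    inner ℝ (z - y) (polarNormal K (radial K y)) ≤ gauge K z - gauge K y := by
  have h1 := hK.inner_polarNormal_le hy z
  have h2 : inner ℝ y (polarNormal K (radial K y)) = gauge K y := by
    nth_rewrite 1 [← hK.gauge_smul_radial y]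
    rw [real_inner_smul_left, hK.inner_polarNormal_self hy, mul_one]
  rw [inner_sub_left, h2]
  linarith

/-- The map that flattens the boundary to the hyperplane `⟨·, ξ⟩ = 1`. -/
def flatten (K : Set (Euc n)) (ξ y : Euc n) : Euc n :=
  y + ((gauge K y - inner ℝ y ξ) * (‖ξ‖ ^ 2)⁻¹) • ξ

lemma IsBody.continuous_flatten (hK : IsBody K) (ξ : Euc n) : Continuous (flatten K ξ) := by
  have := hK.continuous_gauge
  unfold flatten
  fun_prop

lemma inner_flatten {ξ : Euc n} (hξ : ξ ≠ 0) (y : Euc n) :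
    inner ℝ (flatten K ξ y) ξ = gauge K y := by
  have hξn : 0 < ‖ξ‖ := norm_pos_iff.mpr hξ
  rw [flatten, inner_add_left, real_inner_smul_left, real_inner_self_eq_norm_sq]
  field_simp
  ring

lemma flatten_smul {t : ℝ} (ht : 0 ≤ t) (ξ y : Euc n) :
    flatten K ξ (t • y) = t • flatten K ξ y := by
  rw [flatten, flatten, gauge_smul_nonneg ht, real_inner_smul_left, smul_add, smul_smul]
  congr 2
  ring

/-- Flattening moves points along ξ by a multiple of g - ⟨·, ξ⟩, whose subgradients over B have norm
at most δ‖ξ‖. The subgradient inequality from each of the two ends replaces a mean value argument,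
so the cone over B need not be convex. -/
lemma IsBody.norm_flatten_sub_le (hK : IsBody K) {ξ : Euc n} (hξ : ξ ≠ 0) {δ : ℝ}
    {B : Set (Euc n)} (hB : B ⊆ regularPoints K)
    (hBξ : ∀ x ∈ B, ‖polarNormal K x - ξ‖ ≤ δ * ‖ξ‖) {y z : Euc n} (hy : radial K y ∈ B)
    (hz : radial K z ∈ B) :
    ‖(flatten K ξ y - flatten K ξ z) - (y - z)‖ ≤ δ * ‖y - z‖ := by
  have hξn : 0 < ‖ξ‖ := norm_pos_iff.mpr hξ
  have hone : ∀ y z : Euc n, radial K y ∈ B →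
      -(δ * ‖ξ‖ * ‖z - y‖) ≤ gauge K z - gauge K y - inner ℝ (z - y) ξ := by
    intro y z hy
    have h1 := hK.gauge_sub_ge (hB hy) z
    have h2 : inner ℝ (z - y) (polarNormal K (radial K y))
        = inner ℝ (z - y) ξ + inner ℝ (z - y) (polarNormal K (radial K y) - ξ) := by
      rw [← inner_add_right]; congr 1; abel
    have h3 := abs_le.mp (abs_real_inner_le_norm (z - y) (polarNormal K (radial K y) - ξ))
    have h4 := mul_le_mul_of_nonneg_left (hBξ _ hy) (norm_nonneg (z - y))
    nlinarith [h3.1]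
  have habs : |gauge K y - gauge K z - inner ℝ (y - z) ξ| ≤ δ * ‖ξ‖ * ‖y - z‖ := by
    have h1 := hone z y hz
    have h2 := hone y z hy
    rw [norm_sub_rev z y] at h2
    have h3 : inner ℝ (z - y) ξ = -inner ℝ (y - z) ξ := by rw [← inner_neg_left]; congr 1; abel
    rw [h3] at h2
    rw [abs_le]
    constructor <;> linarith
  have heq : (flatten K ξ y - flatten K ξ z) - (y - z)
      = ((gauge K y - gauge K z - inner ℝ (y - z) ξ) * (‖ξ‖ ^ 2)⁻¹) • ξ := by
    rw [flatten, flatten, inner_sub_left]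
    module
  rw [heq, norm_smul, norm_mul, Real.norm_eq_abs, norm_inv, norm_pow, norm_norm]
  calc |gauge K y - gauge K z - inner ℝ (y - z) ξ| * (‖ξ‖ ^ 2)⁻¹ * ‖ξ‖
      ≤ δ * ‖ξ‖ * ‖y - z‖ * (‖ξ‖ ^ 2)⁻¹ * ‖ξ‖ := by gcongr
    _ = δ * ‖y - z‖ := by field_simp

lemma IsBody.lipschitzOnWith_flatten (hK : IsBody K) {ξ : Euc n} (hξ : ξ ≠ 0) {δ : NNReal}
    {B S : Set (Euc n)} (hB : B ⊆ regularPoints K)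
    (hBξ : ∀ x ∈ B, ‖polarNormal K x - ξ‖ ≤ δ * ‖ξ‖) (hS : ∀ y ∈ S, radial K y ∈ B) :
    LipschitzOnWith (1 + δ) (flatten K ξ) S := by
  refine LipschitzOnWith.of_dist_le_mul fun y hy z hz => ?_
  have h := hK.norm_flatten_sub_le hξ hB hBξ (hS y hy) (hS z hz)
  rw [dist_eq_norm, dist_eq_norm]
  have h2 := norm_sub_norm_le (flatten K ξ y - flatten K ξ z) (y - z)
  push_cast
  linarith

lemma IsBody.dist_le_flatten (hK : IsBody K) {ξ : Euc n} (hξ : ξ ≠ 0) {δ : NNReal} (hδ : δ < 1)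
    {B S : Set (Euc n)} (hB : B ⊆ regularPoints K)
    (hBξ : ∀ x ∈ B, ‖polarNormal K x - ξ‖ ≤ δ * ‖ξ‖) (hS : ∀ y ∈ S, radial K y ∈ B) :
    ∀ y ∈ S, ∀ z ∈ S, dist y z
      ≤ (((1 - δ)⁻¹ : NNReal) : ℝ) * dist (flatten K ξ y) (flatten K ξ z) := by
  intro y hy z hz
  have h := hK.norm_flatten_sub_le hξ hB hBξ (hS y hy) (hS z hz)
  have hδ' : (0 : ℝ) < 1 - δ := sub_pos.mpr (by exact_mod_cast hδ)
  rw [dist_eq_norm, dist_eq_norm, NNReal.coe_inv, NNReal.coe_sub hδ.le, NNReal.coe_one,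
    le_inv_mul_iff₀ hδ']
  have h2 := norm_sub_norm_le (y - z) (flatten K ξ y - flatten K ξ z)
  rw [norm_sub_rev (y - z)] at h2
  linarith

lemma radial_of_gauge_eq_one (hx : gauge K x = 1) : radial K x = x := by
  rw [radial, hx, inv_one, one_smul]

/-- The measure `⟨x, N⟩ μ_K`. -/
def supportMeasure (K : Set (Euc n)) : Measure (Euc n) :=
  densityMeasure (surfaceMeasure K) (supportDensity K)

lemma supportMeasure_apply {B : Set (Euc n)} (hB : MeasurableSet B) (hBK : B ⊆ frontier K) :
    supportMeasure K B
      = ∫⁻ x in B, ENNReal.ofReal (supportDensity K x) ∂(μHE[n - 1] : Measure (Euc n)) := by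
  rw [supportMeasure, densityMeasure, withDensity_apply _ hB, surfaceMeasure,
    Measure.restrict_restrict hB, inter_eq_left.mpr hBK]

open scoped Pointwise in
lemma IsBody.mem_image_flatten_cone_iff (hK : IsBody K) {ξ : Euc n} {B : Set (Euc n)}
    (hB : B ⊆ frontier K) (y : Euc n) :
    y ∈ flatten K ξ '' (radial K ⁻¹' B ∩ K) ↔ ∃ t ∈ Ioc (0 : ℝ) 1, y ∈ t • (flatten K ξ '' B) := by
  constructor
  · rintro ⟨c, ⟨hcB, hcK⟩, rfl⟩
    have hc0 : c ≠ 0 := by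
      rintro rfl
      have h1 := hK.gauge_eq_one_iff.mpr (hB hcB)
      simp [radial] at h1
    refine ⟨gauge K c, ⟨hK.gauge_pos_iff.mpr hc0, hK.gauge_le_one_iff.mpr hcK⟩, ?_⟩
    refine ⟨flatten K ξ (radial K c), ⟨_, hcB, rfl⟩, ?_⟩
    simp only
    rw [← flatten_smul (gauge_nonneg c), hK.gauge_smul_radial]
  · rintro ⟨t, ht, _, ⟨b, hb, rfl⟩, rfl⟩
    have hgb : gauge K b = 1 := hK.gauge_eq_one_iff.mpr (hB hb)
    have hg : gauge K (t • b) = t := by rw [gauge_smul_nonneg ht.1.le, hgb, mul_one]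
    refine ⟨t • b, ⟨?_, ?_⟩, flatten_smul ht.1.le ξ b⟩
    · rw [mem_preimage, radial, hg, smul_smul, inv_mul_cancel₀ ht.1.ne', one_smul]
      exact hb
    · rw [← hK.gauge_le_one_iff, hg]
      exact ht.2

/-- On a piece of the boundary where the normals are nearly constant, the cone measure and the
measure `⟨x, N⟩ μ_K` are nearly equal. -/
lemma IsBody.measures_comparable (hK : IsBody K) (hn : 0 < n) {ξ : Euc n} (hξ : ξ ≠ 0)
    {δ : NNReal} (hδ : δ < 1) {B : Set (Euc n)} (hBm : MeasurableSet B)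
    (hB : B ⊆ regularPoints K) (hBξ : ∀ x ∈ B, ‖polarNormal K x - ξ‖ ≤ δ * ‖ξ‖) :
    supportMeasure K B ≤ (((1 + δ) * (1 - δ)⁻¹ : NNReal) : ℝ≥0∞) ^ n * coneMeasure K B ∧
      coneMeasure K B ≤ (((1 + δ) * (1 - δ)⁻¹ : NNReal) : ℝ≥0∞) ^ n * supportMeasure K B := by
  have hξn : 0 < ‖ξ‖ := norm_pos_iff.mpr hξ
  have hδ' : (0 : ℝ) < 1 - δ := sub_pos.mpr (by exact_mod_cast hδ)
  have hBf : B ⊆ frontier K := fun x hx => (hB hx).1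
  set C₀ := radial K ⁻¹' B ∩ K with hC₀
  have hC₀m : MeasurableSet C₀ := (hK.measurable_radial hBm).inter hK.measurableSet
  have hS1 : ∀ y ∈ C₀, radial K y ∈ B := fun y hy => hy.1
  have hS2 : ∀ y ∈ B, radial K y ∈ B := fun y hy => by
    rwa [radial_of_gauge_eq_one (hK.gauge_eq_one_iff.mpr (hBf hy))]
  have hd1 := hK.dist_le_flatten hξ hδ hB hBξ hS1
  have hd2 := hK.dist_le_flatten hξ hδ hB hBξ hS2
  have hinj : InjOn (flatten K ξ) C₀ := by
    intro y hy z hz hyz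
    have := hd1 y hy z hz
    rw [hyz, dist_self, mul_zero] at this
    exact dist_le_zero.mp this
  -- An injective continuous image of a Borel set is Borel.
  have hCm : MeasurableSet (flatten K ξ '' C₀) :=
    hC₀m.image_of_continuousOn_injOn (hK.continuous_flatten ξ).continuousOn hinj
  have hflat := volume_flat_cone hn hξ (D := flatten K ξ '' B) (C := flatten K ξ '' C₀)
    (by
      rintro _ ⟨b, hb, rfl⟩
      rw [inner_flatten hξ]
      exact hK.gauge_eq_one_iff.mpr (hBf hb))
    hCm (hK.mem_image_flatten_cone_iff hBf)
  set a := (μHE[n - 1] : Measure (Euc n)) B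
  set a' := (μHE[n - 1] : Measure (Euc n)) (flatten K ξ '' B)
  set r : ℝ≥0∞ := ((1 + δ : NNReal) : ℝ≥0∞)
  set s : ℝ≥0∞ := (((1 - δ)⁻¹ : NNReal) : ℝ≥0∞)
  set e : ℝ≥0∞ := ENNReal.ofReal ‖ξ‖⁻¹
  have h1 : a' ≤ r ^ (n - 1) * a :=
    euclideanHausdorffMeasure_image_le (hK.lipschitzOnWith_flatten hξ hB hBξ hS2) (n - 1)
  have h2 : a ≤ s ^ (n - 1) * a' := euclideanHausdorffMeasure_le_image hd2 (n - 1)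
  have h3 : volume (flatten K ξ '' C₀) ≤ r ^ n * volume C₀ := by
    have := euclideanHausdorffMeasure_image_le (hK.lipschitzOnWith_flatten hξ hB hBξ hS1) n
    rwa [euclideanHausdorffMeasure_top_dim] at this
  have h4 : volume C₀ ≤ s ^ n * volume (flatten K ξ '' C₀) := by
    have := euclideanHausdorffMeasure_le_image hd1 n
    rwa [euclideanHausdorffMeasure_top_dim] at this
  have hcone : coneMeasure K B = n * volume C₀ := hK.coneMeasure_apply hBm
  -- The norm of `polarNormal` is the inverse of the support density, so on B this density is ‖ξ‖⁻¹
  -- up to factors 1 ± δ.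
  have hbound : ∀ x ∈ B, supportDensity K x ≤ (1 - δ : ℝ)⁻¹ * ‖ξ‖⁻¹ ∧
      ‖ξ‖⁻¹ ≤ (1 + δ) * supportDensity K x := by
    intro x hx
    have hnp := hK.norm_polarNormal (hB hx)
    have hpos : 0 < supportDensity K x :=
      hK.inner_pos (isOuterUnitNormal_regularNormal (hB hx))
    have hd := hBξ x hx
    have e1 := norm_sub_norm_le (polarNormal K x) ξ
    have e2 := norm_sub_norm_le ξ (polarNormal K x)
    rw [norm_sub_rev] at e2
    rw [hnp] at e1 e2
    constructor
    · rw [← mul_inv, le_inv_comm₀ hpos (by positivity)]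
      linarith
    · rw [← inv_inv (supportDensity K x), ← div_eq_mul_inv, le_div_iff₀ (by positivity),
        inv_mul_le_iff₀ hξn]
      linarith
  have hQ := supportMeasure_apply (K := K) hBm hBf
  have h5 : supportMeasure K B ≤ s * e * a := by
    rw [hQ]
    calc ∫⁻ x in B, ENNReal.ofReal (supportDensity K x) ∂(μHE[n - 1] : Measure (Euc n))
        ≤ ∫⁻ _ in B, s * e ∂(μHE[n - 1] : Measure (Euc n)) := by
          refine setLIntegral_mono' hBm fun x hx => ?_
          refine (ENNReal.ofReal_le_ofReal (hbound x hx).1).trans_eq ?_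
          rw [ENNReal.ofReal_mul (by positivity)]
          congr 1
          rw [ENNReal.ofReal, ← NNReal.coe_one, ← NNReal.coe_sub hδ.le, ← NNReal.coe_inv,
            Real.toNNReal_coe]
      _ = s * e * a := by rw [setLIntegral_const]
  have h6 : e * a ≤ r * supportMeasure K B := by
    rw [hQ, ← lintegral_const_mul _ hK.measurable_supportDensity.ennreal_ofReal]
    calc e * a = ∫⁻ _ in B, e ∂(μHE[n - 1] : Measure (Euc n)) := by rw [setLIntegral_const]
      _ ≤ _ := by
          refine setLIntegral_mono' hBm fun x hx => ?_
          refine (ENNReal.ofReal_le_ofReal (hbound x hx).2).trans_eq ?_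
          rw [ENNReal.ofReal_mul (by positivity)]
          congr 1
          rw [ENNReal.ofReal, ← NNReal.coe_one, ← NNReal.coe_add, Real.toNNReal_coe]
  have hpow : ∀ q : ℝ≥0∞, q * q ^ (n - 1) = q ^ n := fun q => by
    rw [← pow_succ', Nat.sub_add_cancel hn]
  -- The chain is: support measure, e times the area of B, e times the area of flattened B, n times
  -- the volume of the flattened cone, n times the volume of the cone. One equality is the flat cone
  -- formula; the other passages cost powers of 1 + δ and (1 - δ)⁻¹, n of each in all.
  rw [ENNReal.coe_mul, mul_pow, hcone]
  change supportMeasure K B ≤ r ^ n * s ^ n * (n * volume C₀) ∧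
    n * volume C₀ ≤ r ^ n * s ^ n * supportMeasure K B
  constructor
  · calc supportMeasure K B ≤ s * e * a := h5
      _ ≤ s * e * (s ^ (n - 1) * a') := by gcongr
      _ = (s * s ^ (n - 1)) * (e * a') := by ring
      _ = s ^ n * (n * volume (flatten K ξ '' C₀)) := by rw [hpow, hflat]
      _ ≤ s ^ n * (n * (r ^ n * volume C₀)) := by gcongr
      _ = _ := by ring
  · calc n * volume C₀ ≤ n * (s ^ n * volume (flatten K ξ '' C₀)) := by gcongr
      _ = s ^ n * (n * volume (flatten K ξ '' C₀)) := by ring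
      _ = s ^ n * (e * a') := by rw [hflat]
      _ ≤ s ^ n * (e * (r ^ (n - 1) * a)) := by gcongr
      _ = s ^ n * r ^ (n - 1) * (e * a) := by ring
      _ ≤ s ^ n * r ^ (n - 1) * (r * supportMeasure K B) := by gcongr
      _ = s ^ n * (r * r ^ (n - 1)) * supportMeasure K B := by ring
      _ = _ := by rw [hpow]; ring

/-! ### From small pieces of the boundary to the whole cone measure -/

lemma measure_le_of_cover {X : Type*} [MeasurableSpace X] {μ ν : Measure X} {c : ℝ≥0∞}
    {A : ℕ → Set X} (hA : ∀ i, MeasurableSet (A i)) (hcover : μ (⋃ i, A i)ᶜ = 0)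
    (h : ∀ i, ∀ B ⊆ A i, MeasurableSet B → μ B ≤ c * ν B) {B : Set X} (hB : MeasurableSet B) :
    μ B ≤ c * ν B := by
  have hdm : ∀ i, MeasurableSet (disjointed A i) := fun i => MeasurableSet.disjointed hA i
  have hsplit : ∀ m : Measure X, m (B ∩ ⋃ i, A i) = ∑' i, m (B ∩ disjointed A i) := by
    intro m
    rw [← iUnion_disjointed, inter_iUnion]
    refine measure_iUnion ?_ fun i => hB.inter (hdm i)
    intro i j hij
    exact (disjoint_disjointed A hij).mono inter_subset_right inter_subset_right
  calc μ B ≤ μ (B ∩ ⋃ i, A i) + μ (B \ ⋃ i, A i) := measure_le_inter_add_sdiff _ _ _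
    _ = μ (B ∩ ⋃ i, A i) := by
        rw [measure_mono_null (fun x hx => hx.2 : B \ ⋃ i, A i ⊆ (⋃ i, A i)ᶜ) hcover, add_zero]
    _ = ∑' i, μ (B ∩ disjointed A i) := hsplit μ
    _ ≤ ∑' i, c * ν (B ∩ disjointed A i) := ENNReal.tsum_le_tsum fun i =>
        h i _ (inter_subset_right.trans (disjointed_subset A i)) (hB.inter (hdm i))
    _ = c * ν (B ∩ ⋃ i, A i) := by rw [ENNReal.tsum_mul_left, hsplit ν]
    _ ≤ c * ν B := by gcongr; exact inter_subset_left

lemma supportMeasure_compl_regularPoints (hK : IsBody K) :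
    supportMeasure K (regularPoints K)ᶜ = 0 := by
  rw [supportMeasure, densityMeasure, withDensity_apply _ hK.measurableSet_regularPoints.compl,
    ← lintegral_indicator hK.measurableSet_regularPoints.compl]
  refine (lintegral_congr fun x => ?_).trans lintegral_zero
  by_cases hx : x ∈ regularPoints K
  · rw [indicator_of_notMem (by simpa using hx)]
  · rw [indicator_of_mem (by simpa using hx), supportDensity_eq_zero hx, ENNReal.ofReal_zero]

lemma IsBody.radial_mem_regularPoints (hK : IsBody K) {y : Euc n} (hy : y ≠ 0)
    (hd : DifferentiableAt ℝ (gauge K) y) : radial K y ∈ regularPoints K := by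
  have hf := hK.radial_mem_frontier hy
  refine ⟨hf, hK.existsUnique_normal_of_differentiableAt hf ?_⟩
  set t := gauge K y with ht
  have htpos : 0 < t := hK.gauge_pos_iff.mpr hy
  have heq : gauge K = fun z => t⁻¹ * gauge K (t • z) := by
    funext z
    rw [gauge_smul_nonneg htpos.le, inv_mul_cancel_left₀ htpos.ne']
  rw [heq]
  refine DifferentiableAt.const_mul ?_ _
  have h1 : DifferentiableAt ℝ (gauge K) (t • radial K y) := by
    rw [ht, hK.gauge_smul_radial]; exact hd
  have h2 : DifferentiableAt ℝ (fun z : Euc n => t • z) (radial K y) :=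
    differentiableAt_id.const_smul t
  exact DifferentiableAt.comp (g := gauge K) (f := fun z : Euc n => t • z) (radial K y) h1 h2

/-- Rademacher's theorem: the gauge is Lipschitz, so it is differentiable almost everywhere, and by
homogeneity also at the radial projections. -/
lemma coneMeasure_compl_regularPoints (hK : IsBody K) (hn : 0 < n) :
    coneMeasure K (regularPoints K)ᶜ = 0 := by
  rw [hK.coneMeasure_apply hK.measurableSet_regularPoints.compl]
  obtain ⟨C, hC⟩ := hK.exists_lipschitz
  have hae := hC.ae_differentiableAt (μ := volume)
  have : Nonempty (Fin n) := ⟨⟨0, hn⟩⟩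
  have h0 : ∀ᵐ y : Euc n, y ≠ 0 := by
    rw [ae_iff]
    simp
  have : volume (radial K ⁻¹' (regularPoints K)ᶜ ∩ K) = 0 := by
    refine measure_mono_null inter_subset_left ?_
    have : ∀ᵐ y : Euc n, radial K y ∈ regularPoints K := by
      filter_upwards [hae, h0] with y h1 h2
      exact hK.radial_mem_regularPoints h2 h1
    exact this
  rw [this, mul_zero]

/-- The measure `⟨x, N⟩ μ_K` is the cone measure. -/
theorem IsBody.supportMeasure_eq_coneMeasure (hK : IsBody K) (hn : 0 < n) :
    supportMeasure K = coneMeasure K := by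
  have hcomp : ∀ δ : NNReal, 0 < δ → δ < 1 → ∀ B, MeasurableSet B →
      supportMeasure K B ≤ (((1 + δ) * (1 - δ)⁻¹ : NNReal) : ℝ≥0∞) ^ n * coneMeasure K B ∧
      coneMeasure K B ≤ (((1 + δ) * (1 - δ)⁻¹ : NNReal) : ℝ≥0∞) ^ n * supportMeasure K B := by
    intro δ hδ0 hδ B hB
    -- Countably many pieces on which `polarNormal` has relative oscillation below δ. They cover the
    -- regular points since `polarNormal` is not 0 there.
    let ξ : ℕ → Euc n := TopologicalSpace.denseSeq (Euc n)
    let A : ℕ → Set (Euc n) := fun i =>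
      regularPoints K ∩ {x | ‖polarNormal K x - ξ i‖ < δ * ‖ξ i‖}
    have hA : ∀ i, MeasurableSet (A i) := fun i => hK.measurableSet_regularPoints.inter
      (measurableSet_lt (hK.measurable_polarNormal.sub measurable_const).norm measurable_const)
    have hcov : regularPoints K ⊆ ⋃ i, A i := by
      intro x hx
      have hp : 0 < ‖polarNormal K x‖ := by
        rw [hK.norm_polarNormal hx]
        exact inv_pos.mpr (hK.inner_pos (isOuterUnitNormal_regularNormal hx))
      have hδr : (0 : ℝ) < δ := hδ0
      have hδr1 : (δ : ℝ) < 1 := by exact_mod_cast hδ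
      obtain ⟨i, hi⟩ := (TopologicalSpace.denseRange_denseSeq (Euc n)).exists_dist_lt
        (polarNormal K x) (show 0 < δ * ‖polarNormal K x‖ / 2 by positivity)
      rw [dist_eq_norm] at hi
      refine mem_iUnion.mpr ⟨i, hx, ?_⟩
      change ‖polarNormal K x - ξ i‖ < δ * ‖ξ i‖
      have h1 := norm_sub_norm_le (polarNormal K x) (ξ i)
      have h2 : ‖polarNormal K x - ξ i‖ < δ * ‖polarNormal K x‖ / 2 := hi
      have h3 : ‖polarNormal K x‖ / 2 ≤ ‖ξ i‖ := by nlinarith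
      nlinarith
    have hpiece : ∀ i, ∀ B ⊆ A i, MeasurableSet B →
        supportMeasure K B ≤ (((1 + δ) * (1 - δ)⁻¹ : NNReal) : ℝ≥0∞) ^ n * coneMeasure K B ∧
        coneMeasure K B ≤ (((1 + δ) * (1 - δ)⁻¹ : NNReal) : ℝ≥0∞) ^ n * supportMeasure K B := by
      intro i B hBA hBm
      by_cases hξ : ξ i = 0
      · have : B = ∅ := by
          rw [eq_empty_iff_forall_notMem]
          intro x hx
          have h1 : ‖polarNormal K x - ξ i‖ < δ * ‖ξ i‖ := (hBA hx).2
          rw [hξ, norm_zero, mul_zero] at h1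
          exact absurd h1 (not_lt.mpr (norm_nonneg _))
        simp [this]
      · exact hK.measures_comparable hn hξ hδ hBm (fun x hx => (hBA hx).1)
          fun x hx => (hBA hx).2.le
    exact ⟨measure_le_of_cover hA
        (measure_mono_null (compl_subset_compl.mpr hcov) (supportMeasure_compl_regularPoints hK))
        (fun i B h1 h2 => (hpiece i B h1 h2).1) hB,
      measure_le_of_cover hA
        (measure_mono_null (compl_subset_compl.mpr hcov) (coneMeasure_compl_regularPoints hK hn))
        (fun i B h1 h2 => (hpiece i B h1 h2).2) hB⟩
  -- The comparison constant tends to 1 as the pieces are refined.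
  have hlim : Tendsto (fun δ : NNReal => (((1 + δ) * (1 - δ)⁻¹ : NNReal) : ℝ≥0∞) ^ n) (𝓝[>] 0)
      (𝓝 1) := by
    have h1 : Tendsto (fun δ : NNReal => ((1 + δ) * (1 - δ)⁻¹) ^ n) (𝓝 0)
        (𝓝 (((1 + 0) * (1 - 0)⁻¹) ^ n)) := by
      refine Tendsto.pow (Tendsto.mul (tendsto_const_nhds.add tendsto_id) ?_) n
      refine Tendsto.inv₀ (tendsto_const_nhds.sub tendsto_id) (by simp)
    have h2 := (ENNReal.tendsto_coe.mpr h1).mono_left (nhdsWithin_le_nhds (s := Ioi 0))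
    simpa using h2
  have hev : ∀ᶠ δ : NNReal in 𝓝[>] 0, 0 < δ ∧ δ < 1 := Ioo_mem_nhdsGT one_pos
  have hpass : ∀ {a b : ℝ≥0∞}, (∀ δ : NNReal, 0 < δ → δ < 1 →
      a ≤ (((1 + δ) * (1 - δ)⁻¹ : NNReal) : ℝ≥0∞) ^ n * b) → a ≤ b := by
    intro a b h
    have h1 := ENNReal.Tendsto.mul_const hlim (b := b) (Or.inl one_ne_zero)
    rw [one_mul] at h1
    exact ge_of_tendsto h1 (hev.mono fun δ hδ => h δ hδ.1 hδ.2)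
  refine Measure.ext fun B hB => le_antisymm ?_ ?_
  · exact hpass fun δ h0 h1 => (hcomp δ h0 h1 B hB).1
  · exact hpass fun δ h0 h1 => (hcomp δ h0 h1 B hB).2

end Cone

end BodyDivergence

end

noncomputable section

namespace BodyDivergence

section Homogeneity

variable {n : ℕ} {K L : Set (Euc n)} {x : Euc n}

/-! ### Homogeneity of the energy -/

lemma energy_smul {t : ℝ} (ht : 0 ≤ t) (y : Euc n) : energy K (t • y) = t ^ 2 * energy K y := by
  rw [energy, energy, gauge_smul_nonneg ht]
  ring

/-- The energy is 2-homogeneous, so its second derivative is 0-homogeneous: the factors t^(-2n) and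
t^(2n) cancel. -/
lemma hessDet_energy_smul {t : ℝ} (ht : 0 < t) (y : Euc n) :
    hessDet (energy K) (t • y) = hessDet (energy K) y := by
  have h := hessDet_comp_linearEquiv (F := energy K)
    (LinearEquiv.smulOfNeZero ℝ (Euc n) t ht.ne').toContinuousLinearEquiv
    (c := (t ^ 2)⁻¹) (by positivity) y
  have h1 : (fun z => (t ^ 2)⁻¹ * energy K
      ((LinearEquiv.smulOfNeZero ℝ (Euc n) t ht.ne').toContinuousLinearEquiv z)) = energy K := by
    funext z
    change (t ^ 2)⁻¹ * energy K (t • z) = _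
    rw [energy_smul ht.le, inv_mul_cancel_left₀ (by positivity)]
  have h2 : (((LinearEquiv.smulOfNeZero ℝ (Euc n) t ht.ne').toContinuousLinearEquiv :
      Euc n →L[ℝ] Euc n)).det = t ^ n := by
    have h3 : ((LinearEquiv.smulOfNeZero ℝ (Euc n) t ht.ne' : Euc n ≃ₗ[ℝ] Euc n) :
        Euc n →ₗ[ℝ] Euc n) = t • LinearMap.id := by
      ext z; rfl
    have h4 : LinearMap.det ((LinearEquiv.smulOfNeZero ℝ (Euc n) t ht.ne' : Euc n ≃ₗ[ℝ] Euc n) :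
        Euc n →ₗ[ℝ] Euc n) = t ^ n := by
      rw [h3, LinearMap.det_smul, LinearMap.det_id, mul_one, finrank_euclideanSpace_fin]
    exact h4
  rw [h1, h2, finrank_euclideanSpace_fin] at h
  rw [h]
  change _ = (t ^ 2)⁻¹ ^ n * (t ^ n) ^ 2 * hessDet (energy K) (t • y)
  rw [← pow_mul, inv_pow, ← pow_mul, mul_comm n 2, inv_mul_cancel₀ (by positivity), one_mul]

lemma IsBody.exists_lipschitzOnWith_energy (hK : IsBody K) (r : ℝ) :
    ∃ c, LipschitzOnWith c (energy K) (Metric.ball 0 r) := by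
  obtain ⟨C, hC⟩ := hK.exists_lipschitz
  have hb : ∀ y ∈ Metric.ball (0 : Euc n) r, gauge K y ≤ C * |r| := by
    intro y hy
    have h := hC.dist_le_mul y 0
    rw [gauge_zero, Real.dist_eq, sub_zero, abs_of_nonneg (gauge_nonneg y)] at h
    refine h.trans (mul_le_mul_of_nonneg_left ?_ C.2)
    exact (Metric.mem_ball.mp hy).le.trans (le_abs_self r)
  refine ⟨C * (C * Real.toNNReal |r|), LipschitzOnWith.of_dist_le_mul fun y hy z hz => ?_⟩
  have h := hC.dist_le_mul y z
  rw [Real.dist_eq] at h ⊢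
  have h1 : energy K y - energy K z
      = (gauge K y - gauge K z) * ((gauge K y + gauge K z) / 2) := by
    rw [energy, energy]; ring
  have h2 : 0 ≤ (gauge K y + gauge K z) / 2 :=
    div_nonneg (add_nonneg (gauge_nonneg y) (gauge_nonneg z)) zero_le_two
  rw [h1, abs_mul, abs_of_nonneg h2]
  have h3 : (gauge K y + gauge K z) / 2 ≤ C * |r| := by linarith [hb y hy, hb z hz]
  calc |gauge K y - gauge K z| * ((gauge K y + gauge K z) / 2)
      ≤ (C * dist y z) * (C * |r|) := mul_le_mul h h3 h2 (by positivity)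
    _ = _ := by
      rw [NNReal.coe_mul, NNReal.coe_mul, Real.coe_toNNReal _ (abs_nonneg r)]
      ring

lemma ae_ne_zero (hn : 0 < n) : ∀ᵐ y : Euc n, y ≠ 0 := by
  have : Nonempty (Fin n) := ⟨⟨0, hn⟩⟩
  rw [ae_iff]
  simp

/-- By 0-homogeneity the determinant at the radial projection equals that at the point itself, which
leaves a volume integral over K. -/
theorem IsBody.lintegral_hessDet_coneMeasure_ne_top (hK : IsBody K) (hn : 0 < n) :
    ∫⁻ x, ENNReal.ofReal (hessDet (energy K) x) ∂(coneMeasure K) ≠ ∞ := by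
  rw [coneMeasure, lintegral_smul_measure, smul_eq_mul]
  -- For an integrand not known to be measurable the image measure gives only an inequality, in the
  -- direction needed.
  refine ENNReal.mul_ne_top (by simp) (ne_top_of_le_ne_top ?_ (lintegral_map_le _ _))
  have hcongr : ∫⁻ y in K, ENNReal.ofReal (hessDet (energy K) (radial K y))
      = ∫⁻ y in K, ENNReal.ofReal (hessDet (energy K) y) := by
    refine lintegral_congr_ae (ae_restrict_of_ae ?_)
    filter_upwards [ae_ne_zero hn] with y hy
    rw [radial, hessDet_energy_smul (inv_pos.mpr (hK.gauge_pos_iff.mpr hy))]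
  rw [hcongr]
  obtain ⟨r, hr⟩ := hK.isCompact.isBounded.subset_ball 0
  obtain ⟨c, hc⟩ := hK.exists_lipschitzOnWith_energy r
  exact ((lintegral_mono_set hr).trans_lt
    (lintegral_hessDet_lt_top hK.convexOn_energy Metric.isOpen_ball hc)).ne

end Homogeneity

/-! ### Conic sets and the cone measure -/

section Conic

variable {n : ℕ} {K L : Set (Euc n)} {x : Euc n}

lemma IsBody.radial_mem_iff (hK : IsBody K) {S : Set (Euc n)}
    (hS : ∀ t : ℝ, 0 < t → ∀ y ∈ S, t • y ∈ S) (y : Euc n) : radial K y ∈ S ↔ y ∈ S := by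
  rcases eq_or_ne y 0 with rfl | hy
  · simp [radial]
  · have hg := hK.gauge_pos_iff.mpr hy
    refine ⟨fun h => ?_, fun h => hS _ (inv_pos.mpr hg) _ h⟩
    have := hS _ hg _ h
    rwa [hK.gauge_smul_radial] at this

/-- The cone measure of a conic set is governed by its volume. A measurable null superset N of the
exceptional set need not be conic, so it is replaced by the set M of all y with ty in N for almost
every t > 0: measurable, conic, still a superset, and null by Fubini. -/
theorem IsBody.ae_coneMeasure_of_conic (hK : IsBody K) {P : Euc n → Prop}
    (hP : ∀ t : ℝ, 0 < t → ∀ y, P y → P (t • y)) (h : ∀ᵐ y, P y) :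
    ∀ᵐ y ∂(coneMeasure K), P y := by
  obtain ⟨N, hDN, hNm, hN0⟩ := exists_measurable_superset_of_null (ae_iff.mp h)
  set M : Set (Euc n) := {y | ∀ᵐ t : ℝ, 0 < t → t • y ∈ N} with hM
  have hm : MeasurableSet {z : Euc n × ℝ | ¬ (0 < z.2 → z.2 • z.1 ∈ N)} := by
    have h1 : MeasurableSet {z : Euc n × ℝ | 0 < z.2} :=
      measurableSet_lt measurable_const measurable_snd
    have h2 : MeasurableSet {z : Euc n × ℝ | z.2 • z.1 ∈ N} :=
      (measurable_snd.smul measurable_fst) hNm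
    have : {z : Euc n × ℝ | ¬ (0 < z.2 → z.2 • z.1 ∈ N)}
        = {z | 0 < z.2} \ {z | z.2 • z.1 ∈ N} := by
      ext z; simp
    rw [this]; exact h1.diff h2
  have hMm : MeasurableSet M := by
    have := measurable_measure_prodMk_left (ν := (volume : Measure ℝ)) hm
    exact this (measurableSet_singleton 0)
  have hDM : {y | ¬ P y} ⊆ M := by
    intro y hy
    change ∀ᵐ t : ℝ, 0 < t → t • y ∈ N
    refine Eventually.of_forall fun t ht => hDN fun hty => hy ?_
    have := hP t⁻¹ (inv_pos.mpr ht) _ hty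
    rwa [inv_smul_smul₀ ht.ne'] at this
  have hMS : ∀ s : ℝ, 0 < s → ∀ y ∈ M, s • y ∈ M := by
    intro s hs y hy
    have h1 : volume {t : ℝ | ¬ (0 < t → t • y ∈ N)} = 0 := hy
    have h2 := Measure.addHaar_preimage_smul (volume : Measure ℝ) hs.ne'
      {t : ℝ | ¬ (0 < t → t • y ∈ N)}
    rw [h1, mul_zero] at h2
    refine measure_mono_null (fun t ht => ?_) h2
    intro hts
    refine ht fun ht0 => ?_
    have h3 : (s * t) • y ∈ N := hts (mul_pos hs ht0)
    rwa [mul_comm, ← smul_smul] at h3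
  have hM0 : volume M = 0 := by
    have h1 : ∀ t : ℝ, 0 < t → ∀ᵐ y : Euc n, t • y ∉ N := by
      intro t ht
      have := Measure.addHaar_preimage_smul (volume : Measure (Euc n)) ht.ne' N
      rw [hN0, mul_zero] at this
      have h3 : ∀ᵐ y : Euc n, y ∉ (fun x => t • x) ⁻¹' N := measure_eq_zero_iff_ae_notMem.mp this
      exact h3
    have h2 : ∀ᵐ t : ℝ, ∀ᵐ y : Euc n, 0 < t → t • y ∉ N := by
      refine Eventually.of_forall fun t => ?_
      by_cases ht : 0 < t
      · filter_upwards [h1 t ht] with y hy _ using hy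
      · exact Eventually.of_forall fun y h => absurd h ht
    have hm2 : MeasurableSet {z : ℝ × Euc n | 0 < z.1 → z.1 • z.2 ∉ N} := by
      have h1 : MeasurableSet {z : ℝ × Euc n | 0 < z.1} :=
        measurableSet_lt measurable_const measurable_fst
      have h2 : MeasurableSet {z : ℝ × Euc n | z.1 • z.2 ∈ N} :=
        (measurable_fst.smul measurable_snd) hNm
      have : {z : ℝ × Euc n | 0 < z.1 → z.1 • z.2 ∉ N}
          = ({z | 0 < z.1} ∩ {z | z.1 • z.2 ∈ N})ᶜ := by
        ext z; simp
      rw [this]; exact (h1.inter h2).compl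
    rw [Measure.ae_ae_comm hm2] at h2
    have h3 : ∀ᵐ y : Euc n, y ∉ M := by
      filter_upwards [h2] with y hy hyM
      have h4 : ∀ᵐ t : ℝ, ¬ 0 < t := by
        filter_upwards [hy, hyM] with t a b c using a c (b c)
      rw [ae_iff] at h4
      have : {t : ℝ | ¬ ¬ 0 < t} = Ioi 0 := by ext; simp
      rw [this, Real.volume_Ioi] at h4
      exact ENNReal.top_ne_zero h4
    rw [ae_iff] at h3
    simpa using h3
  rw [ae_iff]
  refine measure_mono_null hDM ?_
  rw [hK.coneMeasure_apply hMm]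
  have : radial K ⁻¹' M ∩ K ⊆ M := fun y hy => (hK.radial_mem_iff hMS y).mp hy.1
  rw [measure_mono_null this hM0, mul_zero]

lemma IsBody.coneMeasure_restrict_congr (hK : IsBody K) (hL : IsBody L) {S : Set (Euc n)}
    (hSm : MeasurableSet S) (hS : ∀ t : ℝ, 0 < t → ∀ y ∈ S, t • y ∈ S)
    (hKL : ∀ y ∈ S, gauge K y = gauge L y) :
    (coneMeasure K).restrict S = (coneMeasure L).restrict S := by
  ext B hB
  rw [Measure.restrict_apply hB, Measure.restrict_apply hB, hK.coneMeasure_apply (hB.inter hSm),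
    hL.coneMeasure_apply (hB.inter hSm)]
  congr 2
  ext y
  simp only [mem_inter_iff, mem_preimage, hK.radial_mem_iff hS, hL.radial_mem_iff hS,
    ← hK.gauge_le_one_iff, ← hL.gauge_le_one_iff]
  by_cases hy : y ∈ S
  · rw [radial, radial, hKL y hy]
  · simp [hy]

/-- Locality. The cone measures agree on S, and almost every point of S is a density point of S,
where the Hessian determinants agree. As S and the determinants are invariant under dilation, this
carries over to the cone measure. -/
theorem IsBody.ratioDivergence_restrict_congr (hK : IsBody K) (hL : IsBody L) (f : ℝ → ℝ)
    {S : Set (Euc n)} (hSm : MeasurableSet S) (hS : ∀ t : ℝ, 0 < t → ∀ y ∈ S, t • y ∈ S)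
    (hKL : ∀ y ∈ S, gauge K y = gauge L y) :
    ratioDivergence f ((coneMeasure K).restrict S) (hessDet (energy K))
      = ratioDivergence f ((coneMeasure L).restrict S) (hessDet (energy L)) := by
  rw [hK.coneMeasure_restrict_congr hL hSm hS hKL]
  refine ratioDivergence_congr_ae f ((ae_restrict_iff' hSm).mpr ?_)
  refine hL.ae_coneMeasure_of_conic (fun t ht y hy hty => ?_) ?_
  · rw [hessDet_energy_smul ht, hessDet_energy_smul ht]
    refine hy ?_
    have := hS t⁻¹ (inv_pos.mpr ht) _ hty
    rwa [inv_smul_smul₀ ht.ne'] at this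
  · filter_upwards [ae_isDensityPoint hSm] with y hy hyS
    refine hessDet_eq_of_isDensityPoint hK.convexOn_energy hL.convexOn_energy (fun z hz => ?_)
      (hy hyS)
    rw [energy, energy, hKL z hz]

/-- All four divergences are split along S. The ties g_K = g_L belong to the complement, where g_L ≤
g_K is all that is used. -/
theorem ratioDivergence_union_add_inter (hK : IsBody K) (hL : IsBody L) (hKL : IsBody (K ∪ L))
    (hn : 0 < n) {f : ℝ → ℝ} (hf : ConvexOn ℝ (Ioi (0 : ℝ)) f) :
    ratioDivergence f (coneMeasure (K ∪ L)) (hessDet (energy (K ∪ L)))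
        + ratioDivergence f (coneMeasure (K ∩ L)) (hessDet (energy (K ∩ L)))
      = ratioDivergence f (coneMeasure K) (hessDet (energy K))
        + ratioDivergence f (coneMeasure L) (hessDet (energy L)) := by
  set S : Set (Euc n) := {y | gauge K y < gauge L y} with hSdef
  have hSm : MeasurableSet S :=
    measurableSet_lt hK.continuous_gauge.measurable hL.continuous_gauge.measurable
  have hS : ∀ t : ℝ, 0 < t → ∀ y, t • y ∈ S ↔ y ∈ S := by
    intro t ht y
    change gauge K (t • y) < gauge L (t • y) ↔ gauge K y < gauge L y
    rw [gauge_smul_nonneg ht.le, gauge_smul_nonneg ht.le, mul_lt_mul_iff_right₀ ht]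
  have hS1 : ∀ t : ℝ, 0 < t → ∀ y ∈ S, t • y ∈ S := fun t ht y hy => (hS t ht y).mpr hy
  have hS2 : ∀ t : ℝ, 0 < t → ∀ y ∈ Sᶜ, t • y ∈ Sᶜ := fun t ht y hy h => hy ((hS t ht y).mp h)
  have hSc : ∀ y ∈ Sᶜ, gauge L y ≤ gauge K y := fun y hy => by
    by_contra! h
    exact hy h
  have hsplit : ∀ M : Set (Euc n), IsBody M →
      ratioDivergence f (coneMeasure M) (hessDet (energy M))
        = ratioDivergence f ((coneMeasure M).restrict S) (hessDet (energy M))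
          + ratioDivergence f ((coneMeasure M).restrict Sᶜ) (hessDet (energy M)) := by
    intro M hM
    have := hM.isFiniteMeasure_coneMeasure
    exact ratioDivergence_restrict_add_compl
      (lintegral_neg_part_ne_top hf (fun x => hessDet_nonneg hM.convexOn_energy x)
        (hM.lintegral_hessDet_coneMeasure_ne_top hn)) hSm
  have hI := hK.inter hL
  rw [hsplit _ hKL, hsplit _ hI, hsplit _ hK, hsplit _ hL,
    hKL.ratioDivergence_restrict_congr hK f hSm hS1 fun y hy => by
      rw [gauge_union hK hL hKL, min_eq_left (le_of_lt hy)],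
    hKL.ratioDivergence_restrict_congr hL f hSm.compl hS2 fun y hy => by
      rw [gauge_union hK hL hKL, min_eq_right (hSc y hy)],
    hI.ratioDivergence_restrict_congr hL f hSm hS1 fun y hy => by
      rw [gauge_inter hK hL, max_eq_right (le_of_lt hy)],
    hI.ratioDivergence_restrict_congr hK f hSm.compl hS2 fun y hy => by
      rw [gauge_inter hK hL, max_eq_left (hSc y hy)],
    add_comm (ratioDivergence f ((coneMeasure L).restrict S) _), add_add_add_comm,
    add_comm (ratioDivergence f ((coneMeasure L).restrict Sᶜ) _)]

end Conic

/-! ### Behaviour under linear maps -/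

section Linear

variable {n : ℕ} {K L : Set (Euc n)} {x : Euc n}

lemma radial_image (hK : IsBody K) (T : Euc n ≃ₗ[ℝ] Euc n) (y : Euc n) :
    radial (T '' K) (T y) = T (radial K y) := by
  rw [radial, radial, gauge_image hK, map_smul]

lemma linearEquiv_det_ne_zero (T : Euc n ≃ₗ[ℝ] Euc n) :
    LinearMap.det (T : Euc n →ₗ[ℝ] Euc n) ≠ 0 := T.isUnit_det'.ne_zero

lemma coneMeasure_image (hK : IsBody K) (T : Euc n ≃ₗ[ℝ] Euc n) :
    coneMeasure (T '' K) = ENNReal.ofReal |LinearMap.det (T : Euc n →ₗ[ℝ] Euc n)| •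
      (coneMeasure K).map T.toContinuousLinearEquiv.toHomeomorph.toMeasurableEquiv := by
  ext B hB
  have hTm : Measurable (T : Euc n → Euc n) := T.toContinuousLinearEquiv.continuous.measurable
  rw [(hK.image T).coneMeasure_apply hB, Measure.smul_apply, smul_eq_mul,
    Measure.map_apply (MeasurableEquiv.measurable _) hB]
  change _ = _ * coneMeasure K (T ⁻¹' B)
  rw [hK.coneMeasure_apply (hTm hB)]
  have h := Measure.addHaar_image_linearMap (volume : Measure (Euc n)) (T : Euc n →ₗ[ℝ] Euc n)
    (radial K ⁻¹' (T ⁻¹' B) ∩ K)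
  have heq : (T : Euc n →ₗ[ℝ] Euc n) '' (radial K ⁻¹' (T ⁻¹' B) ∩ K)
      = radial (T '' K) ⁻¹' B ∩ T '' K := by
    ext z
    constructor
    · rintro ⟨y, ⟨h1, h2⟩, rfl⟩
      refine ⟨?_, y, h2, rfl⟩
      change radial (T '' K) (T y) ∈ B
      rw [radial_image hK]; exact h1
    · rintro ⟨h1, y, h2, rfl⟩
      refine ⟨y, ⟨?_, h2⟩, rfl⟩
      change T (radial K y) ∈ B
      rw [← radial_image hK]; exact h1
  rw [heq] at h
  rw [h]
  ring

lemma hessDet_energy_image (hK : IsBody K) (T : Euc n ≃ₗ[ℝ] Euc n) (x : Euc n) :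
    hessDet (energy (T '' K)) (T x)
      = (LinearMap.det (T : Euc n →ₗ[ℝ] Euc n) ^ 2)⁻¹ * hessDet (energy K) x := by
  have h := hessDet_comp_linearEquiv (F := energy (T '' K)) T.toContinuousLinearEquiv
    (c := 1) one_ne_zero x
  have h1 : (fun z => 1 * energy (T '' K) (T.toContinuousLinearEquiv z)) = energy K := by
    funext z
    change 1 * energy (T '' K) (T z) = _
    rw [one_mul, energy, energy, gauge_image hK]
  rw [h1, one_pow, one_mul] at h
  have h2 : hessDet (energy K) x
      = LinearMap.det (T : Euc n →ₗ[ℝ] Euc n) ^ 2 * hessDet (energy (T '' K)) (T x) := h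
  rw [h2, inv_mul_cancel_left₀ (pow_ne_zero 2 (linearEquiv_det_ne_zero T))]

lemma vol_image (K : Set (Euc n)) (T : Euc n ≃ₗ[ℝ] Euc n) :
    vol (T '' K) = |LinearMap.det (T : Euc n →ₗ[ℝ] Euc n)| * vol K := by
  have h := Measure.addHaar_image_linearMap (volume : Measure (Euc n)) (T : Euc n →ₗ[ℝ] Euc n) K
  rw [vol, vol]
  change (volume ((T : Euc n →ₗ[ℝ] Euc n) '' K)).toReal = _
  rw [h, ENNReal.toReal_mul, ENNReal.toReal_ofReal (abs_nonneg _)]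

lemma vol_polarBody_image (K : Set (Euc n)) (T : Euc n ≃ₗ[ℝ] Euc n) :
    vol (polarBody (T '' K))
      = |LinearMap.det (T : Euc n →ₗ[ℝ] Euc n)|⁻¹ * vol (polarBody K) := by
  let A : Euc n →L[ℝ] Euc n :=
    ContinuousLinearMap.adjoint (T.toContinuousLinearEquiv : Euc n →L[ℝ] Euc n)
  have hdet : LinearMap.det (A : Euc n →ₗ[ℝ] Euc n) = LinearMap.det (T : Euc n →ₗ[ℝ] Euc n) :=
    det_adjoint (T.toContinuousLinearEquiv : Euc n →L[ℝ] Euc n)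
  have heq : polarBody (T '' K) = (A : Euc n →ₗ[ℝ] Euc n) ⁻¹' polarBody K := by
    ext y
    constructor
    · intro h x hx
      have := h (T x) ⟨x, hx, rfl⟩
      change inner ℝ x (A y) ≤ 1
      rw [ContinuousLinearMap.adjoint_inner_right]
      exact this
    · rintro h _ ⟨x, hx, rfl⟩
      have := h x hx
      change inner ℝ x (A y) ≤ 1 at this
      rw [ContinuousLinearMap.adjoint_inner_right] at this
      exact this
  have hA : LinearMap.det (A : Euc n →ₗ[ℝ] Euc n) ≠ 0 := hdet ▸ linearEquiv_det_ne_zero T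
  rw [vol, heq, Measure.addHaar_preimage_linearMap _ hA, hdet, ENNReal.toReal_mul, ENNReal.toReal_ofReal (abs_nonneg _), abs_inv, vol]

/-- The constants record the normalization: they must absorb |det T| from the measure and (det T)⁻²
from the ratio. -/
theorem ratioDivergence_image (hK : IsBody K) (T : Euc n ≃ₗ[ℝ] Euc n) (f : ℝ → ℝ) {a a' : ℝ≥0∞}
    {c c' : ℝ} (ha : a' * ENNReal.ofReal |LinearMap.det (T : Euc n →ₗ[ℝ] Euc n)| = a)
    (hc : c' * (LinearMap.det (T : Euc n →ₗ[ℝ] Euc n) ^ 2)⁻¹ = c) :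
    ratioDivergence f (a' • coneMeasure (T '' K)) (fun x => c' * hessDet (energy (T '' K)) x)
      = ratioDivergence f (a • coneMeasure K) (fun x => c * hessDet (energy K) x) := by
  rw [coneMeasure_image hK, smul_smul, ha, ← Measure.map_smul, ratioDivergence_map_equiv]
  congr 1
  funext x
  change c' * hessDet (energy (T '' K)) (T x) = _
  rw [hessDet_energy_image hK, ← mul_assoc, hc]

end Linear

end BodyDivergence

end

noncomputable section

namespace BodyDivergence

/-! ### The divergences of a body in terms of its cone measure -/

section Reduction

variable {n : ℕ} {K : Set (Euc n)} {x : Euc n}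

lemma densQtilde_eq (hx : x ∈ frontier K) : densQtilde K x = supportDensity K x := by
  by_cases h : ∃! u, IsOuterUnitNormal K x u
  · rw [supportDensity, regularNormal_eq ⟨hx, h⟩, densQtilde]
  · rw [supportDensity_eq_zero fun hr => h hr.2, densQtilde, outerNormal_eq_zero h,
      inner_zero_right]

lemma IsBody.densPtilde_eq (hK : IsBody K) (hn : 0 < n) (hx : x ∈ frontier K) :
    densPtilde K x = hessDet (energy K) x * supportDensity K x := by
  rw [← hK.gaussCurvature_div hx, ← densQtilde_eq hx, densQtilde, densPtilde]
  -- At points without a unique normal the inner product is the default 0. Since n > 0, its n-th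
  -- power is 0 as well, and division by it gives 0 on the left.
  rcases eq_or_ne (inner ℝ x (outerNormal K x) : ℝ) 0 with h | h
  · rw [h, mul_zero, zero_pow hn.ne', div_zero]
  · rw [pow_succ]
    field_simp

lemma ae_mem_frontier (K : Set (Euc n)) : ∀ᵐ x ∂(surfaceMeasure K), x ∈ frontier K :=
  ae_restrict_mem isClosed_frontier.measurableSet

lemma IsBody.densityMeasure_const_mul (hK : IsBody K) (hn : 0 < n) {a : ℝ} (ha : 0 ≤ a) :
    densityMeasure (surfaceMeasure K) (fun x => a * supportDensity K x)
      = ENNReal.ofReal a • coneMeasure K := by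
  rw [← hK.supportMeasure_eq_coneMeasure hn, supportMeasure, densityMeasure, densityMeasure,
    ← withDensity_smul _ hK.measurable_supportDensity.ennreal_ofReal]
  congr 1
  funext x
  exact ENNReal.ofReal_mul ha

lemma IsBody.fDivergence_left (hK : IsBody K) (hn : 0 < n) (f : ℝ → ℝ) {p q : Euc n → ℝ} {a c : ℝ}
    (ha : 0 ≤ a) (hq : ∀ x ∈ frontier K, q x = a * supportDensity K x)
    (hp : ∀ x ∈ frontier K, p x = (c * hessDet (energy K) x) * (a * supportDensity K x)) :
    fDivergence f (surfaceMeasure K) p q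
      = ratioDivergence f (ENNReal.ofReal a • coneMeasure K)
        (fun x => c * hessDet (energy K) x) := by
  have := hK.isFiniteMeasure_surfaceMeasure
  rw [← hK.densityMeasure_const_mul hn ha,
    ← fDivergence_mul_left f (hK.measurable_supportDensity.const_mul a)
      fun x => mul_nonneg ha (hK.supportDensity_nonneg x)]
  exact fDivergence_congr_ae f ((ae_mem_frontier K).mono hp)
    ((ae_mem_frontier K).mono hq)

lemma IsBody.fDivergence_right (hK : IsBody K) (hn : 0 < n) (f : ℝ → ℝ) {p q : Euc n → ℝ}
    {a c : ℝ} (ha : 0 ≤ a) (hq : ∀ x ∈ frontier K, q x = a * supportDensity K x)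
    (hp : ∀ x ∈ frontier K, p x = (c * hessDet (energy K) x) * (a * supportDensity K x)) :
    fDivergence f (surfaceMeasure K) q p
      = ratioDivergence (adjointFun f) (ENNReal.ofReal a • coneMeasure K)
        (fun x => c * hessDet (energy K) x) := by
  have := hK.isFiniteMeasure_surfaceMeasure
  rw [← hK.densityMeasure_const_mul hn ha,
    ← fDivergence_mul_right f (hK.measurable_supportDensity.const_mul a)
      fun x => mul_nonneg ha (hK.supportDensity_nonneg x)]
  exact fDivergence_congr_ae f ((ae_mem_frontier K).mono hq)
    ((ae_mem_frontier K).mono hp)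

lemma IsBody.vol_pos (hK : IsBody K) : 0 < vol K :=
  ENNReal.toReal_pos
    (Measure.measure_pos_of_mem_nhds volume (mem_interior_iff_mem_nhds.mp hK.zero_mem_interior)).ne'
    hK.isCompact.measure_lt_top.ne

lemma vol_nonneg (K : Set (Euc n)) : 0 ≤ vol K := ENNReal.toReal_nonneg

lemma densQ_eq (hx : x ∈ frontier K) :
    densQ K x = (n * vol K)⁻¹ * supportDensity K x := by
  rw [← densQtilde_eq hx, densQ, densQtilde, div_eq_inv_mul]

/-- The normalized ratio is |K| / |K°| times the Hessian determinant. Positivity of |K°| is not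
needed: if it were 0, both sides would be 0. -/
lemma IsBody.densP_eq (hK : IsBody K) (hn : 0 < n) (hx : x ∈ frontier K) :
    densP K x = (vol K / vol (polarBody K) * hessDet (energy K) x)
      * ((n * vol K)⁻¹ * supportDensity K x) := by
  have h := hK.densPtilde_eq hn hx
  rw [densPtilde] at h
  rw [densP, ← div_div, h, div_eq_mul_inv, div_eq_mul_inv, mul_inv, mul_inv]
  have hV := hK.vol_pos.ne'
  field_simp

lemma IsBody.divPQ_eq (hK : IsBody K) (hn : 0 < n) (f : ℝ → ℝ) :
    divPQ f K = ratioDivergence f (ENNReal.ofReal (n * vol K)⁻¹ • coneMeasure K)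
      (fun x => vol K / vol (polarBody K) * hessDet (energy K) x) :=
  hK.fDivergence_left hn f (inv_nonneg.mpr (mul_nonneg n.cast_nonneg (vol_nonneg K)))
    (fun _ hx => densQ_eq hx) fun _ hx => hK.densP_eq hn hx

lemma IsBody.divQP_eq (hK : IsBody K) (hn : 0 < n) (f : ℝ → ℝ) :
    divQP f K = ratioDivergence (adjointFun f) (ENNReal.ofReal (n * vol K)⁻¹ • coneMeasure K)
      (fun x => vol K / vol (polarBody K) * hessDet (energy K) x) :=
  hK.fDivergence_right hn f (inv_nonneg.mpr (mul_nonneg n.cast_nonneg (vol_nonneg K)))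
    (fun _ hx => densQ_eq hx) fun _ hx => hK.densP_eq hn hx

lemma IsBody.divPQtilde_eq (hK : IsBody K) (hn : 0 < n) (f : ℝ → ℝ) :
    divPQtilde f K = ratioDivergence f (coneMeasure K) (hessDet (energy K)) := by
  have h := hK.fDivergence_left hn f (p := densPtilde K) (q := densQtilde K) (c := 1) zero_le_one
    (fun _ hx => by rw [one_mul, densQtilde_eq hx])
    fun _ hx => by rw [one_mul, one_mul, hK.densPtilde_eq hn hx]
  simp only [ENNReal.ofReal_one, one_smul, one_mul] at h
  exact h

lemma IsBody.divQPtilde_eq (hK : IsBody K) (hn : 0 < n) (f : ℝ → ℝ) :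
    divQPtilde f K = ratioDivergence (adjointFun f) (coneMeasure K) (hessDet (energy K)) := by
  have h := hK.fDivergence_right hn f (p := densPtilde K) (q := densQtilde K) (c := 1) zero_le_one
    (fun _ hx => by rw [one_mul, densQtilde_eq hx])
    fun _ hx => by rw [one_mul, one_mul, hK.densPtilde_eq hn hx]
  simp only [ENNReal.ofReal_one, one_smul, one_mul] at h
  exact h

theorem IsBody.ratioDivergence_coneMeasure_ne_bot (hK : IsBody K) (hn : 0 < n) {f : ℝ → ℝ}
    (hf : ConvexOn ℝ (Ioi (0 : ℝ)) f) (a : ℝ) {c : ℝ} (hc : 0 ≤ c) :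
    ratioDivergence f (ENNReal.ofReal a • coneMeasure K)
      (fun x => c * hessDet (energy K) x) ≠ ⊥ := by
  have := hK.isFiniteMeasure_coneMeasure
  have : IsFiniteMeasure (ENNReal.ofReal a • coneMeasure K) :=
    Measure.smul_finite _ ENNReal.ofReal_ne_top
  refine ratioDivergence_ne_bot hf
    (fun x => mul_nonneg hc (hessDet_nonneg hK.convexOn_energy x)) ?_
  rw [lintegral_smul_measure, smul_eq_mul]
  refine ENNReal.mul_ne_top ENNReal.ofReal_ne_top ?_
  simp_rw [ENNReal.ofReal_mul hc]
  rw [lintegral_const_mul' _ _ ENNReal.ofReal_ne_top]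
  exact ENNReal.mul_ne_top ENNReal.ofReal_ne_top (hK.lintegral_hessDet_coneMeasure_ne_top hn)

theorem ratioDivergence_image_normalized (hK : IsBody K) (f : ℝ → ℝ) (T : Euc n ≃ₗ[ℝ] Euc n) :
    ratioDivergence f (ENNReal.ofReal (n * vol (T '' K))⁻¹ • coneMeasure (T '' K))
        (fun x => vol (T '' K) / vol (polarBody (T '' K)) * hessDet (energy (T '' K)) x)
      = ratioDivergence f (ENNReal.ofReal (n * vol K)⁻¹ • coneMeasure K)
        (fun x => vol K / vol (polarBody K) * hessDet (energy K) x) := by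
  have hd := abs_pos.mpr (linearEquiv_det_ne_zero T)
  refine ratioDivergence_image hK T f ?_ ?_
  · rw [← ENNReal.ofReal_mul (inv_nonneg.mpr (mul_nonneg n.cast_nonneg (vol_nonneg _))), vol_image]
    congr 1
    simp only [mul_inv]
    field_simp
  · rw [vol_image, vol_polarBody_image, ← sq_abs]
    simp only [div_eq_mul_inv, mul_inv]
    field_simp

lemma ratioDivergence_image_of_det_eq_one (hK : IsBody K) (f : ℝ → ℝ) {T : Euc n ≃ₗ[ℝ] Euc n}
    (hT : LinearMap.det (T : Euc n →ₗ[ℝ] Euc n) = 1) :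
    ratioDivergence f (coneMeasure (T '' K)) (hessDet (energy (T '' K)))
      = ratioDivergence f (coneMeasure K) (hessDet (energy K)) := by
  have h := ratioDivergence_image hK T f (a := 1) (a' := 1) (c := 1) (c' := 1)
    (by simp [hT]) (by simp [hT])
  simpa only [one_smul, one_mul] using h

end Reduction

/-! ### Dimension zero -/

section DimensionZero

/-- A zero-dimensional space has no unit vectors, hence no normals and no boundary points. -/
lemma fDivergence_surfaceMeasure_eq_zero {K : Set (Euc 0)} (hK : IsBody K) (f : ℝ → ℝ)
    (p q : Euc 0 → ℝ) : fDivergence f (surfaceMeasure K) p q = 0 := by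
  have h : frontier K = ∅ := by
    refine eq_empty_of_forall_notMem fun x hx => ?_
    obtain ⟨u, hu, -⟩ := hK.exists_normal hx
    rw [Subsingleton.elim u 0, norm_zero] at hu
    exact zero_ne_one hu
  have h0 : surfaceMeasure K = 0 := by rw [surfaceMeasure, h, Measure.restrict_empty]
  rw [h0, fDivergence]
  simp [eintegral, densityMeasure]

end DimensionZero

end BodyDivergence

end

/-! ### The main theorem -/

open BodyDivergence

theorem mainTheorem2 (n : ℕ) (f : ℝ → ℝ) (hf : ConvexOn ℝ (Set.Ioi (0 : ℝ)) f) :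
    (BodyDivergence.IsProperOnBodies (n := n) (BodyDivergence.divPQ f) ∧
      BodyDivergence.IsProperOnBodies (n := n) (BodyDivergence.divQP f) ∧
      BodyDivergence.IsProperOnBodies (n := n) (BodyDivergence.divPQtilde f) ∧
      BodyDivergence.IsProperOnBodies (n := n) (BodyDivergence.divQPtilde f)) ∧
    (BodyDivergence.IsGLInvariant (n := n) (BodyDivergence.divPQ f) ∧
      BodyDivergence.IsGLInvariant (n := n) (BodyDivergence.divQP f)) ∧
    (BodyDivergence.IsSLInvariant (n := n) (BodyDivergence.divPQtilde f) ∧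
      BodyDivergence.IsSLInvariant (n := n) (BodyDivergence.divQPtilde f)) ∧
    (BodyDivergence.IsBodyValuation (n := n) (BodyDivergence.divPQtilde f) ∧
      BodyDivergence.IsBodyValuation (n := n) (BodyDivergence.divQPtilde f)) := by
  -- The cone formulas need n > 0; for n = 0 all divergences vanish.
  rcases Nat.eq_zero_or_pos n with rfl | hn
  · have hzero : ∀ K : Set (Euc 0), IsBody K → divPQ f K = 0 ∧ divQP f K = 0 ∧
        divPQtilde f K = 0 ∧ divQPtilde f K = 0 := fun K hK =>
      ⟨fDivergence_surfaceMeasure_eq_zero hK f _ _, fDivergence_surfaceMeasure_eq_zero hK f _ _,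
        fDivergence_surfaceMeasure_eq_zero hK f _ _, fDivergence_surfaceMeasure_eq_zero hK f _ _⟩
    refine ⟨⟨fun K hK => ?_, fun K hK => ?_, fun K hK => ?_, fun K hK => ?_⟩,
      ⟨fun K hK T => ?_, fun K hK T => ?_⟩, ⟨fun K hK T _ => ?_, fun K hK T _ => ?_⟩,
      fun K L hK hL hKL => ?_, fun K L hK hL hKL => ?_⟩
    · rw [(hzero K hK).1]; exact EReal.zero_ne_bot
    · rw [(hzero K hK).2.1]; exact EReal.zero_ne_bot
    · rw [(hzero K hK).2.2.1]; exact EReal.zero_ne_bot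
    · rw [(hzero K hK).2.2.2]; exact EReal.zero_ne_bot
    · rw [(hzero K hK).1, (hzero _ (hK.image T)).1]
    · rw [(hzero K hK).2.1, (hzero _ (hK.image T)).2.1]
    · rw [(hzero K hK).2.2.1, (hzero _ (hK.image T)).2.2.1]
    · rw [(hzero K hK).2.2.2, (hzero _ (hK.image T)).2.2.2]
    · rw [(hzero _ hKL).2.2.1, (hzero _ (hK.inter hL)).2.2.1, (hzero K hK).2.2.1,
        (hzero L hL).2.2.1]
    · rw [(hzero _ hKL).2.2.2, (hzero _ (hK.inter hL)).2.2.2, (hzero K hK).2.2.2,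
        (hzero L hL).2.2.2]
  have hf' := convexOn_adjointFun hf
  refine ⟨⟨fun K hK => ?_, fun K hK => ?_, fun K hK => ?_, fun K hK => ?_⟩,
    ⟨fun K hK T => ?_, fun K hK T => ?_⟩, ⟨fun K hK T hT => ?_, fun K hK T hT => ?_⟩,
    fun K L hK hL hKL => ?_, fun K L hK hL hKL => ?_⟩
  · rw [hK.divPQ_eq hn]
    exact hK.ratioDivergence_coneMeasure_ne_bot hn hf _ (div_nonneg (vol_nonneg _) (vol_nonneg _))
  · rw [hK.divQP_eq hn]
    exact hK.ratioDivergence_coneMeasure_ne_bot hn hf' _ (div_nonneg (vol_nonneg _) (vol_nonneg _))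
  · rw [hK.divPQtilde_eq hn]
    simpa using hK.ratioDivergence_coneMeasure_ne_bot hn hf 1 zero_le_one
  · rw [hK.divQPtilde_eq hn]
    simpa using hK.ratioDivergence_coneMeasure_ne_bot hn hf' 1 zero_le_one
  · rw [hK.divPQ_eq hn, (hK.image T).divPQ_eq hn, ratioDivergence_image_normalized hK]
  · rw [hK.divQP_eq hn, (hK.image T).divQP_eq hn, ratioDivergence_image_normalized hK]
  · rw [hK.divPQtilde_eq hn, (hK.image T).divPQtilde_eq hn,
      ratioDivergence_image_of_det_eq_one hK f hT]
  · rw [hK.divQPtilde_eq hn, (hK.image T).divQPtilde_eq hn,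
      ratioDivergence_image_of_det_eq_one hK _ hT]
  · rw [hKL.divPQtilde_eq hn, (hK.inter hL).divPQtilde_eq hn, hK.divPQtilde_eq hn,
      hL.divPQtilde_eq hn, ratioDivergence_union_add_inter hK hL hKL hn hf]
  · rw [hKL.divQPtilde_eq hn, (hK.inter hL).divQPtilde_eq hn, hK.divQPtilde_eq hn,
      hL.divQPtilde_eq hn, ratioDivergence_union_add_inter hK hL hKL hn hf']
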